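/- Let $F$ be a finite field, $\gamma$ a generator of $F^*$, $m\ge 1$, $k\ge 1$, $1\le s\le m$ and $r\ge 1$ integers. Put $N=\lfloor(|F|-1)/m\rfloor$ and $n=Nm$. The $m$-folded Reed–Solomon code $\mathsf{FRS}_{F,\gamma,m,k}\subseteq(F^m)^N$ consists of the words whose $j$-th symbol, $0\le j<N$, is $(f(\gamma^{jm}),f(\gamma^{jm+1}),\dots,f(\gamma^{jm+m-1}))$, for polynomials $f\in F[X]$ of degree at most $k$. For a received word $z\in(F^m)^N$ let $y_{jm+l}=z_{j,l}$ ($0\le j<N$, $0\le l<m$), let $I$ be the set of $i\in\{0,\dots,n-1\}$ with $i \bmod m\le m-s$, let $n_0=|I|=N(m-s+1)$, and let $$D=\Big\lfloor\big(k^s n_0\, r(r+1)\cdots(r+s)\big)^{1/(s+1)}\Big\rfloor+1 .$$ The $(s+1)$-variate FRS decoder with multiplicity parameter $r$ and agreement parameter $t$ (an integer) first finds a nonzero $Q\in F[X,Y_1,\dots,Y_s]$ of $(1,k,\dots,k)$-weighted degree at most $D$ that has a zero of multiplicity $r$ at $(\gamma^i,y_i,y_{i+1},\dots,y_{i+s-1})$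 for every $i\in I$. It then outputs the list, without repetitions, of all $f\in F[X]$ of degree at most $k$ with $Q(X,f(X),f(\gamma X),\dots,f(\gamma^{s-1}X))=0$ whose encoding agrees with $z$ in at least $t$ of the $N$ positions. **Theorem.** Suppose that $t\le N$ and $$t\ \ge\ \left(N\Big(\frac{k}{m-s+1}\Big)^{s}\prod_{j=1}^{s}\Big(1+\frac jr\Big)\right)^{1/(s+1)}+2 .$$ Then for every received word $z$ a polynomial $Q$ as above exists, and for every such $Q$ the encodings of the polynomials in the output list are exactly the codewords of $\mathsf{FRS}_{F,\gamma,m,k}$ within Hamming distance $N-t$ of $z$; the list has at most $|F|^s$ elements. Moreover, there is a single deterministic algorithm and an absolute constant $C$ such that, whenever in addition $D/k<|F|$, the algorithm carries out the decoder in at most $n^{Cs}$ steps: given the operation tables of $F$ (for any numbering of its elements), $\gamma$, $m,k,s,r,t$ (written in unary) and $z$, it outputs such a polynomial $Q$ and the corresponding list. Steps are counted on a pointer machine acting on binary trees, where every elementary operation has unit cost. -/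

import Mathlib

namespace FRS

/-! ### Model of computation

A pointer machine on binary trees.  A program transforms one tree into another; every primitive
operation (returning the empty tree, taking a component of a pair, forming a pair, composing,
branching on emptiness, testing a loop) costs one step.  Trees are shared, never copied, so each
step is a bounded amount of work on a random access machine. -/

/-- Binary trees, the data on which programs act. -/
inductive DataTree : Type
  | nil : DataTree
  | cons : DataTree → DataTree → DataTree

namespace DataTree

/-- Left component; the empty tree has empty components. -/
def left : DataTree → DataTree
  | nil => nil
  | cons a _ => a

/-- Right component; the empty tree has empty components. -/
def right : DataTree → DataTree
  | nil => nil
  | cons _ b => b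

/-- Natural numbers are written in unary. -/
def ofNat : ℕ → DataTree
  | 0 => nil
  | n + 1 => cons nil (ofNat n)

/-- Lists are written as right-nested pairs ending in the empty tree. -/
def ofList : List DataTree → DataTree
  | [] => nil
  | a :: l => cons a (ofList l)

end DataTree

/-- Programs. `comp p q` runs `p`, then `q`; `cond c p q` runs `p` if `c` yields a nonempty tree and
`q` otherwise; `loop c p` replaces the current tree by its image under `p` as long as `c` yields a
nonempty tree. -/
inductive Prog : Type
  | nil : Prog
  | id : Prog
  | left : Prog
  | right : Prog
  | pair : Prog → Prog → Prog
  | comp : Prog → Prog → Prog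
  | cond : Prog → Prog → Prog → Prog
  | loop : Prog → Prog → Prog

/-- `Run p x y n`: started on `x`, the program `p` halts with result `y` after exactly `n` steps. -/
inductive Run : Prog → DataTree → DataTree → ℕ → Prop
  | nil (x : DataTree) : Run Prog.nil x DataTree.nil 1
  | id (x : DataTree) : Run Prog.id x x 1
  | left (x : DataTree) : Run Prog.left x x.left 1
  | right (x : DataTree) : Run Prog.right x x.right 1
  | pair {p q : Prog} {x y z : DataTree} {a b : ℕ} :
      Run p x y a → Run q x z b → Run (Prog.pair p q) x (DataTree.cons y z) (a + b + 1)
  | comp {p q : Prog} {x y z : DataTree} {a b : ℕ} :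
      Run p x y a → Run q y z b → Run (Prog.comp p q) x z (a + b + 1)
  | cond_true {c p q : Prog} {x u v y : DataTree} {a b : ℕ} :
      Run c x (DataTree.cons u v) a → Run p x y b → Run (Prog.cond c p q) x y (a + b + 1)
  | cond_false {c p q : Prog} {x y : DataTree} {a b : ℕ} :
      Run c x DataTree.nil a → Run q x y b → Run (Prog.cond c p q) x y (a + b + 1)
  | loop_done {c p : Prog} {x : DataTree} {a : ℕ} :
      Run c x DataTree.nil a → Run (Prog.loop c p) x x (a + 1)
  | loop_step {c p : Prog} {x u v y z : DataTree} {a b d : ℕ} :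
      Run c x (DataTree.cons u v) a → Run p x y b → Run (Prog.loop c p) y z d →
      Run (Prog.loop c p) x z (a + b + d + 1)

/-- Programs are deterministic: the result and the number of steps are determined by the input. -/
theorem Run.deterministic {p : Prog} {x y : DataTree} {n : ℕ} (h : Run p x y n) :
    ∀ {y' : DataTree} {n' : ℕ}, Run p x y' n' → y = y' ∧ n = n' := by
  induction h with
  | nil x => intro y' n' h; cases h; exact ⟨rfl, rfl⟩
  | id x => intro y' n' h; cases h; exact ⟨rfl, rfl⟩
  | left x => intro y' n' h; cases h; exact ⟨rfl, rfl⟩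
  | right x => intro y' n' h; cases h; exact ⟨rfl, rfl⟩
  | pair _ _ ih1 ih2 =>
    intro y' n' h
    cases h with
    | pair g1 g2 =>
      obtain ⟨rfl, rfl⟩ := ih1 g1
      obtain ⟨rfl, rfl⟩ := ih2 g2
      exact ⟨rfl, rfl⟩
  | comp _ _ ih1 ih2 =>
    intro y' n' h
    cases h with
    | comp g1 g2 =>
      obtain ⟨rfl, rfl⟩ := ih1 g1
      obtain ⟨rfl, rfl⟩ := ih2 g2
      exact ⟨rfl, rfl⟩
  | cond_true _ _ ih1 ih2 =>
    intro y' n' h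
    cases h with
    | cond_true g1 g2 =>
      obtain ⟨_, rfl⟩ := ih1 g1
      obtain ⟨rfl, rfl⟩ := ih2 g2
      exact ⟨rfl, rfl⟩
    | cond_false g1 g2 => exact absurd (ih1 g1).1 (by simp)
  | cond_false _ _ ih1 ih2 =>
    intro y' n' h
    cases h with
    | cond_true g1 g2 => exact absurd (ih1 g1).1 (by simp)
    | cond_false g1 g2 =>
      obtain ⟨_, rfl⟩ := ih1 g1
      obtain ⟨rfl, rfl⟩ := ih2 g2
      exact ⟨rfl, rfl⟩
  | loop_done _ ih1 =>
    intro y' n' h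
    cases h with
    | loop_done g1 =>
      obtain ⟨_, rfl⟩ := ih1 g1
      exact ⟨rfl, rfl⟩
    | loop_step g1 g2 g3 => exact absurd (ih1 g1).1 (by simp)
  | loop_step _ _ _ ih1 ih2 ih3 =>
    intro y' n' h
    cases h with
    | loop_done g1 => exact absurd (ih1 g1).1 (by simp)
    | loop_step g1 g2 g3 =>
      obtain ⟨_, rfl⟩ := ih1 g1
      obtain ⟨rfl, rfl⟩ := ih2 g2
      obtain ⟨rfl, rfl⟩ := ih3 g3
      exact ⟨rfl, rfl⟩

noncomputable section

/-! ### Folded Reed-Solomon codes -/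

/-- Block length `N = n / m`, where `n` is the largest multiple of `m` with `n ≤ |F| - 1`. -/
def blockLength (F : Type*) [Fintype F] (m : ℕ) : ℕ := (Fintype.card F - 1) / m

/-- Length `n = N m` of the unfolded code. -/
def unfoldedLength (F : Type*) [Fintype F] (m : ℕ) : ℕ := blockLength F m * m

section

variable {F : Type*} [Field F] [Fintype F]

/-- Folded Reed-Solomon encoding: symbol `j` is `(f(γ^(jm)), …, f(γ^(jm+m-1)))`. -/
def encode (γ : Fˣ) (m : ℕ) (f : Polynomial F) : Fin (blockLength F m) → Fin m → F :=
  fun j l => f.eval ((γ : F) ^ (j.val * m + l.val))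

/-- The folded Reed-Solomon code: encodings of the polynomials of degree at most `k`. -/
def code (γ : Fˣ) (m k : ℕ) : Set (Fin (blockLength F m) → Fin m → F) :=
  {c | ∃ f : Polynomial F, f.natDegree ≤ k ∧ encode γ m f = c}

/-- The unfolded received word: `y_(jm+l) = z_(j,l)` for `j < N`, `l < m` (and `0` past the end,
where it is never used). -/
def unfold {m : ℕ} (z : Fin (blockLength F m) → Fin m → F) (i : ℕ) : F :=
  if h : i < m * blockLength F m then
    z ⟨i / m, Nat.div_lt_of_lt_mul h⟩
      ⟨i % m, Nat.mod_lt i (Nat.pos_of_ne_zero (by rintro rfl; simp at h))⟩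
  else 0

/-- Number of positions in which the encoding of `f` agrees with `z`. -/
def agreement [DecidableEq F] (γ : Fˣ) {m : ℕ} (z : Fin (blockLength F m) → Fin m → F)
    (f : Polynomial F) : ℕ :=
  (Finset.univ.filter fun j => encode γ m f j = z j).card

/-! ### The `(s+1)`-variate interpolation decoder

Polynomials `Q(X, Y₁, …, Y_s)` have variables indexed by `Fin (s + 1)`, with `X` at index `0`. -/

/-- Weights `(1, k, …, k)`. -/
def weight (s k : ℕ) : Fin (s + 1) → ℕ := Fin.cons 1 fun _ => k

/-- `Q` has a zero of multiplicity (at least) `r` at `a`: the polynomial `Q(· + a)` has no monomial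
of degree less than `r`. -/
def HasZeroOfMult {σ : Type*} (Q : MvPolynomial σ F) (a : σ → F) (r : ℕ) : Prop :=
  ∀ d : σ →₀ ℕ, d.degree < r →
    (MvPolynomial.aeval (fun i => MvPolynomial.X i + MvPolynomial.C (a i)) Q :
      MvPolynomial σ F).coeff d = 0

variable (F) in
/-- Interpolation indices: `{0, …, n - 1}` without the `jm + m - s + 1, …, jm + m - 1` for `j < N`,
that is, the indices whose remainder modulo `m` is at most `m - s`. -/
def interpIndices (m s : ℕ) : Finset ℕ :=
  (Finset.range (unfoldedLength F m)).filter fun i => i % m ≤ m - s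

variable (F) in
/-- The degree parameter `D = ⌊(k^s n₀ r (r+1) ⋯ (r+s))^(1/(s+1))⌋ + 1`, where `n₀` is the number of
interpolation points. -/
def interpDegree (m k s r : ℕ) : ℕ :=
  ⌊((k : ℝ) ^ s * ((interpIndices F m s).card : ℝ) *
      ∏ j ∈ Finset.range (s + 1), ((r : ℝ) + (j : ℝ))) ^ ((1 : ℝ) / ((s : ℝ) + 1))⌋₊ + 1

/-- The outcome of the interpolation step: a nonzero polynomial of `(1, k, …, k)`-weighted degree at
most `D` that has a zero of multiplicity `r` at `(γ^i, y_i, …, y_(i+s-1))` for all interpolation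
indices `i`. -/
def IsInterpolant (γ : Fˣ) (k s r : ℕ) {m : ℕ} (z : Fin (blockLength F m) → Fin m → F)
    (Q : MvPolynomial (Fin (s + 1)) F) : Prop :=
  Q ≠ 0 ∧ Q.weightedTotalDegree (weight s k) ≤ interpDegree F m k s r ∧
    ∀ i ∈ interpIndices F m s,
      HasZeroOfMult Q (Fin.cons ((γ : F) ^ i) fun j : Fin s => unfold z (i + j.val)) r

/-- The univariate polynomial `Q(X, f(X), f(γX), …, f(γ^(s-1) X))`. -/
def substitute (γ : Fˣ) {s : ℕ} (Q : MvPolynomial (Fin (s + 1)) F) (f : Polynomial F) :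
    Polynomial F :=
  MvPolynomial.aeval
    (Fin.cons Polynomial.X fun j : Fin s =>
      f.comp (Polynomial.C ((γ : F) ^ j.val) * Polynomial.X) : Fin (s + 1) → Polynomial F) Q

/-- A run of the decoder on the received word `z`: it finds an interpolating polynomial `Q`, and
outputs the list (without repetitions) of all `f` of degree at most `k` that satisfy
`Q(X, f(X), …, f(γ^(s-1) X)) = 0` and whose encoding agrees with `z` in at least `t` positions. -/
def IsDecoderRun [DecidableEq F] (γ : Fˣ) (k s r t : ℕ) {m : ℕ}
    (z : Fin (blockLength F m) → Fin m → F) (Q : MvPolynomial (Fin (s + 1)) F)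
    (L : List (Polynomial F)) : Prop :=
  IsInterpolant γ k s r z Q ∧ L.Nodup ∧
    ∀ f : Polynomial F, f ∈ L ↔
      f.natDegree ≤ k ∧ substitute γ Q f = 0 ∧ t ≤ agreement γ z f

/-! ### Input and output of the decoder on the machine

The field is given by its operation tables with respect to a numbering `e` of its elements. -/

/-- A field element is written as its number. -/
def encElem (e : F ≃ Fin (Fintype.card F)) (a : F) : DataTree := DataTree.ofNat (e a).val

/-- The table of a unary operation. -/
def encTable₁ (e : F ≃ Fin (Fintype.card F)) (op : F → F) : DataTree :=
  DataTree.ofList (List.ofFn fun i => encElem e (op (e.symm i)))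

/-- The table of a binary operation. -/
def encTable₂ (e : F ≃ Fin (Fintype.card F)) (op : F → F → F) : DataTree :=
  DataTree.ofList (List.ofFn fun i => encTable₁ e (op (e.symm i)))

/-- The received word, as a list of `N` lists of `m` field elements. -/
def encWord (e : F ≃ Fin (Fintype.card F)) {m : ℕ} (z : Fin (blockLength F m) → Fin m → F) :
    DataTree :=
  DataTree.ofList (List.ofFn fun j =>
    DataTree.ofList (List.ofFn fun l => encElem e (z j l)))

/-- The input: the field, its generator `γ`, the numerical parameters, and the received word. -/
def encInput (e : F ≃ Fin (Fintype.card F)) (γ : Fˣ) (k s r t : ℕ) {m : ℕ}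
    (z : Fin (blockLength F m) → Fin m → F) : DataTree :=
  DataTree.ofList
    [encElem e 0, encElem e 1, encTable₂ e (fun a b => a + b), encTable₂ e (fun a b => a * b),
      encTable₁ e (fun a => -a), encTable₁ e (fun a => a⁻¹), encElem e (γ : F),
      DataTree.ofNat m, DataTree.ofNat k, DataTree.ofNat s, DataTree.ofNat r, DataTree.ofNat t,
      encWord e z]

/-- A polynomial of degree at most `k`, as the list of its `k + 1` coefficients. -/
def encPoly (e : F ≃ Fin (Fintype.card F)) (k : ℕ) (f : Polynomial F) : DataTree :=
  DataTree.ofList (List.ofFn fun i : Fin (k + 1) => encElem e (f.coeff i.val))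

/-- The polynomial in several variables given by a list of terms (exponents and coefficient). -/
def ofTerms {s : ℕ} (T : List ((Fin (s + 1) →₀ ℕ) × F)) : MvPolynomial (Fin (s + 1)) F :=
  (T.map fun p => MvPolynomial.monomial p.1 p.2).sum

/-- A list of terms; a term is the list of its `s + 1` exponents, paired with its coefficient. -/
def encTerms (e : F ≃ Fin (Fintype.card F)) {s : ℕ} (T : List ((Fin (s + 1) →₀ ℕ) × F)) :
    DataTree :=
  DataTree.ofList (T.map fun p =>
    DataTree.cons (DataTree.ofList (List.ofFn fun i => DataTree.ofNat (p.1 i))) (encElem e p.2))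

/-- The output: the interpolating polynomial, as a list of terms, and the list of messages. -/
def encOutput (e : F ≃ Fin (Fintype.card F)) (k : ℕ) {s : ℕ}
    (T : List ((Fin (s + 1) →₀ ℕ) × F)) (L : List (Polynomial F)) : DataTree :=
  DataTree.cons (encTerms e T) (DataTree.ofList (L.map (encPoly e k)))

end

end

end FRS

/-!
**Interpolation.** A zero of multiplicity `r` at each interpolation point amounts to a homogeneous
linear system for the coefficients of `Q`, and the choice of `D` makes the number of monomials of
weighted degree at most `D` exceed the number of equations (`exists_interpolates`). If the encoding
of `f` agrees with `z` in `t` positions, then `Q(X, f(X), …, f(γ^(s-1) X))` has zeros of multiplicity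
`r` at `t (m - s + 1)` powers of `γ`, which is too many for its degree, so that it vanishes
(`substitute_eq_zero`). Hence every codeword close to `z` is found, for every choice of `Q`.

**The extension field.** The polynomial `X ^ (q - 1) - γ`, with `q = |F|`, is irreducible over `F`.
In the extension `K` by a root `ξ` the substitution of `γ X` for `X` becomes the Frobenius map:
`f(γ ξ) = f(ξ) ^ q`. So `Q(X, f(X), …, f(γ^(s-1) X)) = 0` implies that `f(ξ)` is a zero of the
univariate polynomial `T = Q(ξ, Y, Y ^ q, …, Y ^ (q ^ (s - 1)))`, called `collapse ξ Q`. If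
`D < k q`, the exponents of the `Y_i` are digits in base `q`, whence `deg T < q ^ s`. It can happen
that `T = 0`, namely if the minimal polynomial of `ξ` divides `Q`; dividing by it does not affect the
multiplicities, because it does not vanish at the interpolation points (`exists_collapse_ne_zero`).
As `f` is determined by `f(ξ)`, there are fewer than `q ^ s` close codewords
(`card_le_of_interpolates`). This bound does not refer to the decoder, so that it may be obtained from
any multiplicity and degree: if `D < k q` fails for the given parameters, others are available
(`exists_parameters`), since the hypothesis on `t` has the slack `2`.

**The algorithm.** The polynomial `Q` is found by Gaussian elimination. To have `T ≠ 0`, the whole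
solution space is computed: by the above it contains a `Q` with `T ≠ 0`, and then so does each set
of vectors that spans it. The zeros of `T` of the form `f(ξ)` with `deg f ≤ k` are found without
factoring `T`: the coefficients of `f` are determined one after the other, from the highest to the
lowest. To decide whether some `f` with prescribed
coefficients of index at least `j` gives a zero, consider the quotient of `K[Y]` by `T`, with `y` the
class of `Y` (to avoid divisions, `T` is replaced by a monic polynomial, whose zeros are those of `T`
times its leading coefficient); then `y - f(ξ)` is a unit unless `f(ξ)` is a zero, and the question is
whether the product of `y - f(ξ)` over all these `f` is a non-unit. This is a product over an affine
space over `F`, the value of an additive polynomial, and it is computed in `j` steps by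
`∏ (x - a c) = x ^ q - c ^ (q - 1) x`, with `a` running through `F` (`towerNorm_succ`). It is a
non-unit if and only if the matrix of the multiplication by it is singular. At each stage there are
at most `deg T < q ^ s` candidates, since each extends to a zero (`length_le_natDegree`), and so the
search takes polynomial time (`search_spec`, `Setting.isDecoderRun`).

**Running time.** All quantities are described by explicit formulas, as functions of the parameters
and of finitely many indices. Predicates `Fast`, `FN`, `FB`, `FE`, `FVec`, `FMat` say that a tree,
number, truth value, field element, vector or matrix depending on the input is computed by one
program in time polynomial in `n ^ s`. They are closed under composition, iteration, sums, arithmetic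
and Gaussian elimination; hence the program is obtained by following the formulas (`exists_prog`).
-/

namespace FRS

/-! ### Programs with polynomially bounded running time -/

/-- `a` is bounded by a fixed power of `μ + 2`. -/
def PolyBounded {Γ : Type*} (μ a : Γ → ℕ) : Prop := ∃ c : ℕ, ∀ γ, a γ ≤ (μ γ + 2) ^ c

namespace PolyBounded

variable {Γ : Type*} {μ a b : Γ → ℕ}

theorem mono (hb : PolyBounded μ b) (h : ∀ γ, a γ ≤ b γ) : PolyBounded μ a :=
  let ⟨c, hc⟩ := hb
  ⟨c, fun γ => (h γ).trans (hc γ)⟩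

theorem const (n : ℕ) : PolyBounded μ fun _ => n :=
  ⟨n, fun γ => (Nat.lt_two_pow_self).le.trans (Nat.pow_le_pow_left (by omega) n)⟩

theorem mul (ha : PolyBounded μ a) (hb : PolyBounded μ b) :
    PolyBounded μ fun γ => a γ * b γ := by
  obtain ⟨c, hc⟩ := ha
  obtain ⟨d, hd⟩ := hb
  exact ⟨c + d, fun γ => (pow_add (μ γ + 2) c d) ▸ Nat.mul_le_mul (hc γ) (hd γ)⟩

theorem add (ha : PolyBounded μ a) (hb : PolyBounded μ b) :
    PolyBounded μ fun γ => a γ + b γ := by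
  obtain ⟨c, hc⟩ := ha
  obtain ⟨d, hd⟩ := hb
  refine ⟨c + d + 1, fun γ => ?_⟩
  have h1 := Nat.pow_le_pow_right (n := μ γ + 2) (by omega) (Nat.le_add_right c d)
  have h2 := Nat.pow_le_pow_right (n := μ γ + 2) (by omega) (Nat.le_add_left d c)
  have h3 := Nat.mul_le_mul_left ((μ γ + 2) ^ (c + d)) (show 2 ≤ μ γ + 2 by omega)
  have := hc γ
  have := hd γ
  rw [pow_succ]
  show a γ + b γ ≤ _
  omega

theorem pow (ha : PolyBounded μ a) (n : ℕ) : PolyBounded μ fun γ => a γ ^ n := by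
  obtain ⟨c, hc⟩ := ha
  exact ⟨c * n, fun γ => (pow_mul (μ γ + 2) c n) ▸ Nat.pow_le_pow_left (hc γ) n⟩

theorem self : PolyBounded μ μ := ⟨1, fun _ => by simp⟩

theorem comp {Δ : Type*} (ha : PolyBounded μ a) (f : Δ → Γ) :
    PolyBounded (fun δ => μ (f δ)) fun δ => a (f δ) :=
  let ⟨c, hc⟩ := ha
  ⟨c, fun δ => hc (f δ)⟩

end PolyBounded

/-- One program computes `out γ` from `inp γ`, for all `γ`, in time polynomial in `μ γ`. -/
def Computes {Γ : Type*} (μ : Γ → ℕ) (inp out : Γ → DataTree) : Prop :=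
  ∃ P : Prog, ∃ τ : Γ → ℕ, PolyBounded μ τ ∧ ∀ γ, ∃ n, n ≤ τ γ ∧ Run P (inp γ) (out γ) n

namespace DataTree

/-- The number of elements of a tree read as a list. -/
def len : DataTree → ℕ
  | nil => 0
  | cons _ b => b.len + 1

/-- The tree without its first `i` list elements. -/
def drop (x : DataTree) (i : ℕ) : DataTree := right^[i] x

theorem drop_succ (x : DataTree) (i : ℕ) : x.drop (i + 1) = (x.drop i).right :=
  Function.iterate_succ_apply' _ _ _

theorem len_right (x : DataTree) : x.right.len = x.len - 1 := by cases x <;> simp [right, len]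

theorem len_drop (x : DataTree) (i : ℕ) : (x.drop i).len = x.len - i := by
  induction i with
  | zero => simp [drop]
  | succ i ih => rw [drop_succ, len_right, ih]; omega

theorem eq_nil_iff_len {x : DataTree} : x = nil ↔ x.len = 0 := by cases x <;> simp [len]

theorem drop_len (x : DataTree) : x.drop x.len = nil := by
  rw [eq_nil_iff_len, len_drop]; omega

theorem exists_cons_of_ne_nil {x : DataTree} (h : x ≠ nil) : ∃ u v, x = cons u v := by
  cases x with
  | nil => exact absurd rfl h
  | cons u v => exact ⟨u, v, rfl⟩

@[simp] theorem len_ofNat (n : ℕ) : (ofNat n).len = n := by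
  induction n with
  | zero => rfl
  | succ n ih => simp [ofNat, len, ih]

@[simp] theorem len_ofList (l : List DataTree) : (ofList l).len = l.length := by
  induction l with
  | nil => rfl
  | cons a l ih => simp [ofList, len, ih]

theorem right_ofNat (n : ℕ) : (ofNat n).right = ofNat (n - 1) := by cases n <;> rfl

end DataTree

open DataTree

/-- A loop that passes through the states `st 0, …, st d`. -/
theorem Run.loop_of_states {c p : Prog} {st : ℕ → DataTree} {d A : ℕ}
    (hc : ∀ i < d, ∃ u v, ∃ n ≤ A, Run c (st i) (cons u v) n)
    (hd : ∃ n ≤ A, Run c (st d) DataTree.nil n)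
    (hp : ∀ i < d, ∃ n ≤ A, Run p (st i) (st (i + 1)) n) :
    ∃ n ≤ (d + 1) * (2 * A + 1), Run (Prog.loop c p) (st 0) (st d) n := by
  suffices H : ∀ j ≤ d, ∃ n ≤ (j + 1) * (2 * A + 1),
      Run (Prog.loop c p) (st (d - j)) (st d) n by
    simpa using H d le_rfl
  intro j
  induction j with
  | zero =>
    intro _
    obtain ⟨n, hn, h⟩ := hd
    exact ⟨n + 1, by omega, .loop_done h⟩
  | succ j ih =>
    intro hj
    obtain ⟨n1, h1, r1⟩ := ih (by omega)
    obtain ⟨u, v, n2, h2, r2⟩ := hc (d - (j + 1)) (by omega)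
    obtain ⟨n3, h3, r3⟩ := hp (d - (j + 1)) (by omega)
    rw [show d - (j + 1) + 1 = d - j by omega] at r3
    refine ⟨n2 + n3 + n1 + 1, ?_, .loop_step r2 r3 r1⟩
    nlinarith

namespace Computes

variable {Γ : Type*} {μ : Γ → ℕ} {inp mid out a b : Γ → DataTree}

theorem nil : Computes μ inp fun _ => DataTree.nil :=
  ⟨.nil, _, .const 1, fun _ => ⟨1, le_rfl, .nil _⟩⟩

theorem id : Computes μ inp inp := ⟨.id, _, .const 1, fun _ => ⟨1, le_rfl, .id _⟩⟩

theorem comp (h : Computes μ inp mid) (h' : Computes μ mid out) : Computes μ inp out := by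
  obtain ⟨P, τ, hτ, hP⟩ := h
  obtain ⟨P', τ', hτ', hP'⟩ := h'
  refine ⟨.comp P P', _, (hτ.add hτ').add (.const 1), fun γ => ?_⟩
  obtain ⟨n, hn, r⟩ := hP γ
  obtain ⟨n', hn', r'⟩ := hP' γ
  exact ⟨_, by omega, .comp r r'⟩

theorem left (h : Computes μ inp out) : Computes μ inp fun γ => (out γ).left :=
  h.comp ⟨.left, _, .const 1, fun _ => ⟨1, le_rfl, .left _⟩⟩

theorem right (h : Computes μ inp out) : Computes μ inp fun γ => (out γ).right :=
  h.comp ⟨.right, _, .const 1, fun _ => ⟨1, le_rfl, .right _⟩⟩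

theorem pair (h : Computes μ inp a) (h' : Computes μ inp b) :
    Computes μ inp fun γ => DataTree.cons (a γ) (b γ) := by
  obtain ⟨P, τ, hτ, hP⟩ := h
  obtain ⟨P', τ', hτ', hP'⟩ := h'
  refine ⟨.pair P P', _, (hτ.add hτ').add (.const 1), fun γ => ?_⟩
  obtain ⟨n, hn, r⟩ := hP γ
  obtain ⟨n', hn', r'⟩ := hP' γ
  exact ⟨_, by omega, .pair r r'⟩

open Classical in
theorem ite {c : Γ → DataTree} (h : Computes μ inp c) (ha : Computes μ inp a)
    (hb : Computes μ inp b) :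
    Computes μ inp fun γ => if c γ ≠ DataTree.nil then a γ else b γ := by
  obtain ⟨P, τ, hτ, hP⟩ := h
  obtain ⟨P1, τ1, hτ1, hP1⟩ := ha
  obtain ⟨P2, τ2, hτ2, hP2⟩ := hb
  refine ⟨.cond P P1 P2, _, ((hτ.add hτ1).add hτ2).add (.const 1), fun γ => ?_⟩
  obtain ⟨n, hn, r⟩ := hP γ
  obtain ⟨n1, hn1, r1⟩ := hP1 γ
  obtain ⟨n2, hn2, r2⟩ := hP2 γ
  by_cases hc : c γ = DataTree.nil
  · simp only [hc, ne_eq, not_true_eq_false, if_false]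
    rw [hc] at r
    exact ⟨_, by omega, .cond_false r r2⟩
  · simp only [hc, ne_eq, not_false_eq_true, if_true]
    obtain ⟨u, v, huv⟩ := exists_cons_of_ne_nil hc
    rw [huv] at r
    exact ⟨_, by omega, .cond_true r r1⟩

theorem reindex {Δ : Type*} (h : Computes μ inp out) (f : Δ → Γ) :
    Computes (fun δ => μ (f δ)) (fun δ => inp (f δ)) fun δ => out (f δ) :=
  let ⟨P, _, hτ, hP⟩ := h
  ⟨P, _, hτ.comp f, fun δ => hP (f δ)⟩

/-- Iteration over the elements of a list: in round `i` the body sees the input, the number `i` and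
the state `s γ i`, and produces `s γ (i + 1)`. -/
theorem iter {x : Γ → DataTree} {d : Γ → ℕ} {s : Γ → ℕ → DataTree}
    (hx : Computes μ inp x) (hxd : ∀ γ, (x γ).len = d γ) (hlen : PolyBounded μ d)
    (h0 : Computes μ inp fun γ => s γ 0)
    (hs : Computes (Γ := Σ γ, Fin (d γ)) (fun p => μ p.1)
      (fun p => DataTree.cons (inp p.1) (DataTree.cons (DataTree.ofNat p.2) (s p.1 p.2)))
      fun p => s p.1 (p.2 + 1)) :
    Computes μ inp fun γ => s γ (d γ) := by
  obtain rfl : (fun γ => (x γ).len) = d := funext hxd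
  -- the loop state consists of the input, the rest of the list, the counter and `s γ i`
  let st : Γ → ℕ → DataTree := fun γ i =>
    .cons (inp γ) (.cons ((x γ).drop i) (.cons (.ofNat i) (s γ i)))
  have hinit : Computes μ inp fun γ => st γ 0 := Computes.id.pair (hx.pair (nil.pair h0))
  have hloop : Computes μ (fun γ => st γ 0) fun γ => st γ (x γ).len := by
    have hbody : Computes (Γ := Σ γ, Fin (x γ).len) (fun p => μ p.1) (fun p => st p.1 p.2)
        (fun p => st p.1 (p.2 + 1)) := by
      have hid : Computes (Γ := Σ γ, Fin (x γ).len) (fun p => μ p.1) (fun p => st p.1 p.2)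
        (fun p => st p.1 p.2) := Computes.id
      have h1 := hid.left.pair (hid.right.left.right.pair
        ((nil.pair hid.right.right.left).pair ((hid.left.pair hid.right.right).comp hs)))
      simp only [st, drop_succ]
      exact h1
    obtain ⟨P, τ, ⟨c, hτ⟩, hP⟩ := hbody
    refine ⟨.loop (.comp .right .left) P, _, (hlen.add (.const 1)).mul
      (((PolyBounded.const 2).mul (PolyBounded.add
        (⟨c, fun _ => le_rfl⟩ : PolyBounded μ fun γ => (μ γ + 2) ^ c) (.const 3))).add (.const 1)),
      fun γ => ?_⟩
    refine Run.loop_of_states (st := st γ) (fun i hi => ?_) ?_ fun i hi => ?_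
    · have : (x γ).drop i ≠ DataTree.nil := by
        rw [Ne, eq_nil_iff_len, len_drop]; omega
      obtain ⟨u, v, huv⟩ := exists_cons_of_ne_nil this
      refine ⟨u, v, 3, by omega, ?_⟩
      have := Run.comp (Run.right (st γ i)) (Run.left _)
      simpa [st, DataTree.left, DataTree.right, huv] using this
    · refine ⟨3, by omega, ?_⟩
      have := Run.comp (Run.right (st γ (x γ).len)) (Run.left _)
      simpa [st, DataTree.left, DataTree.right, drop_len] using this
    · obtain ⟨n, hn, r⟩ := hP ⟨γ, ⟨i, hi⟩⟩
      have : τ ⟨γ, ⟨i, hi⟩⟩ ≤ (μ γ + 2) ^ c := hτ _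
      exact ⟨n, by omega, r⟩
  exact (hinit.comp hloop).right.right.right

end Computes

end FRS

namespace FRS
open DataTree

/-! ### Parameters of the decoder as contexts of programs -/

universe u

/-- The data on which the decoder runs, with the properties of the parameters on which its
correctness and its running time depend. -/
structure Setting where
  F : Type u
  [field : Field F]
  [fintype : Fintype F]
  [decEq : DecidableEq F]
  γ : Fˣ
  m : ℕ
  k : ℕ
  s : ℕ
  r : ℕ
  t : ℕ
  z : Fin (blockLength F m) → Fin m → F
  e : F ≃ Fin (Fintype.card F)
  one_le_k : 1 ≤ k
  one_le_s : 1 ≤ s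
  s_le : s ≤ m
  t_le : t ≤ blockLength F m
  three_le : 3 ≤ unfoldedLength F m
  k_lt : k < unfoldedLength F m
  r_le : r ≤ k * Fintype.card F
  one_le_r : 1 ≤ r
  gen : ∀ x : Fˣ, x ∈ Subgroup.zpowers γ
  interpDegree_lt : interpDegree F m k s r < k * Fintype.card F
  interpDegree_lt_agreement : interpDegree F m k s r < r * (t * (m - s + 1))

namespace Setting

attribute [instance] Setting.field Setting.fintype Setting.decEq

variable (S : Setting.{u})

/-- The number of field elements. -/
abbrev q : ℕ := Fintype.card S.F

/-- The number of symbols of a codeword. -/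
abbrev N : ℕ := blockLength S.F S.m

/-- The number of field elements in a codeword. -/
abbrev n : ℕ := unfoldedLength S.F S.m

/-- The quantity in terms of which running times are polynomial. -/
def budget : ℕ := S.n ^ S.s

/-- The input of the decoder. -/
def input : DataTree := encInput S.e S.γ S.k S.s S.r S.t S.z

theorem N_pos : 0 < S.N := by
  have h : 3 ≤ S.N * S.m := S.three_le
  exact Nat.pos_of_ne_zero fun h0 => by simp [h0] at h

theorem m_le : S.m ≤ S.n := Nat.le_mul_of_pos_left _ S.N_pos

theorem N_le : S.N ≤ S.n :=
  Nat.le_mul_of_pos_right _ (by have := S.s_le; have := S.one_le_s; omega)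

theorem n_lt_q : S.n < S.q := by
  have h1 : S.n ≤ S.q - 1 := Nat.div_mul_le_self _ _
  have : 3 ≤ S.n := S.three_le
  omega

theorem q_le : S.q ≤ S.n ^ 2 := by
  have h1 : S.q - 1 < S.N * S.m + S.m := by
    have := Nat.lt_div_mul_add (a := S.q - 1) (b := S.m)
      (by have := S.s_le; have := S.one_le_s; omega)
    exact this
  have h2 : S.n = S.N * S.m := rfl
  have h3 := S.m_le
  have h4 : 3 ≤ S.n := S.three_le
  have h5 : S.q ≤ 2 * S.n := by omega
  nlinarith

theorem k_le : S.k ≤ S.n := S.k_lt.le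

theorem n_le_budget : S.n ≤ S.budget :=
  Nat.le_self_pow (by have := S.one_le_s; omega) _

theorem polyBounded_n {Γ : Type*} {π : Γ → Setting.{u}} :
    PolyBounded (fun γ => (π γ).budget) fun γ => (π γ).n :=
  PolyBounded.self.mono fun γ => (π γ).n_le_budget

theorem polyBounded_q {Γ : Type*} {π : Γ → Setting.{u}} :
    PolyBounded (fun γ => (π γ).budget) fun γ => (π γ).q :=
  (polyBounded_n.pow 2).mono fun γ => (π γ).q_le

theorem polyBounded_k {Γ : Type*} {π : Γ → Setting.{u}} :
    PolyBounded (fun γ => (π γ).budget) fun γ => (π γ).k :=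
  polyBounded_n.mono fun γ => (π γ).k_le

end Setting

/-- A situation in which a program can be run: values `Γ` of the variables, and their
representation `inp` from which the decoder's input can be recovered. -/
structure Ctx where
  Γ : Type (u + 1)
  π : Γ → Setting.{u}
  inp : Γ → DataTree
  root : Computes (fun γ => (π γ).budget) inp fun γ => (π γ).input

/-- The initial context, in which the decoder's input is the only variable. -/
abbrev Ctx.base : Ctx.{u} := ⟨Setting.{u}, fun S => S, fun S => S.input, .id⟩

/-- The tree `out` is computable in the context `C` in polynomial time. -/
def Fast (C : Ctx.{u}) (out : C.Γ → DataTree) : Prop :=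
  Computes (fun γ => (C.π γ).budget) C.inp out

namespace Ctx

variable (C : Ctx.{u})

/-- The context extended by a number less than `d`. -/
abbrev ix (d : C.Γ → ℕ) : Ctx.{u} where
  Γ := Σ γ : C.Γ, Fin (d γ)
  π p := C.π p.1
  inp p := cons (C.inp p.1) (ofNat p.2)
  root := (Computes.id.left).comp (C.root.reindex Sigma.fst)

/-- The context extended by a number less than `d` and a tree that depends on it. -/
abbrev st (d : C.Γ → ℕ) (s : C.Γ → ℕ → DataTree) : Ctx.{u} where
  Γ := Σ γ : C.Γ, Fin (d γ)
  π p := C.π p.1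
  inp p := cons (C.inp p.1) (cons (ofNat p.2) (s p.1 p.2))
  root := (Computes.id.left).comp (C.root.reindex Sigma.fst)

end Ctx

/-- The polynomially bounded number `a` is computable in polynomial time. -/
structure FN (C : Ctx.{u}) (a : C.Γ → ℕ) : Prop where
  fast : Fast C fun γ => ofNat (a γ)
  bound : PolyBounded (fun γ => (C.π γ).budget) a

open Classical in
/-- The truth value of `p` is computable in polynomial time. -/
def FB (C : Ctx.{u}) (p : C.Γ → Prop) : Prop :=
  Fast C fun γ => if p γ then cons nil nil else nil

/-- The field element `a` is computable in polynomial time. -/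
def FE (C : Ctx.{u}) (a : ∀ γ : C.Γ, (C.π γ).F) : Prop :=
  Fast C fun γ => encElem (C.π γ).e (a γ)

/-! ### Trees, numbers and truth values -/

variable {C : Ctx.{u}} {d : C.Γ → ℕ} {s : C.Γ → ℕ → DataTree}

namespace Fast

theorem nil : Fast C fun _ => DataTree.nil := Computes.nil

theorem cons {a b : C.Γ → DataTree} (ha : Fast C a) (hb : Fast C b) :
    Fast C fun γ => DataTree.cons (a γ) (b γ) := Computes.pair ha hb

theorem left {a : C.Γ → DataTree} (ha : Fast C a) : Fast C fun γ => (a γ).left := Computes.left ha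

theorem right {a : C.Γ → DataTree} (ha : Fast C a) : Fast C fun γ => (a γ).right :=
  Computes.right ha

theorem congr {a b : C.Γ → DataTree} (ha : Fast C a) (h : ∀ γ, b γ = a γ) : Fast C b := by
  rwa [funext h]

theorem root : Fast C fun γ => (C.π γ).input := C.root

theorem wk {a : C.Γ → DataTree} (ha : Fast C a) : Fast (C.ix d) fun p => a p.1 :=
  (Computes.id.left).comp (Computes.reindex ha Sigma.fst)

theorem index : Fast (C.ix d) fun p => ofNat p.2 := Computes.id.right

theorem toSt {a : (C.ix d).Γ → DataTree} (ha : Fast (C.ix d) a) : Fast (C.st d s) a :=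
  (Computes.id.left.pair Computes.id.right.left).comp ha

theorem state : Fast (C.st d s) fun p => s p.1 p.2 := Computes.id.right.right

theorem iter (hd : FN C d) (h0 : Fast C fun γ => s γ 0)
    (hs : Fast (C.st d s) fun p => s p.1 (p.2 + 1)) : Fast C fun γ => s γ (d γ) :=
  Computes.iter hd.fast (fun _ => len_ofNat _) hd.bound h0 hs

theorem ite {p : C.Γ → Prop} [∀ γ, Decidable (p γ)] {a b : C.Γ → DataTree} (hp : FB C p)
    (ha : Fast C a) (hb : Fast C b) : Fast C fun γ => if p γ then a γ else b γ := by
  refine Fast.congr (Computes.ite hp ha hb) fun γ => ?_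
  by_cases h : p γ <;> simp [h]

end Fast

namespace FN

variable {a b : C.Γ → ℕ}

theorem congr (ha : FN C a) (h : ∀ γ, b γ = a γ) : FN C b := by rwa [funext h]

theorem wk (ha : FN C a) : FN (C.ix d) fun p => a p.1 := ⟨ha.fast.wk, ha.bound.comp Sigma.fst⟩

theorem toSt {a : (C.ix d).Γ → ℕ} (ha : FN (C.ix d) a) : FN (C.st d s) a :=
  ⟨ha.fast.toSt, ha.bound⟩

theorem wks (ha : FN C a) : FN (C.st d s) fun p => a p.1 := ha.wk.toSt

theorem index (hd : FN C d) : FN (C.ix d) fun p => (p.2 : ℕ) :=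
  ⟨Fast.index, (hd.bound.comp Sigma.fst).mono fun p => p.2.2.le⟩

theorem succ (ha : FN C a) : FN C fun γ => a γ + 1 :=
  ⟨Fast.nil.cons ha.fast, ha.bound.add (.const 1)⟩

theorem pred (ha : FN C a) : FN C fun γ => a γ - 1 :=
  ⟨ha.fast.right.congr fun _ => (right_ofNat _).symm, ha.bound.mono fun _ => Nat.sub_le _ _⟩

theorem const (n : ℕ) : FN C fun _ => n := by
  induction n with
  | zero => exact ⟨Fast.nil, .const 0⟩
  | succ n ih => exact ih.succ

/-- Iteration of a step on numbers that stay bounded. -/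
theorem iter {s : C.Γ → ℕ → ℕ} (hd : FN C d) (h0 : FN C fun γ => s γ 0)
    (hb : PolyBounded (fun p => ((C.ix d).π p).budget) fun p : (C.ix d).Γ => s p.1 p.2)
    (hs : FN (C.st d fun γ i => ofNat (s γ i)) (fun p => s p.1 p.2) →
      FN (C.st d fun γ i => ofNat (s γ i)) fun p => s p.1 (p.2 + 1)) :
    Fast C fun γ => ofNat (s γ (d γ)) :=
  Fast.iter (s := fun γ i => ofNat (s γ i)) hd h0.fast (hs ⟨Fast.state, hb⟩).fast

theorem add (ha : FN C a) (hb : FN C b) : FN C fun γ => a γ + b γ :=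
  ⟨iter (s := fun γ i => a γ + i) hb ha (ha.wk.bound.add (index hb).bound) succ,
    ha.bound.add hb.bound⟩

theorem sub (ha : FN C a) (hb : FN C b) : FN C fun γ => a γ - b γ :=
  ⟨iter (s := fun γ i => a γ - i) hb ha (ha.wk.bound.mono fun _ => Nat.sub_le _ _) pred,
    ha.bound.mono fun _ => Nat.sub_le _ _⟩

theorem mul (ha : FN C a) (hb : FN C b) : FN C fun γ => a γ * b γ :=
  ⟨iter (s := fun γ i => a γ * i) hb (const 0) (ha.wk.bound.mul (index hb).bound)
    fun h => (h.add ha.wks).congr fun _ => rfl, ha.bound.mul hb.bound⟩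

open Finset in
theorem sum {t : C.Γ → ℕ → ℕ} (hd : FN C d) (ht : FN (C.ix d) fun p => t p.1 p.2) :
    FN C fun γ => ∑ i ∈ range (d γ), t γ i := by
  have key : ∀ j : ∀ p : C.Γ, ℕ, (∀ γ, j γ ≤ d γ) → ∀ c γ,
      (∀ p : (C.ix d).Γ, t p.1 p.2 ≤ ((C.π p.1).budget + 2) ^ c) →
      ∑ i ∈ range (j γ), t γ i ≤ d γ * ((C.π γ).budget + 2) ^ c := by
    intro j hj c γ hc
    refine (sum_le_card_nsmul _ _ (((C.π γ).budget + 2) ^ c) fun i hi => ?_).trans ?_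
    · exact hc ⟨γ, i, (mem_range.1 hi).trans_le (hj γ)⟩
    · rw [card_range, smul_eq_mul]
      exact Nat.mul_le_mul_right _ (hj γ)
  obtain ⟨c, hc⟩ := ht.bound
  have hP : PolyBounded (fun γ => (C.π γ).budget) fun γ => d γ * ((C.π γ).budget + 2) ^ c :=
    hd.bound.mul ⟨c, fun _ => le_rfl⟩
  refine ⟨iter (s := fun γ j => ∑ i ∈ range j, t γ i) hd (const 0) ?_ fun h => ?_, ?_⟩
  · refine (hP.comp Sigma.fst).mono fun p => ?_
    exact (sum_le_sum_of_subset (range_subset_range.2 p.2.2.le)).trans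
      (key d (fun _ => le_rfl) c p.1 hc)
  · exact (h.add ht.toSt).congr fun p => sum_range_succ _ _
  · exact hP.mono fun γ => key d (fun _ => le_rfl) c γ hc

open Finset in
/-- A product is computable if the partial products stay bounded. -/
theorem prod {t : C.Γ → ℕ → ℕ} (hd : FN C d) (ht : FN (C.ix d) fun p => t p.1 p.2)
    {B : C.Γ → ℕ} (hB : PolyBounded (fun γ => (C.π γ).budget) B)
    (hle : ∀ γ, ∀ j ≤ d γ, ∏ i ∈ range j, t γ i ≤ B γ) :
    FN C fun γ => ∏ i ∈ range (d γ), t γ i := by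
  refine ⟨iter (s := fun γ j => ∏ i ∈ range j, t γ i) hd (const 1) ?_ fun h => ?_, ?_⟩
  · exact (hB.comp Sigma.fst).mono fun p => hle p.1 _ p.2.2.le
  · exact (h.mul ht.toSt).congr fun p => prod_range_succ _ _
  · exact hB.mono fun γ => hle γ _ le_rfl

theorem pow (ha : FN C a) (hb : FN C b)
    (hB : PolyBounded (fun γ => (C.π γ).budget) fun γ => a γ ^ b γ) :
    FN C fun γ => a γ ^ b γ := by
  refine (prod (t := fun γ _ => a γ) hb ha.wk (hB.add (.const 1)) fun γ j hj => ?_).congr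
    fun γ => by simp
  simp only [Finset.prod_const, Finset.card_range]
  rcases Nat.eq_zero_or_pos (a γ) with h | h
  · rw [h]
    exact (Nat.pow_le_one_iff_of_le_one j).trans (Nat.le_add_left _ _)
  · exact (Nat.pow_le_pow_right h hj).trans (Nat.le_add_right _ _)
where
  Nat.pow_le_one_iff_of_le_one (j : ℕ) : 0 ^ j ≤ 1 := by cases j <;> simp

theorem ite {p : C.Γ → Prop} [∀ γ, Decidable (p γ)] (hp : FB C p) (ha : FN C a) (hb : FN C b) :
    FN C fun γ => if p γ then a γ else b γ :=
  ⟨(Fast.ite hp ha.fast hb.fast).congr fun γ => by split_ifs <;> rfl,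
    (ha.bound.add hb.bound).mono fun γ => by split_ifs <;> omega⟩

theorem len {x : C.Γ → DataTree} (hx : Fast C x)
    (hB : PolyBounded (fun γ => (C.π γ).budget) fun γ => (x γ).len) : FN C fun γ => (x γ).len :=
  ⟨Computes.iter (s := fun _ i => ofNat i) hx (fun _ => rfl) hB Computes.nil
    (Computes.nil.pair Computes.id.right.left), hB⟩

end FN

namespace FB

variable {p p' : C.Γ → Prop} {a b : C.Γ → ℕ}

theorem congr (hp : FB C p) (h : ∀ γ, p' γ ↔ p γ) : FB C p' := by
  rwa [show p' = p from funext fun γ => propext (h γ)]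

theorem wk (hp : FB C p) : FB (C.ix d) fun x => p x.1 := Fast.wk hp

theorem toSt {p : (C.ix d).Γ → Prop} (hp : FB (C.ix d) p) : FB (C.st d s) p := Fast.toSt hp

theorem const (P : Prop) : FB C fun _ => P := by
  by_cases h : P
  · exact (Fast.nil.cons Fast.nil).congr fun _ => by simp [h]
  · exact Fast.nil.congr fun _ => by simp [h]

theorem ne_nil {x : C.Γ → DataTree} (hx : Fast C x) : FB C fun γ => x γ ≠ nil :=
  Fast.congr (Computes.ite hx (Fast.nil.cons Fast.nil) Fast.nil) fun _ => by congr

theorem and (hp : FB C p) (hp' : FB C p') : FB C fun γ => p γ ∧ p' γ := by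
  classical
  exact (Fast.ite hp hp' Fast.nil).congr fun γ => by by_cases h : p γ <;> simp [h]

theorem not (hp : FB C p) : FB C fun γ => ¬ p γ := by
  classical
  exact (Fast.ite hp Fast.nil (Fast.nil.cons Fast.nil)).congr fun γ => by
    by_cases h : p γ <;> simp [h]

theorem le (ha : FN C a) (hb : FN C b) : FB C fun γ => a γ ≤ b γ :=
  (ne_nil (ha.sub hb).fast).not.congr fun γ => by
    rw [ne_eq, not_not, eq_nil_iff_len, len_ofNat]; omega

theorem lt (ha : FN C a) (hb : FN C b) : FB C fun γ => a γ < b γ :=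
  (le hb ha).not.congr fun γ => by omega

theorem eq (ha : FN C a) (hb : FN C b) : FB C fun γ => a γ = b γ :=
  ((le ha hb).and (le hb ha)).congr fun γ => by omega

theorem all {p : C.Γ → ℕ → Prop} (hd : FN C d) (hp : FB (C.ix d) fun x => p x.1 x.2) :
    FB C fun γ => ∀ i < d γ, p γ i := by
  classical
  refine (Fast.iter (s := fun γ j => if ∀ i < j, p γ i then DataTree.cons .nil .nil else .nil) hd
    ((Fast.nil.cons Fast.nil).congr fun _ => by simp) ?_).congr fun γ => ?_
  · refine (Fast.ite hp.toSt Fast.state Fast.nil).congr fun x => ?_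
    simp only [Nat.lt_succ_iff_lt_or_eq, or_imp, forall_and, forall_eq]
    by_cases h : p x.1 x.2 <;> simp [h]
  · congr

theorem ex {p : C.Γ → ℕ → Prop} (hd : FN C d) (hp : FB (C.ix d) fun x => p x.1 x.2) :
    FB C fun γ => ∃ i < d γ, p γ i :=
  (all (p := fun γ i => ¬ p γ i) hd hp.not).not.congr fun γ => by push Not; rfl

end FB

/-- The last `i < d` with `p i`, and `0` if there is none. -/
def lastIdx (p : ℕ → Prop) [DecidablePred p] : ℕ → ℕ
  | 0 => 0
  | d + 1 => if p d then d else lastIdx p d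

section lastIdx

variable {p : ℕ → Prop} [DecidablePred p]

theorem lastIdx_le (p : ℕ → Prop) [DecidablePred p] (d : ℕ) : lastIdx p d ≤ d := by
  induction d with
  | zero => exact le_rfl
  | succ d ih => rw [lastIdx]; split_ifs <;> omega

theorem lastIdx_spec {d : ℕ} (h : ∃ i < d, p i) : lastIdx p d < d ∧ p (lastIdx p d) := by
  induction d with
  | zero => simp at h
  | succ d ih =>
    rw [lastIdx]
    split_ifs with hd
    · exact ⟨by omega, hd⟩
    · obtain ⟨i, hi, hp⟩ := h
      have := ih ⟨i, by rcases Nat.lt_succ_iff_lt_or_eq.1 hi with h | rfl; exacts [h, (hd hp).elim],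
        hp⟩
      exact ⟨by omega, this.2⟩

theorem not_of_lastIdx_lt {d i : ℕ} (h : lastIdx p d < i) (hi : i < d) : ¬ p i := by
  induction d with
  | zero => omega
  | succ d ih =>
    rw [lastIdx] at h
    split_ifs at h with hd
    · omega
    · rcases Nat.lt_succ_iff_lt_or_eq.1 hi with h' | rfl
      exacts [ih h h', hd]

end lastIdx

namespace FN

variable {a b : C.Γ → ℕ}

theorem lastIdx {p : C.Γ → ℕ → Prop} [∀ γ, DecidablePred (p γ)] (hd : FN C d)
    (hp : FB (C.ix d) fun x => p x.1 x.2) : FN C fun γ => lastIdx (p γ) (d γ) := by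
  have hb : PolyBounded (fun γ => (C.π γ).budget) fun γ => FRS.lastIdx (p γ) (d γ) :=
    hd.bound.mono fun γ => lastIdx_le _ _
  refine ⟨iter (s := fun γ j => FRS.lastIdx (p γ) j) hd (const 0) ?_ fun h => ?_, hb⟩
  · exact (index hd).bound.mono fun γ => lastIdx_le _ _
  · exact (ite hp.toSt (index hd).toSt h).congr fun x => rfl

theorem div (ha : FN C a) (hb : FN C b) : FN C fun γ => a γ / b γ := by
  refine (sum (t := fun γ j => if 0 < b γ ∧ (j + 1) * b γ ≤ a γ then 1 else 0) ha
    (ite ((FB.lt (const 0) hb.wk).and (.le ((index ha).succ.mul hb.wk) ha.wk)) (const 1)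
      (const 0))).congr fun γ => ?_
  rcases Nat.eq_zero_or_pos (b γ) with h | h
  · simp [h]
  · simp only [h, true_and, ← Nat.le_div_iff_mul_le h]
    rw [Finset.sum_boole, Nat.cast_id]
    have : (Finset.range (a γ)).filter (fun j => j + 1 ≤ a γ / b γ) = Finset.range (a γ / b γ) := by
      ext j
      have := Nat.div_le_self (a γ) (b γ)
      simp only [Finset.mem_filter, Finset.mem_range]
      omega
    rw [this, Finset.card_range]

theorem mod (ha : FN C a) (hb : FN C b) : FN C fun γ => a γ % b γ :=
  (ha.sub (hb.mul (ha.div hb))).congr fun γ => by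
    have := Nat.div_add_mod (a γ) (b γ)
    omega

end FN

/-! ### Arrays -/

namespace DataTree

/-- The array with entries `w 0, …, w (d - 1)`. -/
def tab (d : ℕ) (w : ℕ → DataTree) : DataTree := ofList ((List.range d).map w)

/-- The entry of an array at a given position. -/
def get (x : DataTree) (i : ℕ) : DataTree := (x.drop i).left

theorem drop_ofList (l : List DataTree) (i : ℕ) : (ofList l).drop i = ofList (l.drop i) := by
  induction i generalizing l with
  | zero => simp [drop]
  | succ i ih =>
    rw [drop_succ, ih]
    rcases h : l.drop i with _ | ⟨a, l'⟩
    · rw [List.drop_eq_nil_iff] at h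
      rw [List.drop_of_length_le (by omega)]
      rfl
    · rw [← List.tail_drop, h]
      rfl

theorem get_ofList (l : List DataTree) (i : ℕ) : (ofList l).get i = l.getD i nil := by
  rw [get, drop_ofList, List.getD_eq_getElem?_getD, ← List.head?_drop]
  cases l.drop i <;> rfl

theorem get_tab {d i : ℕ} (w : ℕ → DataTree) (h : i < d) : (tab d w).get i = w i := by
  rw [tab, get_ofList]
  simp [h]

theorem tab_congr {d : ℕ} {w w' : ℕ → DataTree} (h : ∀ i < d, w i = w' i) : tab d w = tab d w' := by
  rw [tab, tab, List.map_congr_left fun i hi => h i (List.mem_range.1 hi)]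

theorem ofList_ofFn {d : ℕ} (f : Fin d → DataTree) :
    ofList (List.ofFn f) = tab d fun i => if h : i < d then f ⟨i, h⟩ else nil := by
  rw [tab]
  congr 1
  refine List.ext_getElem (by simp) fun i h1 h2 => ?_
  have : i < d := by simpa using h1
  simp [this]

end DataTree

namespace Fast

theorem drop {x : C.Γ → DataTree} {i : C.Γ → ℕ} (hx : Fast C x) (hi : FN C i) :
    Fast C fun γ => (x γ).drop (i γ) :=
  iter (s := fun γ j => (x γ).drop j) hi hx ((right state).congr fun _ => drop_succ _ _)

theorem get {x : C.Γ → DataTree} {i : C.Γ → ℕ} (hx : Fast C x) (hi : FN C i) :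
    Fast C fun γ => (x γ).get (i γ) := (hx.drop hi).left

theorem get_tab {w : C.Γ → ℕ → DataTree} {i : C.Γ → ℕ} (hx : Fast C fun γ => tab (d γ) (w γ))
    (hi : FN C i) (h : ∀ γ, i γ < d γ) : Fast C fun γ => w γ (i γ) :=
  (hx.get hi).congr fun γ => (DataTree.get_tab _ (h γ)).symm

/-- The value of a computable expression at given values of its variables. -/
theorem substitute {C' : Ctx.{u}} {a : C.Γ → ℕ → DataTree} {i : C'.Γ → ℕ}
    (ha : Fast (C.ix d) fun p => a p.1 p.2) (f : C'.Γ → C.Γ) (hπ : ∀ γ, C'.π γ = C.π (f γ))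
    (hf : Fast C' fun γ => C.inp (f γ)) (hi : FN C' i) (hid : ∀ γ, i γ < d (f γ)) :
    Fast C' fun γ => a (f γ) (i γ) := by
  have h := Computes.reindex ha fun γ : C'.Γ => (⟨f γ, ⟨i γ, hid γ⟩⟩ : (C.ix d).Γ)
  have hμ : (fun γ => (C'.π γ).budget) = fun γ => (C.π (f γ)).budget :=
    funext fun γ => by rw [hπ]
  have h' : Computes (fun γ => (C'.π γ).budget) (fun γ => DataTree.cons (C.inp (f γ)) (ofNat (i γ)))
      fun γ => a (f γ) (i γ) := by
    rw [hμ]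
    exact h
  exact (Computes.pair hf hi.fast).comp h'

theorem tab {w : C.Γ → ℕ → DataTree} (hd : FN C d) (hw : Fast (C.ix d) fun p => w p.1 p.2) :
    Fast C fun γ => tab (d γ) (w γ) := by
  -- the array is built from its end
  let s : C.Γ → ℕ → DataTree := fun γ i => DataTree.tab i fun j => w γ (d γ - i + j)
  have hidx : FN (C.st d s) fun p => d p.1 - (p.2 + 1) := hd.wks.sub (FN.index hd).toSt.succ
  have h1 : Fast (C.st d s) fun p => w p.1 (d p.1 - (p.2 + 1)) :=
    substitute hw (fun p : (C.st d s).Γ => p.1) (fun _ => rfl) Computes.id.left hidx fun p => by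
      have := p.2.2
      omega
  have hs : Fast (C.st d s) fun p => s p.1 (p.2 + 1) := by
    refine (h1.cons state).congr fun p => ?_
    have hp : (p.2 : ℕ) < d p.1 := p.2.2
    simp only [s, DataTree.tab, List.range_succ_eq_map, List.map_cons, ofList, List.map_map]
    congr 2
    refine List.map_congr_left fun j _ => ?_
    simp only [Function.comp]
    congr 1
    omega
  have h0 : Fast C fun γ => s γ 0 := Fast.nil
  exact (iter hd h0 hs).congr fun γ => by simp [s]

end Fast

end FRS

namespace FRS
open DataTree

universe u

variable {C : Ctx.{u}} {d : C.Γ → ℕ}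

/-! ### Arithmetic of the field and parameters of the decoder -/

namespace Setting

variable (S : Setting.{u})

/-- The field element with number `i`. -/
def elt (i : ℕ) : S.F := if h : i < S.q then S.e.symm ⟨i, h⟩ else 0

theorem elt_code (a : S.F) : S.elt (S.e a) = a := by simp [elt]

theorem code_elt {i : ℕ} (h : i < S.q) : (S.e (S.elt i) : ℕ) = i := by simp [elt, h]

theorem prod_elt {M : Type*} [CommMonoid M] (f : S.F → M) :
    ∏ i ∈ Finset.range S.q, f (S.elt i) = ∏ a : S.F, f a := by
  rw [Finset.prod_range, ← S.e.symm.prod_comp]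
  exact Finset.prod_congr rfl fun i _ => by simp [elt]

theorem get_encTable₁ (f : S.F → S.F) (a : S.F) :
    (encTable₁ S.e f).get (S.e a) = encElem S.e (f a) := by
  rw [encTable₁, ofList_ofFn, get_tab _ (S.e a).2]
  simp

theorem get_encTable₂ (f : S.F → S.F → S.F) (a b : S.F) :
    ((encTable₂ S.e f).get (S.e a)).get (S.e b) = encElem S.e (f a b) := by
  rw [encTable₂, ofList_ofFn, get_tab _ (S.e a).2, dif_pos (S.e a).2, Fin.eta,
    Equiv.symm_apply_apply, get_encTable₁]

theorem get_encWord {i : ℕ} (h : i < S.n) :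
    ((encWord S.e S.z).get (i / S.m)).get (i % S.m) = encElem S.e (unfold S.z i) := by
  have h' : i < S.m * S.N := by rw [mul_comm]; exact h
  have hm : i % S.m < S.m := Nat.mod_lt _ (by have := S.s_le; have := S.one_le_s; omega)
  have hN : i / S.m < S.N := Nat.div_lt_of_lt_mul h'
  rw [encWord, ofList_ofFn, get_tab _ hN, dif_pos hN, ofList_ofFn, get_tab _ hm, dif_pos hm,
    unfold, dif_pos h']

end Setting

namespace FN

theorem code {a : ∀ γ : C.Γ, (C.π γ).F} (ha : FE C a) : FN C fun γ => ((C.π γ).e (a γ) : ℕ) :=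
  ⟨ha, Setting.polyBounded_q.mono fun γ => ((C.π γ).e (a γ)).2.le⟩

theorem q : FN C fun γ => (C.π γ).q := by
  have h := len (C := C) Fast.root.right.right.right.right.right.left
    (Setting.polyBounded_q.mono fun γ => ?_)
  · refine h.congr fun γ => ?_
    simp [Setting.input, encInput, ofList, DataTree.right, DataTree.left, encTable₁]
  · simp [Setting.input, encInput, ofList, DataTree.right, DataTree.left, encTable₁]

theorem m : FN C fun γ => (C.π γ).m :=
  ⟨Fast.root.right.right.right.right.right.right.right.left,
    Setting.polyBounded_n.mono fun γ => (C.π γ).m_le⟩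

theorem k : FN C fun γ => (C.π γ).k :=
  ⟨Fast.root.right.right.right.right.right.right.right.right.left, Setting.polyBounded_k⟩

theorem s : FN C fun γ => (C.π γ).s :=
  ⟨Fast.root.right.right.right.right.right.right.right.right.right.left,
    Setting.polyBounded_n.mono fun γ => (C.π γ).s_le.trans (C.π γ).m_le⟩

theorem r : FN C fun γ => (C.π γ).r :=
  ⟨Fast.root.right.right.right.right.right.right.right.right.right.right.left,
    (Setting.polyBounded_k.mul Setting.polyBounded_q).mono fun γ => (C.π γ).r_le⟩

theorem t : FN C fun γ => (C.π γ).t :=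
  ⟨Fast.root.right.right.right.right.right.right.right.right.right.right.right.left,
    Setting.polyBounded_n.mono fun γ => (C.π γ).t_le.trans (C.π γ).N_le⟩

theorem word :
    Fast C fun γ => encWord (C.π γ).e (C.π γ).z :=
  Fast.root.right.right.right.right.right.right.right.right.right.right.right.right.left

theorem N : FN C fun γ => (C.π γ).N := by
  have h := len (C := C) word (Setting.polyBounded_n.mono fun γ => ?_)
  · exact h.congr fun γ => by simp [encWord]
  · simpa [encWord] using (C.π γ).N_le

theorem n : FN C fun γ => (C.π γ).n := N.mul m

end FN

namespace FE

variable {a b : ∀ γ : C.Γ, (C.π γ).F}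

theorem congr (ha : FE C a) (h : ∀ γ, b γ = a γ) : FE C b := by rwa [funext h]

theorem wk (ha : FE C a) : FE (C.ix d) fun p => a p.1 := Fast.wk ha

theorem toSt {s : C.Γ → ℕ → DataTree} {a : ∀ p : (C.ix d).Γ, ((C.ix d).π p).F}
    (ha : FE (C.ix d) a) : FE (C.st d s) a := Fast.toSt ha

theorem wks {s : C.Γ → ℕ → DataTree} (ha : FE C a) : FE (C.st d s) fun p => a p.1 := ha.wk.toSt

theorem zero : FE C fun _ => 0 := Fast.root.left

theorem one : FE C fun _ => 1 := Fast.root.right.left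

theorem gen : FE C fun γ => ((C.π γ).γ : (C.π γ).F) :=
  Fast.root.right.right.right.right.right.right.left

theorem add (ha : FE C a) (hb : FE C b) : FE C fun γ => a γ + b γ :=
  ((Fast.root.right.right.left.get (FN.code ha)).get (FN.code hb)).congr
    fun γ => ((C.π γ).get_encTable₂ _ _ _).symm

theorem mul (ha : FE C a) (hb : FE C b) : FE C fun γ => a γ * b γ :=
  ((Fast.root.right.right.right.left.get (FN.code ha)).get (FN.code hb)).congr
    fun γ => ((C.π γ).get_encTable₂ _ _ _).symm

theorem neg (ha : FE C a) : FE C fun γ => -a γ :=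
  (Fast.root.right.right.right.right.left.get (FN.code ha)).congr
    fun γ => ((C.π γ).get_encTable₁ _ _).symm

theorem inv (ha : FE C a) : FE C fun γ => (a γ)⁻¹ :=
  (Fast.root.right.right.right.right.right.left.get (FN.code ha)).congr
    fun γ => ((C.π γ).get_encTable₁ _ _).symm

theorem sub (ha : FE C a) (hb : FE C b) : FE C fun γ => a γ - b γ :=
  (ha.add hb.neg).congr fun _ => sub_eq_add_neg _ _

theorem elt {i : C.Γ → ℕ} (hi : FN C i) (h : ∀ γ, i γ < (C.π γ).q) :
    FE C fun γ => (C.π γ).elt (i γ) :=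
  hi.fast.congr fun γ => by rw [encElem, (C.π γ).code_elt (h γ)]

theorem unfold {i : C.Γ → ℕ} (hi : FN C i) (h : ∀ γ, i γ < (C.π γ).n) :
    FE C fun γ => unfold (C.π γ).z (i γ) :=
  ((FN.word.get (hi.div FN.m)).get (hi.mod FN.m)).congr
    fun γ => ((C.π γ).get_encWord (h γ)).symm

theorem ite {p : C.Γ → Prop} [∀ γ, Decidable (p γ)] (hp : FB C p) (ha : FE C a) (hb : FE C b) :
    FE C fun γ => if p γ then a γ else b γ :=
  (Fast.ite hp ha hb).congr fun γ => by by_cases h : p γ <;> simp [h]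

/-- Iteration of a step on field elements. -/
theorem iter {s : ∀ γ : C.Γ, ℕ → (C.π γ).F} (hd : FN C d) (h0 : FE C fun γ => s γ 0)
    (hs : FE (C.st d fun γ i => encElem (C.π γ).e (s γ i)) (fun p => s p.1 p.2) →
      FE (C.st d fun γ i => encElem (C.π γ).e (s γ i)) fun p => s p.1 (p.2 + 1)) :
    FE C fun γ => s γ (d γ) :=
  Fast.iter (s := fun γ i => encElem (C.π γ).e (s γ i)) hd h0 (hs Fast.state)

open Finset in
theorem sum {t : ∀ γ : C.Γ, ℕ → (C.π γ).F} (hd : FN C d) (ht : FE (C.ix d) fun p => t p.1 p.2) :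
    FE C fun γ => ∑ i ∈ range (d γ), t γ i :=
  iter (s := fun γ j => ∑ i ∈ range j, t γ i) hd zero
    fun h => (h.add ht.toSt).congr fun _ => sum_range_succ _ _

open Finset in
theorem prod {t : ∀ γ : C.Γ, ℕ → (C.π γ).F} (hd : FN C d)
    (ht : FE (C.ix d) fun p => t p.1 p.2) : FE C fun γ => ∏ i ∈ range (d γ), t γ i :=
  iter (s := fun γ j => ∏ i ∈ range j, t γ i) hd one
    fun h => (h.mul ht.toSt).congr fun _ => prod_range_succ _ _

theorem pow {i : C.Γ → ℕ} (ha : FE C a) (hi : FN C i) : FE C fun γ => a γ ^ i γ :=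
  (prod (t := fun γ _ => a γ) hi ha.wk).congr fun γ => by simp

end FE

namespace FB

variable {a b : ∀ γ : C.Γ, (C.π γ).F}

theorem eqE (ha : FE C a) (hb : FE C b) : FB C fun γ => a γ = b γ :=
  (eq (FN.code ha) (FN.code hb)).congr fun γ => by
    rw [← Fin.ext_iff, (C.π γ).e.injective.eq_iff]

end FB

/-! ### Vectors and matrices -/

namespace Setting

variable (S : Setting.{u})

/-- The representation of the vector with entries `v 0, …, v (d - 1)`. -/
def vec (d : ℕ) (v : ℕ → S.F) : DataTree := tab d fun i => encElem S.e (v i)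

/-- The representation of a matrix with `c` rows of length `d`. -/
def mat (c d : ℕ) (A : ℕ → ℕ → S.F) : DataTree := tab c fun i => S.vec d (A i)

end Setting

/-- The vector `v` of length `d` is computable in polynomial time. -/
def FVec (C : Ctx.{u}) (d : C.Γ → ℕ) (v : ∀ γ : C.Γ, ℕ → (C.π γ).F) : Prop :=
  Fast C fun γ => (C.π γ).vec (d γ) (v γ)

/-- The `c × d` matrix `A` is computable in polynomial time. -/
def FMat (C : Ctx.{u}) (c d : C.Γ → ℕ) (A : ∀ γ : C.Γ, ℕ → ℕ → (C.π γ).F) : Prop :=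
  Fast C fun γ => (C.π γ).mat (c γ) (d γ) (A γ)

theorem FVec.wk {c : C.Γ → ℕ} {v : ∀ γ : C.Γ, ℕ → (C.π γ).F} (hv : FVec C d v) :
    FVec (C.ix c) (fun p => d p.1) fun p => v p.1 := Fast.wk hv

theorem FVec.toSt {c : C.Γ → ℕ} {s : C.Γ → ℕ → DataTree} {d : (C.ix c).Γ → ℕ}
    {v : ∀ p : (C.ix c).Γ, ℕ → ((C.ix c).π p).F} (hv : FVec (C.ix c) d v) :
    FVec (C.st c s) d v := Fast.toSt hv

theorem FMat.wk {b c : C.Γ → ℕ} {A : ∀ γ : C.Γ, ℕ → ℕ → (C.π γ).F} (hA : FMat C c d A) :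
    FMat (C.ix b) (fun p => c p.1) (fun p => d p.1) fun p => A p.1 := Fast.wk hA

theorem FMat.toSt {b : C.Γ → ℕ} {s : C.Γ → ℕ → DataTree} {c d : (C.ix b).Γ → ℕ}
    {A : ∀ p : (C.ix b).Γ, ℕ → ℕ → ((C.ix b).π p).F} (hA : FMat (C.ix b) c d A) :
    FMat (C.st b s) c d A := Fast.toSt hA

theorem FVec.get {v : ∀ γ : C.Γ, ℕ → (C.π γ).F} {i : C.Γ → ℕ} (hv : FVec C d v) (hi : FN C i)
    (h : ∀ γ, i γ < d γ) : FE C fun γ => v γ (i γ) :=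
  Fast.get_tab (w := fun γ i => encElem (C.π γ).e (v γ i)) hv hi h

theorem FVec.of {v : ∀ γ : C.Γ, ℕ → (C.π γ).F} (hd : FN C d)
    (hv : FE (C.ix d) fun p => v p.1 p.2) : FVec C d v :=
  Fast.tab (w := fun γ i => encElem (C.π γ).e (v γ i)) hd hv

theorem FMat.row {c : C.Γ → ℕ} {A : ∀ γ : C.Γ, ℕ → ℕ → (C.π γ).F} {i : C.Γ → ℕ}
    (hA : FMat C c d A) (hi : FN C i) (h : ∀ γ, i γ < c γ) : FVec C d fun γ => A γ (i γ) :=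
  Fast.get_tab (w := fun γ i => (C.π γ).vec (d γ) (A γ i)) hA hi h

theorem FMat.get {c : C.Γ → ℕ} {A : ∀ γ : C.Γ, ℕ → ℕ → (C.π γ).F} {i j : C.Γ → ℕ}
    (hA : FMat C c d A) (hi : FN C i) (h : ∀ γ, i γ < c γ) (hj : FN C j) (h' : ∀ γ, j γ < d γ) :
    FE C fun γ => A γ (i γ) (j γ) :=
  FVec.get (v := fun γ => A γ (i γ)) (hA.row hi h) hj h'

theorem FMat.of {c : C.Γ → ℕ} {A : ∀ γ : C.Γ, ℕ → ℕ → (C.π γ).F} (hc : FN C c) (hd : FN C d)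
    (hA : FE ((C.ix c).ix fun p => d p.1) fun p => A p.1.1 p.1.2 p.2) : FMat C c d A :=
  Fast.tab (w := fun γ i => (C.π γ).vec (d γ) (A γ i)) hc
    (FVec.of (C := C.ix c) (d := fun p => d p.1) (v := fun p => A p.1 p.2) hd.wk hA)

end FRS

namespace FRS
open DataTree

universe u

/-! ### Solving linear equations -/

section LinearAlgebra

variable {F : Type*} [Field F]

open Classical in
/-- Given vectors `B 0, …, B (U - 1)` of length `n` and a linear form `l`, subtracts from each vector
the multiple of a fixed `B p` with `l (B p) ≠ 0` that makes its image under `l` vanish.  The vectors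
obtained span the kernel of `l` on the span of `B`; the one with index `p` is zero.  If `l` vanishes
on all `B u`, the convention `0⁻¹ = 0` leaves them unchanged. -/
noncomputable def elimStep (n U : ℕ) (l : ℕ → F) (B : ℕ → ℕ → F) : ℕ → ℕ → F := fun u x =>
  B u x - (∑ y ∈ Finset.range n, l y * B u y) *
    (∑ y ∈ Finset.range n,
      l y * B (lastIdx (fun u => ∑ y ∈ Finset.range n, l y * B u y ≠ 0) U) y)⁻¹ *
    B (lastIdx (fun u => ∑ y ∈ Finset.range n, l y * B u y ≠ 0) U) x

/-- Vectors spanning the common kernel of the first `i` of the linear forms `L` on the span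
of `B`. -/
noncomputable def eliminate (n U : ℕ) (L B : ℕ → ℕ → F) : ℕ → ℕ → ℕ → F
  | 0 => B
  | i + 1 => elimStep n U (L i) (eliminate n U L B i)

/-- The span of the first `U` vectors. -/
def spanRows (U : ℕ) (B : ℕ → ℕ → F) : Submodule F (ℕ → F) :=
  Submodule.span F (Set.range fun u : Fin U => B u)

theorem mem_spanRows {U : ℕ} {B : ℕ → ℕ → F} {x : ℕ → F} :
    x ∈ spanRows U B ↔ ∃ c : Fin U → F, ∑ u, c u • B u = x :=
  Submodule.mem_span_range_iff_exists_fun F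

theorem row_mem_spanRows {U u : ℕ} (B : ℕ → ℕ → F) (h : u < U) : B u ∈ spanRows U B :=
  Submodule.subset_span ⟨⟨u, h⟩, rfl⟩

theorem mem_spanRows_elimStep {n U : ℕ} {l : ℕ → F} {B : ℕ → ℕ → F} {x : ℕ → F} :
    x ∈ spanRows U (elimStep n U l B) ↔
      x ∈ spanRows U B ∧ ∑ y ∈ Finset.range n, l y * x y = 0 := by
  classical
  let f : (ℕ → F) →ₗ[F] F := ∑ y ∈ Finset.range n, l y • LinearMap.proj y
  have hf : ∀ x, ∑ y ∈ Finset.range n, l y * x y = f x := fun x => by simp [f]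
  obtain ⟨p, hp⟩ : ∃ p, p = lastIdx (fun u => f (B u) ≠ 0) U := ⟨_, rfl⟩
  have hstep : ∀ u, elimStep n U l B u = B u - (f (B u) * (f (B p))⁻¹) • B p := by
    intro u
    ext x
    simp only [elimStep, hf, hp, Pi.sub_apply, Pi.smul_apply, smul_eq_mul]
  have hpiv : ∀ u < U, f (B u) ≠ 0 → p < U ∧ f (B p) ≠ 0 := fun u hu h =>
    hp ▸ lastIdx_spec (p := fun u => f (B u) ≠ 0) ⟨u, hu, h⟩
  rw [hf]
  constructor
  · intro h
    have key : spanRows U (elimStep n U l B) ≤ spanRows U B ⊓ LinearMap.ker f := by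
      refine Submodule.span_le.2 ?_
      rintro _ ⟨u, rfl⟩
      simp only [hstep, SetLike.mem_coe, Submodule.mem_inf, LinearMap.mem_ker]
      by_cases h0 : f (B u) = 0
      · simpa [h0] using row_mem_spanRows B u.2
      · obtain ⟨h1, h2⟩ := hpiv u u.2 h0
        refine ⟨sub_mem (row_mem_spanRows B u.2) (Submodule.smul_mem _ _ (row_mem_spanRows B h1)),
          ?_⟩
        simp [h2]
    exact key h
  · rintro ⟨hx, h0⟩
    obtain ⟨c, rfl⟩ := mem_spanRows.1 hx
    refine mem_spanRows.2 ⟨c, ?_⟩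
    simp only [hstep, smul_sub, Finset.sum_sub_distrib, smul_smul, ← Finset.sum_smul, ← mul_assoc,
      ← Finset.sum_mul]
    rw [map_sum] at h0
    simp only [map_smul, smul_eq_mul] at h0
    simp [h0]

theorem mem_spanRows_eliminate {n U : ℕ} {L B : ℕ → ℕ → F} {R : ℕ} {x : ℕ → F} :
    x ∈ spanRows U (eliminate n U L B R) ↔
      x ∈ spanRows U B ∧ ∀ i < R, ∑ y ∈ Finset.range n, L i y * x y = 0 := by
  induction R with
  | zero => simp [eliminate]
  | succ R ih =>
    rw [eliminate, mem_spanRows_elimStep, ih, and_assoc]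
    simp only [Nat.lt_succ_iff_lt_or_eq, or_imp, forall_and, forall_eq]

open Classical in
/-- The standard basis vectors with index in `ok`, and zero vectors in the other places. -/
noncomputable def coordVectors (ok : ℕ → Prop) : ℕ → ℕ → F :=
  fun u x => if u = x ∧ ok u then 1 else 0

theorem mem_spanRows_coordVectors {n : ℕ} {ok : ℕ → Prop} {x : ℕ → F} :
    x ∈ spanRows n (coordVectors (F := F) ok) ↔ ∀ u, x u ≠ 0 → u < n ∧ ok u := by
  classical
  rw [mem_spanRows]
  constructor
  · rintro ⟨c, rfl⟩ u hu
    by_contra h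
    refine hu ?_
    rw [Finset.sum_apply]
    refine Finset.sum_eq_zero fun v _ => ?_
    simp only [Pi.smul_apply, coordVectors, smul_eq_mul, mul_ite, mul_one, mul_zero]
    rw [if_neg]
    rintro ⟨rfl, h'⟩
    exact h ⟨v.2, h'⟩
  · intro h
    refine ⟨fun u => x u, ?_⟩
    ext y
    rw [Finset.sum_apply]
    simp only [Pi.smul_apply, coordVectors, smul_eq_mul, mul_ite, mul_one, mul_zero]
    by_cases hy : x y = 0
    · rw [hy]
      refine Finset.sum_eq_zero fun v _ => ?_
      split_ifs with hv
      · rw [hv.1, hy]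
      · rfl
    · obtain ⟨h1, h2⟩ := h y hy
      rw [Finset.sum_eq_single ⟨y, h1⟩]
      · simp [h2]
      · intro v _ hv
        rw [if_neg]
        rintro ⟨rfl, -⟩
        exact hv rfl
      · simp

end LinearAlgebra

variable {C : Ctx.{u}}

theorem lastIdx_lt {p : ℕ → Prop} [DecidablePred p] {d : ℕ} (h : 0 < d) : lastIdx p d < d := by
  induction d with
  | zero => omega
  | succ d ih =>
    rw [lastIdx]
    split_ifs
    · omega
    · rcases Nat.eq_zero_or_pos d with rfl | hd
      · simp [lastIdx]
      · have := ih hd; omega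

theorem FMat.elimStep {n U : C.Γ → ℕ} {l : ∀ γ : C.Γ, ℕ → (C.π γ).F}
    {B : ∀ γ : C.Γ, ℕ → ℕ → (C.π γ).F} (hn : FN C n) (hU : FN C U) (hl : FVec C n l)
    (hB : FMat C U n B) : FMat C U n fun γ => elimStep (n γ) (U γ) (l γ) (B γ) := by
  classical
  have hev : FVec C U fun γ u => ∑ y ∈ Finset.range (n γ), l γ y * B γ u y := by
    refine FVec.of hU (FE.sum hn.wk (FE.mul ?_ ?_))
    · exact FVec.get hl.wk.wk (FN.index hn.wk) fun p => p.2.2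
    · exact FMat.get hB.wk.wk (FN.index hU).wk (fun p => p.1.2.2)
        (FN.index hn.wk) fun p => p.2.2
  have hp : FN C fun γ =>
      FRS.lastIdx (fun u => ∑ y ∈ Finset.range (n γ), l γ y * B γ u y ≠ 0) (U γ) :=
    FN.lastIdx hU (FB.eqE (FVec.get hev.wk (FN.index hU) fun p => p.2.2) FE.zero).not
  have hpU : ∀ p : ((C.ix U).ix fun p => n p.1).Γ,
      FRS.lastIdx (fun u => ∑ y ∈ Finset.range (n p.1.1), l p.1.1 y * B p.1.1 u y ≠ 0) (U p.1.1) <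
        U p.1.1 := fun p => lastIdx_lt (by have := p.1.2.2; omega)
  refine FMat.of hU hn (FE.sub ?_ (FE.mul (FE.mul ?_ (FE.inv ?_)) ?_))
  · exact FMat.get hB.wk.wk (FN.index hU).wk (fun p => p.1.2.2)
      (FN.index hn.wk) fun p => p.2.2
  · exact FVec.get hev.wk.wk (FN.index hU).wk fun p => p.1.2.2
  · refine FE.congr (FVec.get hev.wk.wk hp.wk.wk hpU) fun p => by congr!
  · refine FE.congr (FMat.get hB.wk.wk hp.wk.wk hpU
      (FN.index hn.wk) fun p => p.2.2) fun p => by congr!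

theorem FMat.eliminate {n U R : C.Γ → ℕ} {L B : ∀ γ : C.Γ, ℕ → ℕ → (C.π γ).F}
    (hn : FN C n) (hU : FN C U) (hR : FN C R)
    (hL : FE ((C.ix R).ix fun p => n p.1) fun p => L p.1.1 p.1.2 p.2) (hB : FMat C U n B) :
    FMat C U n fun γ => eliminate (n γ) (U γ) (L γ) (B γ) (R γ) := by
  have hL' : FVec (C.ix R) (fun p => n p.1) fun p => L p.1 p.2 := FVec.of hn.wk hL
  refine Fast.iter
    (s := fun γ i => (C.π γ).mat (U γ) (n γ) (FRS.eliminate (n γ) (U γ) (L γ) (B γ) i)) hR hB ?_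
  exact FMat.elimStep hn.wks hU.wks hL'.toSt Fast.state

theorem FMat.coordVectors {n : C.Γ → ℕ} {ok : C.Γ → ℕ → Prop} (hn : FN C n)
    (hok : FB (C.ix n) fun p => ok p.1 p.2) :
    FMat C n n fun γ => coordVectors (F := (C.π γ).F) (ok γ) := by
  classical
  refine FMat.of hn hn (FE.congr (FE.ite ((FB.eq (FN.index hn).wk (FN.index hn.wk)).and hok.wk)
    FE.one FE.zero) fun p => ?_)
  simp only [FRS.coordVectors]

/-- Singularity of a square matrix can be tested in polynomial time. -/
theorem FB.exists_ker {n : C.Γ → ℕ} {A : ∀ γ : C.Γ, ℕ → ℕ → (C.π γ).F} (hn : FN C n)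
    (hA : FMat C n n A) :
    FB C fun γ => ∃ v : ℕ → (C.π γ).F, (∃ j < n γ, v j ≠ 0) ∧
      ∀ i < n γ, ∑ j ∈ Finset.range (n γ), A γ i j * v j = 0 := by
  have h1 := FMat.eliminate (L := A) hn hn hn
    (FMat.get hA.wk.wk (FN.index hn).wk (fun p => p.1.2.2)
      (FN.index hn.wk) fun p => p.2.2) (FMat.coordVectors (ok := fun _ _ => True) hn (FB.const _))
  have h2 := FB.ex (p := fun γ u => ∃ j < n γ, FRS.eliminate (n γ) (n γ) (A γ)
      (FRS.coordVectors fun _ => True) (n γ) u j ≠ 0) hn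
    (FB.ex (p := fun (p : (C.ix n).Γ) j => FRS.eliminate (n p.1) (n p.1) (A p.1)
      (FRS.coordVectors fun _ => True) (n p.1) p.2 j ≠ 0) hn.wk
      (FB.eqE (FMat.get h1.wk.wk (FN.index hn).wk (fun p => p.1.2.2)
        (FN.index hn.wk) fun p => p.2.2) FE.zero).not)
  refine h2.congr fun γ => ?_
  constructor
  · rintro ⟨v, ⟨j, hj, hvj⟩, hv⟩
    -- cut off the entries that play no role
    let v' : ℕ → (C.π γ).F := fun j => if j < n γ then v j else 0
    have hv' : v' ∈ spanRows (n γ) (FRS.eliminate (n γ) (n γ) (A γ)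
        (FRS.coordVectors fun _ => True) (n γ)) := by
      refine mem_spanRows_eliminate.2 ⟨mem_spanRows_coordVectors.2 fun u hu => ⟨?_, trivial⟩,
        fun i hi => ?_⟩
      · by_contra h
        simp [v', h] at hu
      · rw [← hv i hi]
        refine Finset.sum_congr rfl fun j hj => ?_
        simp [v', Finset.mem_range.1 hj]
    obtain ⟨c, hc⟩ := mem_spanRows.1 hv'
    by_contra! hz
    refine hvj ?_
    have : v' j = 0 := by
      rw [← hc, Finset.sum_apply]
      exact Finset.sum_eq_zero fun u _ => by simp [hz u u.2 j hj]
    simpa [v', hj] using this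
  · rintro ⟨u, hu, j, hj, h⟩
    have := mem_spanRows_eliminate.1 (row_mem_spanRows (FRS.eliminate (n γ) (n γ) (A γ)
        (FRS.coordVectors fun _ => True) (n γ)) hu)
    exact ⟨_, ⟨j, hj, h⟩, this.2⟩

end FRS

namespace FRS

/-! ### Multiplicities of zeros -/

section Multiplicity

open MvPolynomial

variable {F : Type*} [Field F] {σ : Type*}

/-- The polynomial `Q(· + a)`. -/
noncomputable def shift (a : σ → F) : MvPolynomial σ F →ₐ[F] MvPolynomial σ F :=
  aeval fun i => X i + C (a i)

theorem coeff_prod_aeval_X [Fintype σ] (p : σ → Polynomial F) (d : σ →₀ ℕ) :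
    (∏ i, Polynomial.aeval (X i : MvPolynomial σ F) (p i)).coeff d = ∏ i, (p i).coeff (d i) := by
  classical
  have h1 : ∀ i, Polynomial.aeval (X i : MvPolynomial σ F) (p i) =
      ∑ j ∈ (p i).support, monomial (Finsupp.single i j) ((p i).coeff j) := fun i => by
    rw [Polynomial.aeval_eq_sum_range' (Nat.lt_succ_self _), ← Finset.sum_subset
      (Polynomial.supp_subset_range_natDegree_succ)]
    · refine Finset.sum_congr rfl fun j _ => ?_
      rw [X_pow_eq_monomial, smul_monomial, smul_eq_mul, mul_one]
    · intro j _ hj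
      rw [Polynomial.notMem_support_iff.1 hj, zero_smul]
  have h2 : ∀ g : σ → ℕ, ∏ i, monomial (Finsupp.single i (g i)) ((p i).coeff (g i)) =
      (monomial (Finsupp.equivFunOnFinite.symm g) (∏ i, (p i).coeff (g i)) : MvPolynomial σ F) := by
    intro g
    rw [← monomial_sum_prod, Finsupp.equivFunOnFinite_symm_eq_sum]
  simp only [h1, Finset.prod_univ_sum, h2, coeff_sum, coeff_monomial]
  by_cases h : ∀ i, d i ∈ (p i).support
  · rw [Finset.sum_eq_single (d : σ → ℕ)]
    · simp
    · intro g _ hg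
      rw [if_neg]
      rintro rfl
      exact hg rfl
    · intro h'
      exact absurd (Fintype.mem_piFinset.2 h) h'
  · push Not at h
    obtain ⟨i, hi⟩ := h
    rw [Finset.prod_eq_zero (Finset.mem_univ i) (Polynomial.notMem_support_iff.1 hi)]
    refine Finset.sum_eq_zero fun g hg => ?_
    rw [if_neg]
    rintro rfl
    exact hi (Fintype.mem_piFinset.1 hg i)

theorem coeff_shift_monomial [Fintype σ] (a : σ → F) (e d : σ →₀ ℕ) (c : F) :
    (shift a (monomial e c)).coeff d =
      c * ∏ i, ((Polynomial.X + Polynomial.C (a i)) ^ e i).coeff (d i) := by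
  rw [← coeff_prod_aeval_X, ← coeff_C_mul, shift, aeval_monomial,
    Finsupp.prod_fintype _ _ fun i => pow_zero _]
  simp [algebraMap_eq]

theorem aeval_sub_shift (a : σ → F) (Q : MvPolynomial σ F) {A : Type*} [CommRing A] [Algebra F A]
    (g : σ → A) : aeval (fun i => g i - algebraMap F A (a i)) (shift a Q) = aeval g Q := by
  have : (aeval fun i => g i - algebraMap F A (a i)).comp (shift a) = aeval g := by
    refine algHom_ext fun i => ?_
    simp [shift, ← algebraMap_eq]
  exact DFunLike.congr_fun this Q

/-- A zero of multiplicity `r` gives a zero of multiplicity `r` on every curve through the point. -/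
theorem pow_dvd_aeval_of_hasZeroOfMult {Q : MvPolynomial σ F} {a : σ → F} {r : ℕ}
    (h : HasZeroOfMult Q a r) {g : σ → Polynomial F} {x : F} (hg : ∀ i, (g i).eval x = a i) :
    (Polynomial.X - Polynomial.C x) ^ r ∣ aeval g Q := by
  rw [← aeval_sub_shift a, aeval_def, eval₂_eq]
  refine Finset.dvd_sum fun d hd => Dvd.dvd.mul_left ?_ _
  have hdr : r ≤ d.degree := by
    by_contra! hlt
    exact (mem_support_iff.1 hd) (h d hlt)
  refine (pow_dvd_pow _ hdr).trans ?_
  rw [Finsupp.degree_apply, ← Finset.prod_pow_eq_pow_sum]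
  refine Finset.prod_dvd_prod_of_dvd _ _ fun i _ => pow_dvd_pow_of_dvd ?_ _
  rw [Polynomial.dvd_iff_isRoot]
  simp [hg]

/-- A factor that does not vanish at a point does not contribute to the multiplicity there. -/
theorem HasZeroOfMult.of_mul {P Q : MvPolynomial σ F} {a : σ → F} {r : ℕ}
    (h : HasZeroOfMult (P * Q) a r) (hP : eval a P ≠ 0) : HasZeroOfMult Q a r := by
  classical
  have h0 : (shift a P).coeff 0 = eval a P := by
    rw [← constantCoeff_eq]
    have : (constantCoeff : MvPolynomial σ F →+* F).comp (shift a).toRingHom = eval a := by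
      refine ringHom_ext (fun c => ?_) fun i => ?_ <;> simp [shift]
    exact DFunLike.congr_fun this P
  suffices H : ∀ n, ∀ d : σ →₀ ℕ, d.degree = n → n < r → (shift a Q).coeff d = 0 from
    fun d hd => H _ d rfl hd
  intro n
  induction n using Nat.strong_induction_on with
  | _ n ih =>
    intro d hdn hnr
    have h1 : (shift a (P * Q)).coeff d = 0 := h d (hdn ▸ hnr)
    rw [map_mul, coeff_mul, Finset.sum_eq_single (0, d)] at h1
    · exact (mul_eq_zero.1 h1).resolve_left (h0 ▸ hP)
    · rintro ⟨d1, d2⟩ hd hne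
      rw [Finset.HasAntidiagonal.mem_antidiagonal] at hd
      dsimp only at hd ⊢
      have hdeg : d1.degree + d2.degree = n := by rw [← hdn, ← hd, map_add]
      have hpos : d1.degree ≠ 0 := fun h' => by
        rw [Finsupp.degree_eq_zero_iff] at h'
        subst h'
        exact hne (by rw [← hd, zero_add])
      rw [ih d2.degree (by omega) d2 rfl (by omega), mul_zero]
    · intro h'
      exact absurd (Finset.HasAntidiagonal.mem_antidiagonal.2 (zero_add d)) h'

end Multiplicity

/-! ### Counting monomials -/

section Counting

open Finset

/-- The vectors `v` of `s` natural numbers with `k * ∑ v ≤ D`. -/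
def simplex (k : ℕ) : (s : ℕ) → ℕ → Finset (Fin s → ℕ)
  | 0, _ => {Fin.elim0}
  | s + 1, D => (range (D / k + 1)).biUnion fun j => (simplex k s (D - k * j)).image (Fin.cons j)

theorem mem_simplex {k s D : ℕ} (hk : 1 ≤ k) {v : Fin s → ℕ} :
    v ∈ simplex k s D ↔ k * ∑ i, v i ≤ D := by
  induction s generalizing D with
  | zero => simp [simplex, Subsingleton.elim v Fin.elim0]
  | succ s ih =>
    simp only [simplex, mem_biUnion, mem_range, mem_image, ih, Fin.sum_univ_succ, Nat.lt_succ_iff,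
      Nat.le_div_iff_mul_le hk]
    constructor
    · rintro ⟨j, hj, w, hw, rfl⟩
      simp only [Fin.cons_zero, Fin.cons_succ, mul_add]
      rw [mul_comm] at hj
      omega
    · intro h
      rw [mul_add] at h
      refine ⟨v 0, by rw [mul_comm]; omega, Fin.tail v, ?_, Fin.cons_self_tail v⟩
      simp only [Fin.tail]
      omega

theorem card_simplex_succ (k s D : ℕ) :
    #(simplex k (s + 1) D) = ∑ j ∈ range (D / k + 1), #(simplex k s (D - k * j)) := by
  rw [simplex, card_biUnion]
  · exact sum_congr rfl fun j _ => card_image_of_injective _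
      (Fin.cons_right_injective (α := fun _ => ℕ) j)
  · intro i _ j _ hij
    rw [Function.onFun, disjoint_left]
    rintro v hv hv'
    obtain ⟨w, -, rfl⟩ := mem_image.1 hv
    obtain ⟨w', -, h⟩ := mem_image.1 hv'
    exact hij (Fin.cons_injective2 h).1.symm

theorem pow_succ_le_sub_pow_add (a k s : ℕ) :
    a ^ (s + 1) ≤ (a - k) ^ (s + 1) + (s + 1) * k * a ^ s := by
  induction s with
  | zero => simp; omega
  | succ s ih =>
    have h1 : (a - k) ^ (s + 1) ≤ a ^ (s + 1) := Nat.pow_le_pow_left (Nat.sub_le _ _) _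
    have h2 : a ≤ (a - k) + k := by omega
    calc a ^ (s + 1 + 1) = a ^ (s + 1) * a := pow_succ _ _
      _ ≤ ((a - k) ^ (s + 1) + (s + 1) * k * a ^ s) * a := Nat.mul_le_mul_right _ ih
      _ = (a - k) ^ (s + 1) * a + (s + 1) * k * a ^ (s + 1) := by ring
      _ ≤ (a - k) ^ (s + 1) * ((a - k) + k) + (s + 1) * k * a ^ (s + 1) := by gcongr
      _ = (a - k) ^ (s + 1 + 1) + (k * (a - k) ^ (s + 1) + (s + 1) * k * a ^ (s + 1)) := by ring
      _ ≤ (a - k) ^ (s + 1 + 1) + (k * a ^ (s + 1) + (s + 1) * k * a ^ (s + 1)) := by gcongr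
      _ = _ := by ring

/-- A Riemann sum for `D ^ (s + 1) / (s + 1)`. -/
theorem pow_succ_le_sum (k s D : ℕ) (hk : 1 ≤ k) :
    D ^ (s + 1) ≤ ∑ j ∈ range (D / k + 1), (s + 1) * k * (D - k * j) ^ s := by
  have h : ∀ J, D ^ (s + 1) ≤
      (D - k * J) ^ (s + 1) + ∑ j ∈ range J, (s + 1) * k * (D - k * j) ^ s := by
    intro J
    induction J with
    | zero => simp
    | succ J ih =>
      refine ih.trans ?_
      have := pow_succ_le_sub_pow_add (D - k * J) k s
      rw [Nat.sub_sub, ← Nat.mul_succ] at this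
      rw [sum_range_succ]
      simp only [Nat.succ_eq_add_one] at this
      omega
  have h1 := h (D / k + 1)
  have h2 : D - k * (D / k + 1) = 0 := by
    have := Nat.lt_mul_div_succ D hk
    omega
  rwa [h2, zero_pow (by omega), zero_add] at h1

theorem pow_le_card_simplex (k s D : ℕ) (hk : 1 ≤ k) :
    D ^ s ≤ #(simplex k s D) * (s.factorial * k ^ s) := by
  induction s generalizing D with
  | zero => simp [simplex]
  | succ s ih =>
    refine (pow_succ_le_sum k s D hk).trans ?_
    rw [card_simplex_succ, sum_mul]
    refine sum_le_sum fun j _ => ?_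
    calc (s + 1) * k * (D - k * j) ^ s
        ≤ (s + 1) * k * (#(simplex k s (D - k * j)) * (s.factorial * k ^ s)) :=
          Nat.mul_le_mul_left _ (ih _)
      _ = _ := by rw [Nat.factorial_succ]; ring

theorem card_simplex_one (s D : ℕ) : #(simplex 1 s D) = (D + s).choose s := by
  induction s generalizing D with
  | zero => simp [simplex]
  | succ s ih =>
    simp only [card_simplex_succ, ih, Nat.div_one, one_mul]
    rw [← add_assoc, ← Nat.sum_range_add_choose, ← sum_range_reflect]
    refine sum_congr rfl fun j hj => ?_
    rw [mem_range] at hj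
    congr 2
    omega

/-- The exponents of monomials of `(1, k, …, k)`-weighted degree at most `D`. -/
def monomialSet (k s D : ℕ) : Finset (Fin (s + 1) → ℕ) :=
  (range (D + 1)).biUnion fun j => (simplex k s (D - j)).image (Fin.cons j)

theorem mem_monomialSet {k s D : ℕ} (hk : 1 ≤ k) {v : Fin (s + 1) → ℕ} :
    v ∈ monomialSet k s D ↔ v 0 + k * ∑ i : Fin s, v i.succ ≤ D := by
  simp only [monomialSet, mem_biUnion, mem_range, mem_image, mem_simplex hk]
  constructor
  · rintro ⟨j, hj, w, hw, rfl⟩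
    simp only [Fin.cons_zero, Fin.cons_succ]
    omega
  · intro h
    refine ⟨v 0, by omega, Fin.tail v, ?_, Fin.cons_self_tail v⟩
    simp only [Fin.tail]
    omega

theorem pow_le_card_monomialSet (k s D : ℕ) (hk : 1 ≤ k) :
    D ^ (s + 1) ≤ #(monomialSet k s D) * ((s + 1).factorial * k ^ s) := by
  have hcard : #(monomialSet k s D) = ∑ j ∈ range (D + 1), #(simplex k s (D - j)) := by
    rw [monomialSet, card_biUnion]
    · exact sum_congr rfl fun j _ =>
        card_image_of_injective _ (Fin.cons_right_injective (α := fun _ => ℕ) j)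
    · intro i _ j _ hij
      rw [Function.onFun, disjoint_left]
      rintro v hv hv'
      obtain ⟨w, -, rfl⟩ := mem_image.1 hv
      obtain ⟨w', -, h⟩ := mem_image.1 hv'
      exact hij (Fin.cons_injective2 h).1.symm
  have h1 := pow_succ_le_sum 1 s D le_rfl
  simp only [Nat.div_one, mul_one, one_mul] at h1
  refine h1.trans ?_
  rw [hcard, sum_mul]
  refine sum_le_sum fun j _ => ?_
  calc (s + 1) * (D - j) ^ s
      ≤ (s + 1) * (#(simplex k s (D - j)) * (s.factorial * k ^ s)) :=
        Nat.mul_le_mul_left _ (pow_le_card_simplex k s _ hk)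
    _ = _ := by rw [Nat.factorial_succ]; ring

end Counting

/-! ### Existence of interpolating polynomials -/

section Interpolation

open MvPolynomial

theorem weight_weight {s k : ℕ} (e : Fin (s + 1) →₀ ℕ) :
    Finsupp.weight (weight s k) e = e 0 + k * ∑ i : Fin s, e i.succ := by
  rw [Finsupp.weight_apply, Finsupp.sum_fintype _ _ fun i => by simp, Fin.sum_univ_succ]
  simp [weight, Finset.mul_sum, mul_comm]

theorem weightedTotalDegree_le_iff {F : Type*} [Field F] {s k D : ℕ}
    {Q : MvPolynomial (Fin (s + 1)) F} :
    Q.weightedTotalDegree (weight s k) ≤ D ↔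
      ∀ e ∈ Q.support, e 0 + k * ∑ i : Fin s, e i.succ ≤ D := by
  rw [weightedTotalDegree, Finset.sup_le_iff]
  simp only [weight_weight]

variable {F : Type*} [Field F] [Fintype F]

/-- Interpolating polynomials with a degree bound that is not tied to the other parameters. -/
def Interpolates (γ : Fˣ) (k s r D : ℕ) {m : ℕ} (z : Fin (blockLength F m) → Fin m → F)
    (Q : MvPolynomial (Fin (s + 1)) F) : Prop :=
  Q ≠ 0 ∧ Q.weightedTotalDegree (weight s k) ≤ D ∧
    ∀ i ∈ interpIndices F m s,
      HasZeroOfMult Q (Fin.cons ((γ : F) ^ i) fun j : Fin s => unfold z (i + j.val)) r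

/-- There are more monomials than linear conditions on their coefficients. -/
theorem exists_interpolates (γ : Fˣ) {k s r D m : ℕ} (hk : 1 ≤ k) (hr : 1 ≤ r)
    (hD : k ^ s * (interpIndices F m s).card * ∏ j ∈ Finset.range (s + 1), (r + j) < D ^ (s + 1))
    (z : Fin (blockLength F m) → Fin m → F) : ∃ Q, Interpolates γ k s r D z Q := by
  classical
  let pt : ℕ → Fin (s + 1) → F := fun i =>
    Fin.cons ((γ : F) ^ i) fun j : Fin s => unfold z (i + j.val)
  let mon : (Fin (s + 1) → ℕ) ≃ (Fin (s + 1) →₀ ℕ) := Finsupp.equivFunOnFinite.symm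
  let poly : (monomialSet k s D → F) →ₗ[F] MvPolynomial (Fin (s + 1)) F :=
    ∑ e : monomialSet k s D, (monomial (mon e)).comp (LinearMap.proj e)
  let cond : (monomialSet k s D → F) →ₗ[F]
      (interpIndices F m s × simplex 1 (s + 1) (r - 1) → F) :=
    LinearMap.pi fun p => (lcoeff F (mon p.2)).comp ((shift (pt p.1)).toLinearMap.comp poly)
  have hlt : Module.finrank F (interpIndices F m s × simplex 1 (s + 1) (r - 1) → F) <
      Module.finrank F (monomialSet k s D → F) := by
    rw [Module.finrank_fintype_fun_eq_card, Module.finrank_fintype_fun_eq_card, Fintype.card_prod,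
      Fintype.card_coe, Fintype.card_coe, Fintype.card_coe, card_simplex_one]
    have h1 : ∏ j ∈ Finset.range (s + 1), (r + j) =
        (s + 1).factorial * (r - 1 + (s + 1)).choose (s + 1) := by
      rw [← Nat.ascFactorial_eq_factorial_mul_choose, Nat.ascFactorial_eq_prod_range]
      exact Finset.prod_congr rfl fun j _ => by omega
    have h2 := hD.trans_le (pow_le_card_monomialSet k s D hk)
    rw [h1] at h2
    refine lt_of_mul_lt_mul_right (a := (s + 1).factorial * k ^ s) (lt_of_eq_of_lt ?_ h2)
      (Nat.zero_le _)
    ring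
  obtain ⟨x, hx, hx0⟩ := (Submodule.ne_bot_iff _).1 (LinearMap.ker_ne_bot_of_finrank_lt
    (f := cond) hlt)
  have hpoly : poly x = ∑ e : monomialSet k s D, monomial (mon e) (x e) := by simp [poly]
  have hcoeff : ∀ e : monomialSet k s D, (poly x).coeff (mon e) = x e := fun e => by
    rw [hpoly, coeff_sum, Finset.sum_eq_single e]
    · simp
    · intro e' _ h
      rw [coeff_monomial, if_neg]
      exact fun h' => h (Subtype.ext (mon.injective h'))
    · simp
  refine ⟨poly x, fun h => hx0 ?_, weightedTotalDegree_le_iff.2 fun e he => ?_, fun i hi d hd => ?_⟩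
  · ext e
    rw [← hcoeff, h, coeff_zero, Pi.zero_apply]
  · rw [hpoly] at he
    obtain ⟨e', -, h⟩ := Finset.mem_biUnion.1 (support_sum he)
    have := Finset.mem_singleton.1 (support_monomial_subset h)
    subst this
    exact (mem_monomialSet hk).1 e'.2
  · have hd' : mon.symm d ∈ simplex 1 (s + 1) (r - 1) := by
      rw [mem_simplex le_rfl, one_mul]
      have : d.degree = ∑ i, d i := Finsupp.degree_eq_sum d
      change ∑ i, d i ≤ _
      omega
    have h := congrFun (LinearMap.mem_ker.1 hx) (⟨i, hi⟩, ⟨mon.symm d, hd'⟩)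
    have h' : (shift (pt i) (poly x)).coeff d = 0 := by simpa [cond] using h
    exact h'

end Interpolation

end FRS

namespace FRS

/-! ### Agreement forces vanishing -/

section Agreement

variable {F : Type*} [Field F] [Fintype F]

theorem orderOf_generator {γ : Fˣ} (hγ : ∀ x : Fˣ, x ∈ Subgroup.zpowers γ) :
    orderOf γ = Fintype.card F - 1 := by
  classical
  rw [orderOf_eq_card_of_forall_mem_zpowers hγ, Nat.card_eq_fintype_card, Fintype.card_units]

theorem pow_generator_injOn {γ : Fˣ} (hγ : ∀ x : Fˣ, x ∈ Subgroup.zpowers γ) :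
    Set.InjOn (fun i : ℕ => (γ : F) ^ i) (Set.Iio (Fintype.card F - 1)) := by
  intro i hi j hj h
  rw [← orderOf_generator hγ] at hi hj
  refine pow_injOn_Iio_orderOf hi hj ?_
  ext
  simpa using h

theorem interpIndices_card_le (F : Type*) [Fintype F] (m s : ℕ) :
    (interpIndices F m s).card ≤ blockLength F m * (m - s + 1) := by
  classical
  have h : interpIndices F m s ⊆ (Finset.range (blockLength F m) ×ˢ Finset.range (m - s + 1)).image
      fun p => p.1 * m + p.2 := by
    intro i hi
    simp only [interpIndices, Finset.mem_filter, Finset.mem_range] at hi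
    refine Finset.mem_image.2 ⟨(i / m, i % m), ?_, Nat.div_add_mod' i m⟩
    rw [Finset.mem_product, Finset.mem_range, Finset.mem_range]
    exact ⟨Nat.div_lt_of_lt_mul (by rw [mul_comm]; exact hi.1), by dsimp only; omega⟩
  refine (Finset.card_le_card h).trans (Finset.card_image_le.trans ?_)
  simp

variable [DecidableEq F]

/-- The interpolation indices in the blocks where the encoding of `f` agrees with `z`. -/
def agreementIndices (γ : Fˣ) (s : ℕ) {m : ℕ} (z : Fin (blockLength F m) → Fin m → F)
    (f : Polynomial F) : Finset ℕ :=
  ((Finset.univ.filter fun j => encode γ m f j = z j) ×ˢ Finset.range (m - s + 1)).image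
    fun p => p.1.val * m + p.2

theorem card_agreementIndices (γ : Fˣ) {s m : ℕ} (hs : 1 ≤ s) (hsm : s ≤ m)
    (z : Fin (blockLength F m) → Fin m → F) (f : Polynomial F) :
    (agreementIndices γ s z f).card = agreement γ z f * (m - s + 1) := by
  rw [agreementIndices, Finset.card_image_of_injOn, Finset.card_product, Finset.card_range]
  · rfl
  · rintro ⟨i, l⟩ h ⟨i', l'⟩ h' heq
    simp only [Finset.coe_product, Set.mem_prod, Finset.mem_coe, Finset.mem_range] at h h' heq
    have h1 : (i.val * m + l) / m = i.val := by
      rw [mul_comm, Nat.mul_add_div (by omega), Nat.div_eq_of_lt (by omega), add_zero]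
    have h2 : (i'.val * m + l') / m = i'.val := by
      rw [mul_comm, Nat.mul_add_div (by omega), Nat.div_eq_of_lt (by omega), add_zero]
    have h3 : i = i' := Fin.ext (by rw [← h1, ← h2, heq])
    subst h3
    simpa using heq

theorem mem_agreementIndices {γ : Fˣ} {s m : ℕ} (hs : 1 ≤ s) (hsm : s ≤ m)
    {z : Fin (blockLength F m) → Fin m → F} {f : Polynomial F} {i : ℕ}
    (hi : i ∈ agreementIndices γ s z f) : i ∈ interpIndices F m s ∧
      ∀ j < s, f.eval ((γ : F) ^ (i + j)) = unfold z (i + j) := by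
  obtain ⟨⟨b, l⟩, hb, rfl⟩ := Finset.mem_image.1 hi
  rw [Finset.mem_product, Finset.mem_filter, Finset.mem_range] at hb
  obtain ⟨⟨-, hb⟩, hl⟩ := hb
  dsimp only at hb hl ⊢
  have hbN := b.2
  have hlt : ∀ l' < m, b.val * m + l' < blockLength F m * m := fun l' hl' => by
    calc b.val * m + l' < (b.val + 1) * m := by rw [add_mul, one_mul]; omega
      _ ≤ _ := Nat.mul_le_mul_right _ hbN
  refine ⟨?_, fun j hj => ?_⟩
  · rw [interpIndices, Finset.mem_filter, Finset.mem_range]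
    refine ⟨hlt l (by omega), ?_⟩
    rw [mul_comm, Nat.mul_add_mod, Nat.mod_eq_of_lt (by omega)]
    omega
  · have h1 : l + j < m := by omega
    have h2 : (b.val * m + (l + j)) / m = b.val := by
      rw [mul_comm, Nat.mul_add_div (by omega), Nat.div_eq_of_lt h1, add_zero]
    have h3 : (b.val * m + (l + j)) % m = l + j := by
      rw [mul_comm, Nat.mul_add_mod, Nat.mod_eq_of_lt h1]
    have h4 := congrFun hb ⟨l + j, h1⟩
    rw [add_assoc, unfold, dif_pos (by rw [mul_comm m]; exact hlt _ h1)]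
    simp only [h2, h3]
    exact h4

omit [Fintype F] [DecidableEq F] in
theorem natDegree_substitute_le {γ : Fˣ} {k s D : ℕ} {Q : MvPolynomial (Fin (s + 1)) F}
    (hQ : Q.weightedTotalDegree (weight s k) ≤ D) {f : Polynomial F} (hf : f.natDegree ≤ k) :
    (substitute γ Q f).natDegree ≤ D := by
  rw [substitute, MvPolynomial.aeval_def, MvPolynomial.eval₂_eq']
  refine Polynomial.natDegree_sum_le_of_forall_le _ _ fun e he => ?_
  refine le_trans ?_ (weightedTotalDegree_le_iff.1 hQ e he)
  refine (Polynomial.natDegree_C_mul_le _ _).trans ((Polynomial.natDegree_prod_le _ _).trans ?_)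
  rw [Fin.sum_univ_succ, Finset.mul_sum]
  refine add_le_add ?_ (Finset.sum_le_sum fun i _ => ?_)
  · simp
  · rw [Fin.cons_succ, mul_comm k]
    refine Polynomial.natDegree_pow_le.trans (Nat.mul_le_mul_left _ ?_)
    refine Polynomial.natDegree_comp_le.trans ((Nat.mul_le_mul hf ?_).trans_eq (mul_one k))
    exact (Polynomial.natDegree_C_mul_le _ _).trans Polynomial.natDegree_X_le

/-- If the encoding of `f` agrees with `z` in many positions, then the interpolating polynomial
vanishes on `f`, because the substitution has more zeros than its degree allows. -/
theorem substitute_eq_zero {γ : Fˣ} (hγ : ∀ x : Fˣ, x ∈ Subgroup.zpowers γ) {k s r D t m : ℕ}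
    (hs : 1 ≤ s) (hsm : s ≤ m) {z : Fin (blockLength F m) → Fin m → F}
    {Q : MvPolynomial (Fin (s + 1)) F} (hQ : Interpolates γ k s r D z Q)
    (hD : D < r * (t * (m - s + 1))) {f : Polynomial F} (hf : f.natDegree ≤ k)
    (ht : t ≤ agreement γ z f) : substitute γ Q f = 0 := by
  have hinj : Set.InjOn (fun i : ℕ => (γ : F) ^ i) (agreementIndices γ s z f) := by
    refine (pow_generator_injOn hγ).mono fun i hi => ?_
    have h1 := (mem_agreementIndices hs hsm hi).1
    rw [interpIndices, Finset.mem_filter, Finset.mem_range] at h1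
    exact h1.1.trans_le (Nat.div_mul_le_self _ _)
  have hdvd : ∏ i ∈ agreementIndices γ s z f,
      (Polynomial.X - Polynomial.C ((γ : F) ^ i)) ^ r ∣ substitute γ Q f := by
    refine Finset.prod_dvd_of_coprime (fun i hi j hj hij => ?_) fun i hi => ?_
    · exact (Polynomial.isCoprime_X_sub_C_of_isUnit_sub
        (sub_ne_zero.2 fun h => hij (hinj hi hj h)).isUnit).pow
    · obtain ⟨h1, h2⟩ := mem_agreementIndices hs hsm hi
      refine pow_dvd_aeval_of_hasZeroOfMult (hQ.2.2 i h1) fun j => ?_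
      refine Fin.cases ?_ (fun j => ?_) j
      · simp
      · simp only [Fin.cons_succ, Polynomial.eval_comp, Polynomial.eval_mul, Polynomial.eval_C,
          Polynomial.eval_X]
        rw [← pow_add, add_comm, h2 j j.2]
  refine Polynomial.eq_zero_of_dvd_of_natDegree_lt hdvd
    ((natDegree_substitute_le hQ.2.1 hf).trans_lt (hD.trans_le ?_))
  rw [Polynomial.natDegree_prod _ _ fun i _ => pow_ne_zero _ (Polynomial.X_sub_C_ne_zero _)]
  simp only [Polynomial.natDegree_pow, Polynomial.natDegree_X_sub_C, mul_one, Finset.sum_const,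
    smul_eq_mul, card_agreementIndices γ hs hsm]
  rw [mul_comm r]
  gcongr

end Agreement

/-! ### The extension field -/

section Extension

open Polynomial

universe u

/-- The polynomial `X ^ (q - 1) - γ` is irreducible: its roots are `γ ^ i * ξ`, all conjugate under
the Frobenius automorphism. -/
theorem exists_powerBasis (F : Type u) [Field F] [Fintype F] {γ : Fˣ}
    (hγ : ∀ x : Fˣ, x ∈ Subgroup.zpowers γ) :
    ∃ (K : Type u) (_ : Field K) (_ : Algebra F K) (pb : PowerBasis F K),
      pb.dim = Fintype.card F - 1 ∧ pb.gen ^ (Fintype.card F - 1) = algebraMap F K γ := by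
  classical
  have hq : 1 < Fintype.card F := Fintype.one_lt_card
  obtain ⟨ξ, hξ⟩ := IsAlgClosed.exists_pow_nat_eq (algebraMap F (AlgebraicClosure F) γ)
    (show 0 < Fintype.card F - 1 by omega)
  have hint : IsIntegral F ξ := Algebra.IsIntegral.isIntegral ξ
  have hξ0 : ξ ≠ 0 := by
    rintro rfl
    rw [zero_pow (by omega)] at hξ
    exact γ.ne_zero ((map_eq_zero _).1 hξ.symm)
  refine ⟨IntermediateField.adjoin F {ξ}, inferInstance, inferInstance,
    IntermediateField.adjoin.powerBasis hint, ?_, ?_⟩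
  · rw [IntermediateField.adjoin.powerBasis_dim]
    apply le_antisymm
    · have h1 : minpoly F ξ ∣ X ^ (Fintype.card F - 1) - C (γ : F) :=
        minpoly.dvd F ξ (by simp [hξ])
      have h2 := natDegree_le_of_dvd h1 (X_pow_sub_C_ne_zero (by omega) _)
      rwa [natDegree_X_pow_sub_C] at h2
    · let φ := FiniteField.frobeniusAlgHom F (AlgebraicClosure F)
      have hroot : ∀ i : ℕ, aeval (algebraMap F (AlgebraicClosure F) γ ^ i * ξ) (minpoly F ξ) = 0 := by
        intro i
        induction i with
        | zero => simp
        | succ i ih =>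
          have h : φ (algebraMap F (AlgebraicClosure F) γ ^ i * ξ) =
              algebraMap F (AlgebraicClosure F) γ ^ (i + 1) * ξ := by
            rw [map_mul, map_pow, AlgHom.commutes]
            have : φ ξ = ξ ^ (Fintype.card F - 1) * ξ := by
              rw [← pow_succ, Nat.sub_add_cancel hq.le]
              simp [φ]
            rw [this, hξ]
            ring
          rw [← h, aeval_algHom_apply, ih, map_zero]
      have h3 := card_le_degree_of_subset_roots (p := (minpoly F ξ).map (algebraMap F _))
        (Z := (Finset.range (Fintype.card F - 1)).image
          fun i => algebraMap F (AlgebraicClosure F) γ ^ i * ξ) ?_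
      · rw [Finset.card_image_of_injOn, Finset.card_range, natDegree_map] at h3
        · exact h3
        · intro i hi j hj h
          simp only [Finset.coe_range] at hi hj
          refine pow_generator_injOn hγ hi hj ?_
          have := mul_right_cancel₀ hξ0 h
          rw [← map_pow, ← map_pow] at this
          exact (algebraMap F (AlgebraicClosure F)).injective this
      · intro x hx
        obtain ⟨i, -, rfl⟩ := Finset.mem_image.1 (Finset.mem_def.2 hx)
        rw [mem_roots', IsRoot.def, eval_map_algebraMap]
        exact ⟨(Polynomial.map_ne_zero (minpoly.ne_zero hint)), hroot i⟩
  · rw [IntermediateField.adjoin.powerBasis_gen]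
    ext
    simpa using hξ

variable {F : Type*} [Field F] [Fintype F] {K : Type*} [Field K] [Algebra F K]

/-- Substituting `γ ^ i * X` for `X` becomes the Frobenius automorphism in the extension field. -/
theorem aeval_pow_mul_gen {γ : F} {ξ : K} (hξ : ξ ^ (Fintype.card F - 1) = algebraMap F K γ)
    (f : F[X]) (i : ℕ) :
    aeval (algebraMap F K γ ^ i * ξ) f = aeval ξ f ^ Fintype.card F ^ i := by
  let φ := FiniteField.frobeniusAlgHom F K
  have hq : 1 < Fintype.card F := Fintype.one_lt_card
  induction i with
  | zero => simp
  | succ i ih =>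
    have h : φ (algebraMap F K γ ^ i * ξ) = algebraMap F K γ ^ (i + 1) * ξ := by
      rw [map_mul, map_pow, AlgHom.commutes]
      have : φ ξ = ξ ^ (Fintype.card F - 1) * ξ := by
        rw [← pow_succ, Nat.sub_add_cancel hq.le]
        simp [φ]
      rw [this, hξ]
      ring
    rw [← h, aeval_algHom_apply, ih, pow_succ, pow_mul]
    simp [φ]

/-- The image of `Q` under `X ↦ ξ` and `Y_i ↦ Y ^ (q ^ i)`. -/
noncomputable def collapse (ξ : K) {s : ℕ} : MvPolynomial (Fin (s + 1)) F →ₐ[F] K[X] :=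
  MvPolynomial.aeval (Fin.cons (C ξ) fun i : Fin s => X ^ Fintype.card F ^ i.val)

theorem eval_collapse {γ : Fˣ} {ξ : K} (hξ : ξ ^ (Fintype.card F - 1) = algebraMap F K γ) {s : ℕ}
    (Q : MvPolynomial (Fin (s + 1)) F) (f : F[X]) :
    (collapse ξ Q).eval (aeval ξ f) = aeval ξ (substitute γ Q f) := by
  have h : ((aeval (aeval ξ f)).restrictScalars F).comp (collapse ξ) = (aeval ξ).comp
      (MvPolynomial.aeval (Fin.cons X fun j : Fin s => f.comp (C ((γ : F) ^ j.val) * X) :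
        Fin (s + 1) → F[X])) := by
    refine MvPolynomial.algHom_ext fun i => ?_
    refine Fin.cases ?_ (fun j => ?_) i
    · simp [collapse]
    · have := aeval_pow_mul_gen hξ f j
      simp [collapse, ← this, aeval_comp]
  have := DFunLike.congr_fun h Q
  simpa [substitute] using! this

theorem collapse_monomial (ξ : K) {s : ℕ} (e : Fin (s + 1) →₀ ℕ) (c : F) :
    collapse ξ (MvPolynomial.monomial e c) =
      C (c • ξ ^ e 0) * X ^ (∑ i : Fin s, e i.succ * Fintype.card F ^ i.val) := by
  rw [collapse, MvPolynomial.aeval_monomial, Finsupp.prod_fintype _ _ fun i => pow_zero _,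
    Fin.prod_univ_succ]
  simp only [Fin.cons_zero, Fin.cons_succ, ← pow_mul]
  rw [Finset.prod_pow_eq_pow_sum, Algebra.smul_def]
  simp [Polynomial.algebraMap_apply, mul_comm, mul_assoc]

end Extension

end FRS

namespace FRS

/-! ### Digits -/

section Digits

theorem sum_digits_lt {q s : ℕ} {v : Fin s → ℕ} (hv : ∀ i, v i < q) :
    ∑ i, v i * q ^ i.val < q ^ s := by
  have := finFunctionFinEquiv_apply (m := q) (n := s) fun i => ⟨v i, hv i⟩
  dsimp only at this
  rw [← this]
  exact Fin.is_lt _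

theorem sum_digits_div_mod {q s : ℕ} {v : Fin s → ℕ} (hv : ∀ i, v i < q) (j : Fin s) :
    (∑ i, v i * q ^ i.val) / q ^ j.val % q = v j := by
  have h1 := finFunctionFinEquiv_apply (m := q) (n := s) fun i => ⟨v i, hv i⟩
  have h2 := finFunctionFinEquiv_symm_apply_val (finFunctionFinEquiv (m := q) (n := s)
    fun i => ⟨v i, hv i⟩) j
  rw [Equiv.symm_apply_apply, h1] at h2
  exact h2.symm

theorem sum_div_mod_digits {q s l : ℕ} (hl : l < q ^ s) :
    ∑ i : Fin s, l / q ^ i.val % q * q ^ i.val = l := by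
  have h1 := finFunctionFinEquiv_apply (finFunctionFinEquiv.symm (⟨l, hl⟩ : Fin (q ^ s)))
  rw [Equiv.apply_symm_apply] at h1
  simpa using h1.symm

end Digits

/-! ### Interpolating polynomials that do not vanish in the extension field -/

section Collapse

open Polynomial

variable {F : Type*} [Field F] [Fintype F] {K : Type*} [Field K] [Algebra F K]

theorem exponent_lt {k D q s : ℕ} (hD : D < k * q) {e : Fin (s + 1) →₀ ℕ}
    (he : e 0 + k * ∑ i : Fin s, e i.succ ≤ D) (i : Fin s) : e i.succ < q := by
  have h1 : e i.succ ≤ ∑ i : Fin s, e i.succ :=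
    Finset.single_le_sum (f := fun i : Fin s => e i.succ) (fun _ _ => Nat.zero_le _)
      (Finset.mem_univ i)
  have h2 : k * e i.succ < k * q := by
    have := Nat.mul_le_mul_left k h1
    omega
  exact Nat.lt_of_mul_lt_mul_left h2

theorem collapse_eq_sum (ξ : K) {s : ℕ} (Q : MvPolynomial (Fin (s + 1)) F) :
    collapse ξ Q = ∑ e ∈ Q.support, C (Q.coeff e • ξ ^ e 0) *
      X ^ (∑ i : Fin s, e i.succ * Fintype.card F ^ i.val) := by
  conv_lhs => rw [Q.as_sum]
  simp only [map_sum, collapse_monomial]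

theorem natDegree_collapse_lt (ξ : K) {k s D : ℕ} (hD : D < k * Fintype.card F)
    {Q : MvPolynomial (Fin (s + 1)) F} (hQ : Q.weightedTotalDegree (weight s k) ≤ D) :
    (collapse ξ Q).natDegree < Fintype.card F ^ s := by
  have hpos : 0 < Fintype.card F ^ s := pow_pos Fintype.card_pos _
  rw [← Nat.le_sub_one_iff_lt hpos, collapse_eq_sum]
  refine natDegree_sum_le_of_forall_le _ _ fun e he => ?_
  refine (natDegree_C_mul_X_pow_le _ _).trans ?_
  have := sum_digits_lt (v := fun i : Fin s => e i.succ)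
    (exponent_lt hD (weightedTotalDegree_le_iff.1 hQ e he))
  omega

/-- The part of `Q` with exponents `v` of `Y_1, …, Y_s`, as a polynomial in `X`. -/
noncomputable def slice {s : ℕ} (Q : MvPolynomial (Fin (s + 1)) F) (v : Fin s →₀ ℕ) : F[X] :=
  ∑ e ∈ Q.support with e.tail = v, monomial (e 0) (Q.coeff e)

/-- The product of `p(X)` and the monomial in `Y_1, …, Y_s` with exponents `v`. -/
noncomputable def unslice {s : ℕ} (p : F[X]) (v : Fin s →₀ ℕ) : MvPolynomial (Fin (s + 1)) F :=
  aeval (MvPolynomial.X 0) p * MvPolynomial.monomial (Finsupp.cons 0 v) 1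

omit [Fintype F] in
theorem unslice_monomial {s : ℕ} (j : ℕ) (c : F) (v : Fin s →₀ ℕ) :
    unslice (monomial j c) v = MvPolynomial.monomial (Finsupp.cons j v) c := by
  rw [unslice, aeval_monomial, MvPolynomial.algebraMap_eq, MvPolynomial.X_pow_eq_monomial,
    MvPolynomial.C_mul_monomial, MvPolynomial.monomial_mul, mul_one, mul_one]
  have h : Finsupp.single 0 j + Finsupp.cons 0 v = Finsupp.cons j v := by
    ext i
    refine Fin.cases ?_ (fun i => ?_) i <;> simp
  rw [h]

omit [Fintype F] in
theorem unslice_sum {s : ℕ} {ι : Type*} (t : Finset ι) (p : ι → F[X]) (v : Fin s →₀ ℕ) :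
    unslice (∑ i ∈ t, p i) v = ∑ i ∈ t, unslice (p i) v := by
  simp [unslice, Finset.sum_mul]

omit [Fintype F] in
theorem sum_unslice_slice {s : ℕ} (Q : MvPolynomial (Fin (s + 1)) F) :
    ∑ v ∈ Q.support.image Finsupp.tail, unslice (slice Q v) v = Q := by
  conv_rhs => rw [Q.as_sum]
  rw [← Finset.sum_fiberwise_of_maps_to (g := Finsupp.tail) (t := Q.support.image Finsupp.tail)
    fun e he => Finset.mem_image_of_mem _ he]
  refine Finset.sum_congr rfl fun v _ => ?_
  rw [slice, unslice_sum]
  refine Finset.sum_congr rfl fun e he => ?_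
  rw [unslice_monomial, ← (Finset.mem_filter.1 he).2, Finsupp.cons_tail]

omit [Fintype F] in
theorem mem_support_unslice {s : ℕ} {p : F[X]} {v : Fin s →₀ ℕ} {e : Fin (s + 1) →₀ ℕ}
    (he : e ∈ (unslice p v).support) : e 0 ≤ p.natDegree ∧ p ≠ 0 ∧ e.tail = v := by
  classical
  rw [p.as_sum_support, unslice_sum] at he
  obtain ⟨j, hj, h⟩ := Finset.mem_biUnion.1 (MvPolynomial.support_sum he)
  rw [unslice_monomial] at h
  have := Finset.mem_singleton.1 (MvPolynomial.support_monomial_subset h)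
  subst this
  refine ⟨?_, ?_, Finsupp.tail_cons _ _⟩
  · rw [Finsupp.cons_zero]
    exact le_natDegree_of_mem_supp j hj
  · rintro rfl
    simp at hj

omit [Fintype F] in
theorem exists_of_slice_ne_zero {s : ℕ} {Q : MvPolynomial (Fin (s + 1)) F} {v : Fin s →₀ ℕ}
    (h : slice Q v ≠ 0) : ∃ e ∈ Q.support, e.tail = v ∧ e 0 = (slice Q v).natDegree := by
  have h1 := natDegree_mem_support_of_nonzero h
  rw [mem_support_iff] at h1
  nth_rw 1 [slice] at h1
  rw [finsetSum_coeff] at h1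
  obtain ⟨e, he, h2⟩ := Finset.exists_ne_zero_of_sum_ne_zero h1
  rw [Finset.mem_filter] at he
  rw [coeff_monomial] at h2
  exact ⟨e, he.1, he.2, by by_contra h3; exact h2 (if_neg h3)⟩

theorem collapse_eq_sum_slice (ξ : K) {s : ℕ} (Q : MvPolynomial (Fin (s + 1)) F) :
    collapse ξ Q = ∑ v ∈ Q.support.image Finsupp.tail,
      C (aeval ξ (slice Q v)) * X ^ (∑ i : Fin s, v i * Fintype.card F ^ i.val) := by
  rw [collapse_eq_sum, ← Finset.sum_fiberwise_of_maps_to (g := Finsupp.tail)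
    (t := Q.support.image Finsupp.tail) fun e he => Finset.mem_image_of_mem _ he]
  refine Finset.sum_congr rfl fun v _ => ?_
  rw [slice, map_sum, map_sum, Finset.sum_mul]
  refine Finset.sum_congr rfl fun e he => ?_
  rw [aeval_monomial, Algebra.smul_def, ← (Finset.mem_filter.1 he).2]
  rfl

/-- Dividing an interpolating polynomial by the minimal polynomial of `ξ`, which does not vanish at
the interpolation points, as often as possible gives one with nonzero image. -/
theorem exists_collapse_ne_zero {γ : Fˣ} (hγ : ∀ x : Fˣ, x ∈ Subgroup.zpowers γ)
    (hq : 3 ≤ Fintype.card F) (ξ : K) (hint : IsIntegral F ξ)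
    (hξ : ξ ^ (Fintype.card F - 1) = algebraMap F K γ) {k s r D m : ℕ}
    (hD : D < k * Fintype.card F) {z : Fin (blockLength F m) → Fin m → F}
    {Q : MvPolynomial (Fin (s + 1)) F} (hQ : Interpolates γ k s r D z Q) :
    ∃ Q', Interpolates γ k s r D z Q' ∧ collapse ξ Q' ≠ 0 := by
  suffices H : ∀ n, ∀ Q, Interpolates γ k s r D z Q → (∀ e ∈ Q.support, e 0 < n) →
      ∃ Q', Interpolates γ k s r D z Q' ∧ collapse ξ Q' ≠ 0 by
    refine H (D + 1) Q hQ fun e he => ?_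
    have := weightedTotalDegree_le_iff.1 hQ.2.1 e he
    omega
  intro n
  induction n with
  | zero =>
    intro Q hQ h
    refine absurd ?_ hQ.1
    rw [← MvPolynomial.support_eq_empty]
    exact Finset.eq_empty_of_forall_notMem fun e he => by simpa using h e he
  | succ n ih =>
    intro Q hQ h
    by_cases h0 : collapse ξ Q = 0
    swap
    · exact ⟨Q, hQ, h0⟩
    have hslice : ∀ v ∈ Q.support.image Finsupp.tail, minpoly F ξ ∣ slice Q v := by
      intro v hv
      refine minpoly.dvd F ξ ?_
      have h1 := congrArg (fun P => P.coeff (∑ i : Fin s, v i * Fintype.card F ^ i.val)) h0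
      simp only [collapse_eq_sum_slice, finsetSum_coeff, coeff_C_mul, coeff_X_pow, coeff_zero] at h1
      rw [Finset.sum_eq_single v] at h1
      · simpa using h1
      · intro w hw hwv
        rw [if_neg, mul_zero]
        intro heq
        refine hwv ?_
        have hlt : ∀ v ∈ Q.support.image Finsupp.tail, ∀ i, v i < Fintype.card F := by
          intro v hv i
          obtain ⟨e, he, rfl⟩ := Finset.mem_image.1 hv
          exact exponent_lt hD (weightedTotalDegree_le_iff.1 hQ.2.1 e he) i
        ext i
        rw [← sum_digits_div_mod (hlt w hw) i, ← sum_digits_div_mod (hlt v hv) i, heq]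
      · exact fun h => absurd hv h
    have hdvd : ∀ v, ∃ p : F[X], v ∈ Q.support.image Finsupp.tail →
        slice Q v = minpoly F ξ * p := fun v => by
      by_cases hv : v ∈ Q.support.image Finsupp.tail
      · obtain ⟨p, hp⟩ := hslice v hv
        exact ⟨p, fun _ => hp⟩
      · exact ⟨0, fun h => absurd h hv⟩
    choose p hp using hdvd
    let Q' := ∑ v ∈ Q.support.image Finsupp.tail, unslice (p v) v
    have hmul : aeval (MvPolynomial.X 0) (minpoly F ξ) * Q' = Q := by
      conv_rhs => rw [← sum_unslice_slice Q]
      rw [Finset.mul_sum]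
      refine Finset.sum_congr rfl fun v hv => ?_
      rw [hp v hv, unslice, unslice, map_mul, mul_assoc]
    have hsupp : ∀ e ∈ Q'.support, ∃ e' ∈ Q.support, e'.tail = e.tail ∧ e 0 < e' 0 := by
      intro e he
      obtain ⟨v, hv, h1⟩ := Finset.mem_biUnion.1 (MvPolynomial.support_sum he)
      obtain ⟨h2, h3, h4⟩ := mem_support_unslice h1
      have hne : slice Q v ≠ 0 := by
        rw [hp v hv]
        exact mul_ne_zero (minpoly.ne_zero hint) h3
      obtain ⟨e', he', h5, h6⟩ := exists_of_slice_ne_zero hne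
      refine ⟨e', he', h5.trans h4.symm, ?_⟩
      rw [h6, hp v hv, natDegree_mul (minpoly.ne_zero hint) h3]
      have := minpoly.natDegree_pos hint
      omega
    refine ih Q' ⟨fun h' => hQ.1 ?_, weightedTotalDegree_le_iff.2 fun e he => ?_, fun i hi => ?_⟩
      fun e he => ?_
    · rw [← hmul, h', mul_zero]
    · obtain ⟨e', he', h1, h2⟩ := hsupp e he
      have h3 := weightedTotalDegree_le_iff.1 hQ.2.1 e' he'
      have h4 : ∀ i : Fin s, e i.succ = e' i.succ := fun i => (DFunLike.congr_fun h1 i).symm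
      simp only [h4]
      omega
    · refine HasZeroOfMult.of_mul (P := aeval (MvPolynomial.X 0) (minpoly F ξ)) ?_ ?_
      · rw [hmul]
        exact hQ.2.2 i hi
      · rw [← MvPolynomial.coe_aeval_eq_eval, RingHom.coe_coe, ← Polynomial.aeval_algHom_apply,
          MvPolynomial.aeval_X, Fin.cons_zero]
        intro h1
        have h2 : minpoly F ξ ∣ X ^ (Fintype.card F - 1) - C (γ : F) :=
          minpoly.dvd F ξ (by simp [hξ])
        have h3 := aeval_eq_zero_of_dvd_aeval_eq_zero h2 h1
        simp only [map_sub, map_pow, aeval_X, aeval_C, Algebra.algebraMap_self, RingHom.id_apply] at h3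
        rw [← pow_mul, mul_comm, pow_mul, FiniteField.pow_card_sub_one_eq_one _ γ.ne_zero, one_pow,
          sub_eq_zero] at h3
        have h4 := orderOf_generator hγ
        rw [show γ = 1 from Units.ext h3.symm, orderOf_one] at h4
        omega
    · obtain ⟨e', he', h1, h2⟩ := hsupp e he
      have := h e' he'
      omega

/-- The number of polynomials whose encodings are close to `z` is bounded by the degree of the
image of an interpolating polynomial, all of whose zeros are in the extension field. -/
theorem card_le_natDegree [DecidableEq F] {γ : Fˣ} (hγ : ∀ x : Fˣ, x ∈ Subgroup.zpowers γ)
    (pb : PowerBasis F K) (hdim : pb.dim = Fintype.card F - 1)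
    (hgen : pb.gen ^ (Fintype.card F - 1) = algebraMap F K γ) {k s r D t m : ℕ}
    (hs : 1 ≤ s) (hsm : s ≤ m) (hk : k < Fintype.card F - 1)
    (hDt : D < r * (t * (m - s + 1)))
    {z : Fin (blockLength F m) → Fin m → F} {Q : MvPolynomial (Fin (s + 1)) F}
    (hQ : Interpolates γ k s r D z Q) (h0 : collapse pb.gen Q ≠ 0) (L : Finset F[X])
    (hL : ∀ f ∈ L, f.natDegree ≤ k ∧ t ≤ agreement γ z f) :
    L.card ≤ (collapse pb.gen Q).natDegree := by
  classical
  have hinj : Set.InjOn (fun f : F[X] => aeval pb.gen f) L := by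
    intro f hf g hg h
    by_contra hne
    have h1 := pb.dim_le_natDegree_of_root (sub_ne_zero.2 hne)
      (by rw [map_sub, sub_eq_zero]; exact h)
    have h2 := natDegree_sub_le f g
    have h3 := (hL f hf).1
    have h4 := (hL g hg).1
    omega
  rw [← Finset.card_image_of_injOn hinj]
  refine card_le_degree_of_subset_roots fun x hx => ?_
  obtain ⟨f, hf, rfl⟩ := Finset.mem_image.1 (Finset.mem_def.2 hx)
  rw [mem_roots', IsRoot.def, eval_collapse hgen,
    substitute_eq_zero hγ hs hsm hQ hDt (hL f hf).1 (hL f hf).2, map_zero]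
  exact ⟨h0, rfl⟩

/-- A bound for the number of polynomials with enough agreements, where `D < k q` guarantees that the
univariate polynomial over the extension field has degree less than `q ^ s`. -/
theorem card_le_of_interpolates [DecidableEq F] {γ : Fˣ} (hγ : ∀ x : Fˣ, x ∈ Subgroup.zpowers γ)
    (hq : 3 ≤ Fintype.card F) {k s r D t m : ℕ} (hs : 1 ≤ s) (hsm : s ≤ m)
    (hk : k < Fintype.card F - 1) (hD : D < k * Fintype.card F) (hDt : D < r * (t * (m - s + 1)))
    {z : Fin (blockLength F m) → Fin m → F} {Q : MvPolynomial (Fin (s + 1)) F}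
    (hQ : Interpolates γ k s r D z Q) (L : Finset F[X])
    (hL : ∀ f ∈ L, f.natDegree ≤ k ∧ t ≤ agreement γ z f) : L.card ≤ Fintype.card F ^ s := by
  obtain ⟨K, _, _, pb, hdim, hgen⟩ := exists_powerBasis F hγ
  obtain ⟨Q', hQ', h0⟩ := exists_collapse_ne_zero hγ hq pb.gen pb.isIntegral_gen hgen hD hQ
  exact (card_le_natDegree hγ pb hdim hgen hs hsm hk hDt hQ' h0 L hL).trans
    (natDegree_collapse_lt _ hD hQ'.2.1).le

end Collapse

end FRS

namespace FRS

/-! ### Choice of the parameters -/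

section Parameters

open Finset

/-- The arithmetic mean of `r, …, r + s` bounds their geometric mean. -/
theorem prod_add_le (r s : ℕ) :
    ∏ j ∈ range (s + 1), ((r : ℝ) + j) ≤ (r + s / 2) ^ (s + 1) := by
  have h0 : 0 ≤ ∏ j ∈ range (s + 1), ((r : ℝ) + j) := prod_nonneg fun j _ => by positivity
  refine le_of_sq_le_sq₀ ?_ (by positivity)
  calc (∏ j ∈ range (s + 1), ((r : ℝ) + j)) ^ 2
      = ∏ j ∈ range (s + 1), (((r : ℝ) + j) * (r + (s - j : ℕ))) := by
        rw [prod_mul_distrib, sq]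
        congr 1
        rw [← prod_range_reflect]
        simp
    _ ≤ ∏ j ∈ range (s + 1), ((r : ℝ) + s / 2) ^ 2 := by
        refine prod_le_prod (fun j _ => by positivity) fun j hj => ?_
        have : j ≤ s := by simpa [Nat.lt_succ_iff] using hj
        rw [Nat.cast_sub this]
        nlinarith [sq_nonneg ((j : ℝ) - s / 2)]
    _ = _ := by rw [prod_const, card_range, ← pow_mul, ← pow_mul, mul_comm]
where
  le_of_sq_le_sq₀ {a b : ℝ} (h : a ^ 2 ≤ b ^ 2) (hb : 0 ≤ b) : a ≤ b :=
    abs_le_of_sq_le_sq' h hb |>.2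

theorem rpow_inv_succ_pow {x : ℝ} (hx : 0 ≤ x) (s : ℕ) :
    (x ^ ((1 : ℝ) / ((s : ℝ) + 1))) ^ (s + 1) = x := by
  rw [one_div, ← Nat.cast_succ]
  exact Real.rpow_inv_natCast_pow hx (Nat.succ_ne_zero s)

theorem lt_of_bound_of_two_le {N k M s a x : ℝ} (hN : 3 ≤ N) (hk : 1 ≤ k) (hM : 1 ≤ M) (hs : 2 ≤ s)
    (hx : 4 * M * x ≤ k * N * M * s + a * (2 + 4 * M + 2 * M * s))
    (hlin : a * (s + 1) ≤ k * (N * M + s)) : x < k * (N * (M + s - 1)) := by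
  have hkey : N * M * s * (s + 1) + (N * M + s) * (2 + 4 * M + 2 * M * s) <
      4 * M * (N * (M + s - 1)) * (s + 1) := by
    obtain ⟨u, rfl⟩ : ∃ u : ℝ, s = u + 2 := ⟨s - 2, by ring⟩
    obtain ⟨v, rfl⟩ : ∃ v : ℝ, M = v + 1 := ⟨M - 1, by ring⟩
    obtain ⟨w, rfl⟩ : ∃ w : ℝ, N = w + 3 := ⟨N - 3, by ring⟩
    have hu0 : 0 ≤ u := by linarith
    have hv0 : 0 ≤ v := by linarith
    have hw0 : 0 ≤ w := by linarith
    rw [← sub_pos]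
    ring_nf
    positivity
  have h1 := mul_le_mul_of_nonneg_right hx (by linarith : 0 ≤ s + 1)
  have h2 := mul_le_mul_of_nonneg_right hlin (by positivity : 0 ≤ 2 + 4 * M + 2 * M * s)
  have h3 := mul_lt_mul_of_pos_left hkey (by linarith : 0 < k)
  have h4 : 4 * M * (s + 1) * x < 4 * M * (s + 1) * (k * (N * (M + s - 1))) := by linarith
  exact lt_of_mul_lt_mul_left h4 (by positivity)

theorem lt_of_bound_of_one {M a x y : ℝ} (hM : 1 ≤ M) (ha0 : 0 < a)
    (ha : 2 + 6 * M < (4 * M - 1) * a) (hx : 4 * M * x ≤ y + a * (2 + 6 * M)) (hy : a ^ 2 = y) :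
    x < y := by
  have h1 := mul_lt_mul_of_pos_right ha ha0
  have h2 : 4 * M * x < 4 * M * y := by
    rw [← hy] at hx ⊢
    linarith
  exact lt_of_mul_lt_mul_left h2 (by positivity)

theorem lt_slope {N k M t : ℕ} {a : ℝ} (hN : 3 ≤ N) (hk : 1 ≤ k) (hM : 1 ≤ M) (htN : t ≤ N)
    (h : N * k ≤ (t - 2) ^ 2 * M) (hspecial : ¬ (M = 1 ∧ k = 1 ∧ N ≤ 7)) (ha0 : 0 ≤ a)
    (ha : a ^ 2 = k * (N * M)) : 2 + 6 * (M : ℝ) < (4 * M - 1) * a := by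
  by_cases hM1 : M = 1
  · subst hM1
    have h8 : 8 ≤ k * N := by
      rcases eq_or_lt_of_le hk with hk1 | hk2
      · subst hk1
        omega
      · have h6 : 6 ≤ N := by
          by_contra! h6
          have h7 : (t - 2) ^ 2 ≤ (N - 2) ^ 2 := Nat.pow_le_pow_left (by omega) _
          have h8 : N * 2 ≤ N * k := Nat.mul_le_mul_left _ hk2
          have h9 : N * 2 ≤ (N - 2) ^ 2 := by omega
          interval_cases N <;> norm_num at h9
        nlinarith
    have h8r : (8 : ℝ) ≤ k * N := by exact_mod_cast h8
    push_cast at ha ⊢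
    by_contra! h'
    nlinarith
  · have hM2 : 2 ≤ M := by omega
    have h6 : (6 : ℝ) ≤ k * (N * M) := by
      have : 3 * 2 ≤ N * M := Nat.mul_le_mul hN hM2
      exact_mod_cast (show 6 ≤ k * (N * M) by nlinarith)
    have ha2 : 2 < a := by
      by_contra! h'
      nlinarith
    have hM2r : (2 : ℝ) ≤ M := by exact_mod_cast hM2
    nlinarith

/-- Interpolation parameters `r'`, `D'` for which the agreement `t` suffices and `D' < k * q`.  They
are used to bound the number of polynomials when the decoder's own parameters violate the latter
condition.  The multiplicity `r'` is the smallest for which the slack `2` in the agreement makes up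
for the factor by which the arithmetic mean of `r', …, r' + s` exceeds `r'`. -/
theorem exists_parameters {N k M s t : ℕ} (hN : 3 ≤ N) (hk : 1 ≤ k) (hM : 1 ≤ M) (hs : 1 ≤ s)
    (ht3 : 3 ≤ t) (htN : t ≤ N) (h : N * k ^ s ≤ (t - 2) ^ (s + 1) * M ^ s) (hkN : k < N * M) :
    ∃ r D : ℕ, 1 ≤ r ∧ k ^ s * (N * M) * ∏ j ∈ range (s + 1), (r + j) < D ^ (s + 1) ∧
      D < k * (N * (M + s - 1) + 1) ∧ D < r * (t * M) := by
  by_cases hspecial : s = 1 ∧ M = 1 ∧ k = 1 ∧ N ≤ 7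
  · obtain ⟨rfl, rfl, rfl, hN7⟩ := hspecial
    simp only [pow_one, mul_one] at h
    have ht4 : 4 ≤ t := by
      by_contra! h'
      obtain rfl : t = 3 := by omega
      norm_num at h
      omega
    by_cases hN4 : N ≤ 4
    · exact ⟨1, 3, le_rfl, by simp [prod_range_succ]; omega, by omega, by omega⟩
    · have ht5 : 5 ≤ t := by
        by_contra! h'
        obtain rfl : t = 4 := by omega
        norm_num at h
        omega
      exact ⟨1, 4, le_rfl, by simp [prod_range_succ]; omega, by omega, by omega⟩
  have hNr : (3 : ℝ) ≤ N := by exact_mod_cast hN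
  have hkr : (1 : ℝ) ≤ k := by exact_mod_cast hk
  have hMr : (1 : ℝ) ≤ M := by exact_mod_cast hM
  have hsr : (1 : ℝ) ≤ s := by exact_mod_cast hs
  have hkNr : (k : ℝ) ≤ N * M := by exact_mod_cast hkN.le
  have htr : (3 : ℝ) ≤ t := by exact_mod_cast ht3
  obtain ⟨a, ha0, ha⟩ : ∃ a : ℝ, 0 ≤ a ∧ a ^ (s + 1) = (k : ℝ) ^ s * (N * M) :=
    ⟨_, by positivity, rpow_inv_succ_pow (x := (k : ℝ) ^ s * (N * M)) (by positivity) s⟩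
  have hat : a ≤ M * (t - 2) := by
    refine le_of_pow_le_pow_left₀ (Nat.succ_ne_zero s) (by nlinarith) ?_
    rw [Nat.succ_eq_add_one, ha, mul_pow]
    have h' : (N : ℝ) * k ^ s ≤ (t - 2) ^ (s + 1) * M ^ s := by
      have := h
      rw [← Nat.cast_le (α := ℝ)] at this
      push_cast [Nat.cast_sub (show 2 ≤ t by omega)] at this
      exact this
    calc (k : ℝ) ^ s * (N * M) = N * k ^ s * M := by ring
      _ ≤ (t - 2) ^ (s + 1) * M ^ s * M := by gcongr
      _ = _ := by ring
  have hsq : a ^ 2 ≤ k * (N * M) := by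
    refine le_of_pow_le_pow_left₀ (Nat.succ_ne_zero s) (by positivity) ?_
    rw [Nat.succ_eq_add_one, ← pow_mul, mul_comm, pow_mul, ha]
    obtain ⟨s', rfl⟩ : ∃ s', s = s' + 1 := ⟨s - 1, by omega⟩
    calc ((k : ℝ) ^ (s' + 1) * (N * M : ℝ)) ^ 2
        = (k : ℝ) ^ s' * ((k : ℝ) ^ (s' + 2) * (N * M : ℝ) ^ 2) := by ring
      _ ≤ (N * M : ℝ) ^ s' * ((k : ℝ) ^ (s' + 2) * (N * M : ℝ) ^ 2) := by gcongr
      _ = _ := by ring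
  have hlin : a * (s + 1) ≤ k * (N * M + s) := by
    rw [← le_div_iff₀ (by positivity)]
    refine le_of_pow_le_pow_left₀ (Nat.succ_ne_zero s) (by positivity) ?_
    rw [Nat.succ_eq_add_one, ha]
    have hb := one_add_mul_le_pow (a := ((N : ℝ) * M - 1) / (s + 1)) ?_ (s + 1)
    · have h1 : (1 : ℝ) + ((s + 1 : ℕ) : ℝ) * (((N : ℝ) * M - 1) / (s + 1)) = N * M := by
        push_cast
        field_simp
        ring
      have h2 : (1 : ℝ) + ((N : ℝ) * M - 1) / (s + 1) = (N * M + s) / (s + 1) := by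
        field_simp
        ring
      rw [h1, h2] at hb
      calc (k : ℝ) ^ s * (N * M) ≤ k ^ s * ((N * M + s) / (s + 1)) ^ (s + 1) := by gcongr
        _ ≤ k ^ (s + 1) * ((N * M + s) / (s + 1)) ^ (s + 1) := by
          exact mul_le_mul_of_nonneg_right (pow_le_pow_right₀ hkr (Nat.le_succ s)) (by positivity)
        _ = _ := by rw [← mul_pow, mul_div_assoc]
    · have : (0 : ℝ) ≤ ((N : ℝ) * M - 1) / (s + 1) := div_nonneg (by nlinarith) (by positivity)
      linarith
  obtain ⟨r, hr⟩ : ∃ r : ℕ, r = ⌊(a * s / 2 + 1) / (2 * M)⌋₊ + 1 := ⟨_, rfl⟩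
  have hr1 : a * s / 2 + 1 < 2 * M * r := by
    have := Nat.lt_floor_add_one ((a * s / 2 + 1) / (2 * M))
    rw [div_lt_iff₀ (by positivity)] at this
    rw [hr]
    push_cast
    linarith
  have hr2 : 2 * M * (r : ℝ) ≤ a * s / 2 + 1 + 2 * M := by
    have := Nat.floor_le (a := (a * s / 2 + 1) / (2 * M)) (by positivity)
    rw [le_div_iff₀ (by positivity)] at this
    rw [hr]
    push_cast
    linarith
  have hx0 : 0 ≤ a * (r + s / 2) := by positivity
  have hfl := Nat.floor_le hx0
  -- the size of the real number whose integral part determines the degree bound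
  have hx : 4 * M * (a * (r + s / 2)) ≤ k * N * M * s + a * (2 + 4 * M + 2 * M * s) := by
    have : 4 * M * (a * (r + s / 2)) = 2 * (a * (2 * M * r)) + 2 * M * s * a := by ring
    nlinarith [mul_le_mul_of_nonneg_left hr2 ha0, mul_le_mul_of_nonneg_right hsq (by positivity :
      (0 : ℝ) ≤ s)]
  refine ⟨r, ⌊a * (r + s / 2)⌋₊ + 1, by omega, ?_, ?_, ?_⟩
  · have h1 : (k : ℝ) ^ s * (N * M) * ∏ j ∈ range (s + 1), ((r : ℝ) + j) <
        ((⌊a * (r + s / 2)⌋₊ : ℝ) + 1) ^ (s + 1) := by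
      calc (k : ℝ) ^ s * (N * M) * ∏ j ∈ range (s + 1), ((r : ℝ) + j)
          ≤ a ^ (s + 1) * (r + s / 2) ^ (s + 1) := by
            rw [ha]
            exact mul_le_mul_of_nonneg_left (prod_add_le r s) (by positivity)
        _ = (a * (r + s / 2)) ^ (s + 1) := (mul_pow _ _ _).symm
        _ < _ := pow_lt_pow_left₀ (Nat.lt_floor_add_one _) hx0 (Nat.succ_ne_zero s)
    exact_mod_cast h1
  · have key : a * (r + s / 2) < k * (N * (M + s - 1) + 1) - 1 := by
      rcases eq_or_lt_of_le hs with hs1 | hs2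
      · subst hs1
        have haa : a ^ 2 = k * (N * M) := by simpa using ha
        have ha' := lt_slope hN hk hM htN (by simpa using h) (fun h => hspecial ⟨rfl, h⟩) ha0 haa
        have hapos : 0 < a := lt_of_le_of_ne ha0 fun h0 => by
          rw [← h0] at haa
          have : (0 : ℝ) < k * (N * M) := by positivity
          rw [← haa] at this
          simp at this
        have := lt_of_bound_of_one (x := a * (r + (1 : ℕ) / 2)) hMr hapos ha'
          (by push_cast at hx ⊢; linarith) haa
        push_cast at this ⊢
        linarith
      · refine (lt_of_bound_of_two_le hNr hkr hMr (by exact_mod_cast hs2) hx hlin).trans_le ?_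
        nlinarith
    have h1 : ((⌊a * (r + s / 2)⌋₊ + 1 : ℕ) : ℝ) < ((k * (N * (M + s - 1) + 1) : ℕ) : ℝ) := by
      push_cast [Nat.cast_sub (show 1 ≤ M + s by omega)]
      linarith
    exact_mod_cast h1
  · have h1 : ((⌊a * (r + s / 2)⌋₊ + 1 : ℕ) : ℝ) < ((r * (t * M) : ℕ) : ℝ) := by
      push_cast
      have h2 : (a : ℝ) * r ≤ M * (t - 2) * r := mul_le_mul_of_nonneg_right hat (by positivity)
      nlinarith
    exact_mod_cast h1

end Parameters

end FRS

namespace FRS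

section Decoding

open Finset

theorem prod_range_eq_pow_mul {r : ℕ} (hr : 1 ≤ r) (s : ℕ) :
    ∏ j ∈ range (s + 1), ((r : ℝ) + j) = r ^ (s + 1) * ∏ j ∈ Icc 1 s, (1 + (j : ℝ) / r) := by
  have hr0 : (r : ℝ) ≠ 0 := by positivity
  induction s with
  | zero => simp
  | succ s ih =>
    rw [prod_range_succ, ih, prod_Icc_succ_top (by omega)]
    field_simp
    ring

/-- The condition on the agreement parameter in terms of natural numbers. -/
theorem agreement_bound {N m k s r t : ℕ} (hk : 1 ≤ k) (hsm : s ≤ m) (hr : 1 ≤ r) (htN : t ≤ N)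
    (ht : ((N : ℝ) * ((k : ℝ) / ((m : ℝ) - (s : ℝ) + 1)) ^ s *
      ∏ j ∈ Icc 1 s, (1 + (j : ℝ) / (r : ℝ))) ^ ((1 : ℝ) / ((s : ℝ) + 1)) + 2 ≤ (t : ℝ)) :
    3 ≤ t ∧ k ^ s * (N * (m - s + 1)) * ∏ j ∈ range (s + 1), (r + j) ≤
      (r * (m - s + 1) * (t - 2)) ^ (s + 1) := by
  have hM : ((m : ℝ) - s + 1) = ((m - s + 1 : ℕ) : ℝ) := by push_cast [Nat.cast_sub hsm]; ring
  rw [hM] at ht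
  set M := m - s + 1 with hMdef
  have hM0 : (0 : ℝ) < M := by
    rw [hMdef]
    positivity
  set P : ℝ := ∏ j ∈ Icc 1 s, (1 + (j : ℝ) / (r : ℝ)) with hP
  have hP0 : 0 < P := prod_pos fun j _ => by positivity
  have hk0 : (0 : ℝ) < k := by exact_mod_cast hk
  have hA0 : 0 ≤ (N : ℝ) * ((k : ℝ) / M) ^ s * P := by positivity
  have hroot : 0 ≤ ((N : ℝ) * ((k : ℝ) / M) ^ s * P) ^ ((1 : ℝ) / ((s : ℝ) + 1)) :=
    Real.rpow_nonneg hA0 _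
  have ht2 : 2 ≤ t := by
    have : (2 : ℝ) ≤ t := by linarith
    exact_mod_cast this
  have hN0 : (0 : ℝ) < N := by
    have : 0 < N := by omega
    exact_mod_cast this
  have hroot' : 0 < ((N : ℝ) * ((k : ℝ) / M) ^ s * P) ^ ((1 : ℝ) / ((s : ℝ) + 1)) :=
    Real.rpow_pos_of_pos (by positivity) _
  refine ⟨?_, ?_⟩
  · have : (2 : ℝ) < t := by linarith
    have : 2 < t := by exact_mod_cast this
    omega
  · have h1 : (N : ℝ) * ((k : ℝ) / M) ^ s * P ≤ (t - 2) ^ (s + 1) := by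
      rw [← rpow_inv_succ_pow hA0 s]
      exact pow_le_pow_left₀ hroot (by linarith) _
    have h2 : (k : ℝ) ^ s * (N * M) * ∏ j ∈ range (s + 1), ((r : ℝ) + j) ≤
        (r * M * (t - 2)) ^ (s + 1) := by
      rw [prod_range_eq_pow_mul hr]
      calc (k : ℝ) ^ s * (N * M) * (r ^ (s + 1) * P)
          = (r * M) ^ (s + 1) * ((N : ℝ) * ((k : ℝ) / M) ^ s * P) := by
            rw [mul_pow, div_pow, pow_succ (M : ℝ)]
            field_simp
        _ ≤ (r * M) ^ (s + 1) * (t - 2) ^ (s + 1) := by gcongr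
        _ = _ := (mul_pow _ _ _).symm
    have h3 : ((k ^ s * (N * M) * ∏ j ∈ range (s + 1), (r + j) : ℕ) : ℝ) ≤
        ((r * M * (t - 2)) ^ (s + 1) : ℕ) := by
      push_cast [Nat.cast_sub ht2]
      exact h2
    exact_mod_cast h3

/-- `D` is the least number with `V < D ^ (s + 1)`. -/
theorem floor_rpow_lt_iff {V s D : ℕ} :
    ⌊(V : ℝ) ^ ((1 : ℝ) / ((s : ℝ) + 1))⌋₊ < D ↔ V < D ^ (s + 1) := by
  have h0 : (0 : ℝ) ≤ (V : ℝ) ^ ((1 : ℝ) / ((s : ℝ) + 1)) := Real.rpow_nonneg (by positivity) _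
  rw [Nat.floor_lt h0, ← pow_lt_pow_iff_left₀ h0 (by positivity) (Nat.succ_ne_zero s),
    Nat.succ_eq_add_one, rpow_inv_succ_pow (by positivity)]
  exact_mod_cast Iff.rfl

variable {F : Type*} [Field F] [Fintype F]

variable (F) in
/-- The number whose `(s + 1)`-st root determines the degree of the interpolating polynomial. -/
def degreeRadicand (m k s r : ℕ) : ℕ :=
  k ^ s * (interpIndices F m s).card * ∏ j ∈ range (s + 1), (r + j)

omit [Field F] in
theorem interpDegree_eq (m k s r : ℕ) : interpDegree F m k s r =
    ⌊(degreeRadicand F m k s r : ℝ) ^ ((1 : ℝ) / ((s : ℝ) + 1))⌋₊ + 1 := by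
  rw [interpDegree, degreeRadicand]
  push_cast
  rfl

omit [Field F] in
theorem degreeRadicand_lt (m k s r : ℕ) :
    degreeRadicand F m k s r < interpDegree F m k s r ^ (s + 1) := by
  rw [← floor_rpow_lt_iff, interpDegree_eq]
  exact Nat.lt_succ_self _

omit [Field F] in
theorem interpDegree_le_iff {m k s r D : ℕ} :
    interpDegree F m k s r ≤ D ↔ degreeRadicand F m k s r < D ^ (s + 1) := by
  rw [← floor_rpow_lt_iff, interpDegree_eq, Nat.succ_le_iff]

omit [Field F] in
theorem le_interpDegree {m k s : ℕ} (hk : 1 ≤ k) (hn : 1 ≤ unfoldedLength F m) (r : ℕ) :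
    r ≤ interpDegree F m k s r := by
  have h0 : 1 ≤ (interpIndices F m s).card :=
    card_pos.2 ⟨0, mem_filter.2 ⟨mem_range.2 hn, by simp⟩⟩
  refine (lt_of_pow_lt_pow_left₀ (s + 1) (Nat.zero_le _)
    (lt_of_le_of_lt ?_ (degreeRadicand_lt (F := F) m k s r))).le
  calc r ^ (s + 1) = ∏ j ∈ range (s + 1), r := by simp
    _ ≤ ∏ j ∈ range (s + 1), (r + j) := prod_le_prod' fun j _ => Nat.le_add_right _ _
    _ ≤ _ := Nat.le_mul_of_pos_left _ (Nat.mul_pos (pow_pos hk _) h0)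

omit [Field F] in
/-- Numerical consequences of the hypotheses on the parameters. -/
theorem parameter_bounds {m k s r t : ℕ} (hk : 1 ≤ k) (hsm : s ≤ m) (hr : 1 ≤ r)
    (htN : t ≤ blockLength F m)
    (ht : ((blockLength F m : ℝ) * ((k : ℝ) / ((m : ℝ) - (s : ℝ) + 1)) ^ s *
      ∏ j ∈ Icc 1 s, (1 + (j : ℝ) / (r : ℝ))) ^ ((1 : ℝ) / ((s : ℝ) + 1)) + 2 ≤ (t : ℝ)) :
    3 ≤ t ∧ interpDegree F m k s r < r * (t * (m - s + 1)) ∧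
      blockLength F m * k ^ s ≤ (t - 2) ^ (s + 1) * (m - s + 1) ^ s ∧
      k < blockLength F m * (m - s + 1) := by
  obtain ⟨h3, h⟩ := agreement_bound hk hsm hr htN ht
  set M := m - s + 1 with hM
  set N := blockLength F m
  have hM1 : 1 ≤ M := by omega
  have h4 : N * k ^ s ≤ (t - 2) ^ (s + 1) * M ^ s := by
    have h5 : r ^ (s + 1) ≤ ∏ j ∈ range (s + 1), (r + j) := by
      calc r ^ (s + 1) = ∏ j ∈ range (s + 1), r := by simp
        _ ≤ _ := prod_le_prod' fun j _ => Nat.le_add_right _ _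
    refine Nat.le_of_mul_le_mul_left (c := r ^ (s + 1) * M) ?_ (by positivity)
    calc r ^ (s + 1) * M * (N * k ^ s) = k ^ s * (N * M) * r ^ (s + 1) := by ring
      _ ≤ k ^ s * (N * M) * ∏ j ∈ range (s + 1), (r + j) := Nat.mul_le_mul_left _ h5
      _ ≤ (r * M * (t - 2)) ^ (s + 1) := h
      _ = r ^ (s + 1) * M * ((t - 2) ^ (s + 1) * M ^ s) := by simp only [mul_pow]; ring
  refine ⟨h3, ?_, h4, ?_⟩
  · have h5 : interpDegree F m k s r ≤ r * M * (t - 2) + 1 := by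
      rw [interpDegree_le_iff]
      refine lt_of_le_of_lt ?_ (Nat.pow_lt_pow_left (Nat.lt_succ_self _) (Nat.succ_ne_zero s))
      refine le_trans ?_ h
      exact Nat.mul_le_mul_right _ (Nat.mul_le_mul_left _ (interpIndices_card_le F m s))
    have h6 : 1 ≤ r * M := Nat.mul_pos hr hM1
    obtain ⟨t', rfl⟩ : ∃ t', t = t' + 2 := ⟨t - 2, by omega⟩
    rw [Nat.add_sub_cancel] at h5
    calc _ ≤ r * M * t' + 1 := h5
      _ < r * M * t' + 2 * (r * M) := by omega
      _ = r * ((t' + 2) * M) := by ring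
  · by_contra! h5
    have h6 : N ^ (s + 1) * M ^ s ≤ (t - 2) ^ (s + 1) * M ^ s := by
      calc N ^ (s + 1) * M ^ s = N * (N * M) ^ s := by rw [mul_pow]; ring
        _ ≤ N * k ^ s := by gcongr
        _ ≤ _ := h4
    have h7 := (Nat.pow_le_pow_iff_left (Nat.succ_ne_zero s)).1
      (Nat.le_of_mul_le_mul_right h6 (by positivity))
    omega

theorem hammingDist_le_iff [DecidableEq F] {γ : Fˣ} {m t : ℕ}
    (htN : t ≤ blockLength F m) {z : Fin (blockLength F m) → Fin m → F} {f : Polynomial F} :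
    hammingDist (encode γ m f) z ≤ blockLength F m - t ↔ t ≤ agreement γ z f := by
  have h := card_filter_add_card_filter_not (s := (univ : Finset (Fin (blockLength F m))))
    fun j => encode γ m f j = z j
  rw [card_univ, Fintype.card_fin] at h
  have h' : hammingDist (encode γ m f) z =
    #{j | ¬ encode γ m f j = z j} := by
    rw [hammingDist]
  rw [h', agreement]
  omega

variable [DecidableEq F]

theorem IsDecoderRun.mem_map_iff {γ : Fˣ} (hγ : ∀ x : Fˣ, x ∈ Subgroup.zpowers γ) {k s r t m : ℕ}
    (hs : 1 ≤ s) (hsm : s ≤ m) (htN : t ≤ blockLength F m)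
    (hDt : interpDegree F m k s r < r * (t * (m - s + 1)))
    {z : Fin (blockLength F m) → Fin m → F} {Q : MvPolynomial (Fin (s + 1)) F}
    {L : List (Polynomial F)} (h : IsDecoderRun γ k s r t z Q L)
    (c : Fin (blockLength F m) → Fin m → F) :
    c ∈ L.map (encode γ m) ↔ c ∈ code γ m k ∧ hammingDist c z ≤ blockLength F m - t := by
  obtain ⟨hQ, -, hL⟩ := h
  rw [List.mem_map]
  constructor
  · rintro ⟨f, hf, rfl⟩
    obtain ⟨h1, -, h2⟩ := (hL f).1 hf
    exact ⟨⟨f, h1, rfl⟩, (hammingDist_le_iff htN).2 h2⟩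
  · rintro ⟨⟨f, h1, rfl⟩, h2⟩
    have h3 := (hammingDist_le_iff htN).1 h2
    exact ⟨f, (hL f).2 ⟨h1, substitute_eq_zero hγ hs hsm hQ hDt h1 h3, h3⟩, rfl⟩

/-- The interpolating polynomial of the run itself need not yield this bound, since its degree may be
too large; one for other parameters does. -/
theorem IsDecoderRun.length_le {γ : Fˣ} (hγ : ∀ x : Fˣ, x ∈ Subgroup.zpowers γ) {k s r t m : ℕ}
    (hk : 1 ≤ k) (hs : 1 ≤ s) (hsm : s ≤ m) (htN : t ≤ blockLength F m) (ht3 : 3 ≤ t)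
    (hN : blockLength F m * k ^ s ≤ (t - 2) ^ (s + 1) * (m - s + 1) ^ s)
    (hkN : k < blockLength F m * (m - s + 1))
    {z : Fin (blockLength F m) → Fin m → F} {Q : MvPolynomial (Fin (s + 1)) F}
    {L : List (Polynomial F)} (h : IsDecoderRun γ k s r t z Q L) :
    L.length ≤ Fintype.card F ^ s := by
  obtain ⟨r', D, hr', hV, hD, hDt⟩ := exists_parameters (ht3.trans htN) hk (by omega) hs ht3 htN
    hN hkN
  have hn : blockLength F m * m ≤ Fintype.card F - 1 := Nat.div_mul_le_self _ _
  have hNm : blockLength F m * (m - s + 1) ≤ blockLength F m * m :=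
    Nat.mul_le_mul_left _ (by omega)
  have hm3 : 3 ≤ blockLength F m * m := (ht3.trans htN).trans (Nat.le_mul_of_pos_right _ (by omega))
  rw [show m - s + 1 + s - 1 = m by omega] at hD
  obtain ⟨Q', hQ'⟩ := exists_interpolates γ hk hr' (lt_of_le_of_lt (Nat.mul_le_mul_right _
    (Nat.mul_le_mul_left _ (interpIndices_card_le F m s))) hV) z
  rw [← List.toFinset_card_of_nodup h.2.1]
  refine card_le_of_interpolates hγ (by omega) hs hsm (by omega)
    (hD.trans_le (Nat.mul_le_mul_left _ (by omega))) hDt hQ' _ fun f hf => ?_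
  have := (h.2.2 f).1 (List.mem_toFinset.1 hf)
  exact ⟨this.1, this.2.2⟩

end Decoding

end FRS

namespace FRS

/-! ### Searching the zeros of a polynomial digit by digit -/

section Tower

open Finset

variable {F : Type*} [Field F] [Fintype F] {R : Type*} [CommRing R] [Algebra F R]

/-- The polynomial `∏ (X - a c)` over all `a` in `F`, whose zeros form the line spanned by `c`, is
the additive polynomial `X ^ q - c ^ (q - 1) X`. -/
theorem prod_sub_smul (c x : R) :
    ∏ a : F, (x - a • c) = x ^ Fintype.card F - c ^ (Fintype.card F - 1) * x := by
  classical
  have hq : 1 < Fintype.card F := Fintype.one_lt_card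
  have h1 : (∏ a : F, (Polynomial.X - Polynomial.C a)) =
      (Polynomial.X ^ Fintype.card F - Polynomial.X : Polynomial F) := by
    have := FiniteField.X_pow_card_sub_X_natDegree_eq F hq
    have hroots := FiniteField.roots_X_pow_card_sub_X F
    have hmonic : (Polynomial.X ^ Fintype.card F - Polynomial.X : Polynomial F).Monic :=
      Polynomial.monic_X_pow_sub (by rw [Polynomial.degree_X]; exact_mod_cast hq)
    have hcard : (Polynomial.X ^ Fintype.card F - Polynomial.X : Polynomial F).roots.card =
        (Polynomial.X ^ Fintype.card F - Polynomial.X : Polynomial F).natDegree := by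
      rw [hroots, this]
      exact Finset.card_univ
    have := Polynomial.prod_multiset_X_sub_C_of_monic_of_roots_card_eq hmonic hcard
    rw [hroots] at this
    exact this
  -- the homogeneous form of this identity
  have h2 : (∏ a : F, (MvPolynomial.X 0 - MvPolynomial.C a * MvPolynomial.X 1) :
      MvPolynomial (Fin 2) F) = MvPolynomial.X 0 ^ Fintype.card F -
        MvPolynomial.X 1 ^ (Fintype.card F - 1) * MvPolynomial.X 0 := by
    let A := MvPolynomial (Fin 2) F
    let L := FractionRing A
    have hinj : Function.Injective (algebraMap A L) := IsFractionRing.injective A L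
    apply hinj
    set u : L := algebraMap A L (MvPolynomial.X 0)
    set v : L := algebraMap A L (MvPolynomial.X 1) with hv
    have hv0 : v ≠ 0 := by
      rw [hv, Ne, map_eq_zero_iff _ hinj]
      exact MvPolynomial.X_ne_zero _
    have h3 := congrArg (Polynomial.aeval (u / v)) h1
    rw [map_prod, map_sub, map_pow, Polynomial.aeval_X] at h3
    simp only [map_sub, Polynomial.aeval_X, Polynomial.aeval_C] at h3
    rw [map_prod, map_sub, map_mul, map_pow, map_pow]
    have h4 : ∀ a : F, algebraMap A L (MvPolynomial.X 0 - MvPolynomial.C a * MvPolynomial.X 1) =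
        v * (u / v - algebraMap F L a) := fun a => by
      rw [map_sub, map_mul, mul_sub, mul_div_cancel₀ _ hv0, mul_comm v]
      rfl
    rw [prod_congr rfl fun a _ => h4 a, prod_mul_distrib, h3, prod_const, card_univ, mul_sub,
      ← mul_pow, mul_div_cancel₀ _ hv0]
    congr 1
    obtain ⟨q', hq'⟩ : ∃ q', Fintype.card F = q' + 1 := ⟨Fintype.card F - 1, by omega⟩
    rw [hq', pow_succ, Nat.add_sub_cancel, mul_assoc, mul_div_cancel₀ _ hv0]
  have h3 := congrArg (MvPolynomial.aeval ![x, c]) h2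
  rw [map_prod] at h3
  simpa [Algebra.smul_def] using h3

/-- The additive polynomial `∏ (X - a c)` with zeros in the line spanned by `c`, as a linear map. -/
noncomputable def lineMap (c : R) : R →ₗ[F] R :=
  (FiniteField.frobeniusAlgHom F R).toLinearMap - LinearMap.mulLeft F (c ^ (Fintype.card F - 1))

theorem lineMap_apply (c x : R) : lineMap (F := F) c x = ∏ a : F, (x - a • c) := by
  rw [prod_sub_smul]
  simp [lineMap]

variable (F) in
/-- Starting from elements `y 0, y 1, …`, the `j`-th stage consists of the values at these elements
of the additive polynomial whose zeros form the span of `y 0, …, y (j - 1)`. -/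
noncomputable def tower (y : ℕ → R) : ℕ → ℕ → R
  | 0 => y
  | j + 1 => fun i => ∏ a : F, (tower y j i - a • tower y j j)

theorem tower_succ (y : ℕ → R) (j i : ℕ) :
    tower F y (j + 1) i = lineMap (F := F) (tower F y j j) (tower F y j i) := by
  rw [lineMap_apply, tower]

/-- The product of all elements `y (k + 1) - ∑ g_i y_i`, where `g` runs through the polynomials of
degree at most `k` that agree with `f` in the coefficients with index at least `j`. -/
noncomputable def towerNorm (k : ℕ) (y : ℕ → R) (j : ℕ) (f : Polynomial F) : R :=
  tower F y j (k + 1) - ∑ i ∈ range (k + 1), f.coeff i • tower F y j i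

/-- The next stage is the product over the choices of one more coefficient. -/
theorem towerNorm_succ {k j : ℕ} (hj : j ≤ k) (y : ℕ → R) (f : Polynomial F) :
    towerNorm k y (j + 1) f = ∏ a : F, towerNorm k y j (f + Polynomial.monomial j a) := by
  have h : ∀ a : F, towerNorm k y j (f + Polynomial.monomial j a) =
      towerNorm k y j f - a • tower F y j j := fun a => by
    simp only [towerNorm, Polynomial.coeff_add, Polynomial.coeff_monomial, add_smul,
      sum_add_distrib, ite_smul, zero_smul, sum_ite_eq, mem_range]
    rw [if_pos (by omega), sub_add_eq_sub_sub]
  rw [Finset.prod_congr rfl fun a _ => h a, ← lineMap_apply]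
  simp only [towerNorm, map_sub, map_sum, map_smul, tower_succ]

theorem not_isUnit_towerNorm_succ {k j : ℕ} (hj : j ≤ k) (y : ℕ → R) (f : Polynomial F) :
    ¬ IsUnit (towerNorm k y (j + 1) f) ↔
      ∃ a : F, ¬ IsUnit (towerNorm k y j (f + Polynomial.monomial j a)) := by
  rw [towerNorm_succ hj, IsUnit.prod_univ_iff]
  push Not
  rfl

/-- A non-unit on a later stage comes from a non-unit on the initial one. -/
theorem exists_not_isUnit_towerNorm_zero {k j : ℕ} (hj : j ≤ k + 1) (y : ℕ → R) {f : Polynomial F}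
    (hf : f.natDegree ≤ k) (h : ¬ IsUnit (towerNorm k y j f)) :
    ∃ g : Polynomial F, g.natDegree ≤ k ∧ (∀ i ≥ j, g.coeff i = f.coeff i) ∧
      ¬ IsUnit (towerNorm k y 0 g) := by
  induction j generalizing f with
  | zero => exact ⟨f, hf, fun _ _ => rfl, h⟩
  | succ j ih =>
    obtain ⟨a, ha⟩ := (not_isUnit_towerNorm_succ (by omega) y f).1 h
    obtain ⟨g, hg, hc, hu⟩ := ih (by omega) (Polynomial.natDegree_add_le_of_degree_le hf
      ((Polynomial.natDegree_monomial_le a).trans (by omega))) ha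
    refine ⟨g, hg, fun i hi => ?_, hu⟩
    rw [hc i (by omega), Polynomial.coeff_add, Polynomial.coeff_monomial, if_neg (by omega),
      add_zero]

end Tower

/-! ### Enumeration of the zeros -/

section Search

open Polynomial

variable {F : Type*} [Field F]

open Classical in
/-- The polynomials `g + a X ^ j` that satisfy `p`, for the first `b` pairs of a polynomial `g` in
`l` and a field element `a = elt i` with `i < q`, in some order. -/
noncomputable def extendBy (p : F[X] → Prop) (q : ℕ) (elt : ℕ → F) (j : ℕ) (l : List F[X]) :
    ℕ → List F[X]
  | 0 => []
  | b + 1 =>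
    if b / q < l.length ∧ p (l.getD (b / q) 0 + monomial j (elt (b % q))) then
      (l.getD (b / q) 0 + monomial j (elt (b % q))) :: extendBy p q elt j l b
    else extendBy p q elt j l b

variable {p : F[X] → Prop} {q : ℕ} {elt : ℕ → F} {j : ℕ} {l : List F[X]}

theorem mem_extendBy {b : ℕ} {f : F[X]} : f ∈ extendBy p q elt j l b ↔
    p f ∧ ∃ c < b, c / q < l.length ∧ f = l.getD (c / q) 0 + monomial j (elt (c % q)) := by
  induction b with
  | zero => simp [extendBy]
  | succ b ih =>
    rw [extendBy]
    simp only [Nat.lt_succ_iff_lt_or_eq, or_and_right, exists_or, exists_eq_left]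
    split_ifs with h
    · rw [List.mem_cons, ih]
      constructor
      · rintro (rfl | h')
        · exact ⟨h.2, .inr ⟨h.1, rfl⟩⟩
        · exact ⟨h'.1, .inl h'.2⟩
      · rintro ⟨h1, h2 | h2⟩
        · exact .inr ⟨h1, h2⟩
        · exact .inl h2.2
    · rw [ih]
      constructor
      · rintro ⟨h1, h2⟩
        exact ⟨h1, .inl h2⟩
      · rintro ⟨h1, h2 | h2⟩
        · exact ⟨h1, h2⟩
        · exact absurd ⟨h2.1, h2.2 ▸ h1⟩ h

/-- The pairs can be recovered from the sums. -/
theorem nodup_extendBy (hl : l.Nodup) (hlj : ∀ g ∈ l, g.coeff j = 0)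
    (helt : Set.InjOn elt (Set.Iio q)) (hq : 0 < q) (b : ℕ) : (extendBy p q elt j l b).Nodup := by
  induction b with
  | zero => exact List.nodup_nil
  | succ b ih =>
    rw [extendBy]
    split_ifs with h
    · refine List.nodup_cons.2 ⟨fun hmem => ?_, ih⟩
      obtain ⟨-, c, hc, hcl, heq⟩ := mem_extendBy.1 hmem
      have hbl := h.1
      clear h
      rw [List.getD_eq_getElem _ _ hbl, List.getD_eq_getElem _ _ hcl] at heq
      have h1 : elt (b % q) = elt (c % q) := by
        have := congrArg (fun f : F[X] => f.coeff j) heq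
        simpa [coeff_monomial, hlj _ (List.getElem_mem _)] using this
      rw [h1] at heq
      have h2 := (List.Nodup.getElem_inj_iff hl).1 (add_right_cancel heq)
      have h3 := helt (Nat.mod_lt b hq) (Nat.mod_lt c hq) h1
      have h4 := Nat.div_add_mod b q
      have h5 := Nat.div_add_mod c q
      rw [h2, h3] at h4
      omega
    · exact ih

theorem mem_extendBy_mul {B : ℕ} (hB : l.length ≤ B) (helt : ∀ a, ∃ i < q, elt i = a) {f : F[X]} :
    f ∈ extendBy p q elt j l (B * q) ↔ p f ∧ ∃ g ∈ l, ∃ a, f = g + monomial j a := by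
  rw [mem_extendBy]
  refine and_congr_right fun _ => ⟨?_, ?_⟩
  · rintro ⟨c, -, hc, rfl⟩
    rw [List.getD_eq_getElem _ _ hc]
    exact ⟨_, List.getElem_mem _, _, rfl⟩
  · rintro ⟨g, hg, a, rfl⟩
    obtain ⟨b, hb, rfl⟩ := List.getElem_of_mem hg
    obtain ⟨i, hi, rfl⟩ := helt a
    have h1 : (i + q * b) / q = b := by
      rw [Nat.add_mul_div_left _ _ (by omega), Nat.div_eq_of_lt hi, zero_add]
    refine ⟨i + q * b, ?_, by rwa [h1], ?_⟩
    · calc i + q * b < q * (b + 1) := by rw [Nat.mul_succ]; omega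
        _ ≤ B * q := by rw [mul_comm]; exact Nat.mul_le_mul_right _ (by omega)
    · rw [h1, Nat.add_mul_mod_self_left, Nat.mod_eq_of_lt hi, List.getD_eq_getElem _ _ hb]

variable (p : ℕ → F[X] → Prop) (q elt) in
/-- The polynomials of degree at most `k` that satisfy `p 0`, found by determining the coefficients
one by one, the leading one first.  After `i` steps, the coefficients with index at least
`j = k + 1 - i` are known, and the list consists of the polynomials divisible by `X ^ j` that
satisfy `p j`.  The lists are assumed to have length at most `B`. -/
noncomputable def search (B k : ℕ) : ℕ → List F[X]
  | 0 => [0]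
  | i + 1 => extendBy (p (k - i)) q elt (k - i) (search B k i) (B * q)

theorem search_spec {p : ℕ → F[X] → Prop} {B k : ℕ} (hB : 1 ≤ B) (hq : 0 < q)
    (helt : Set.InjOn elt (Set.Iio q)) (helt' : ∀ a, ∃ i < q, elt i = a)
    (hp : ∀ j < k, ∀ g a, p j (g + monomial j a) → p (j + 1) g)
    (hle : ∀ j ≤ k, ∀ l : List F[X], l.Nodup →
      (∀ f ∈ l, f.natDegree ≤ k ∧ (∀ i < j, f.coeff i = 0) ∧ p j f) → l.length ≤ B)
    {i : ℕ} (hi : i ≤ k + 1) :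
    (search q elt p B k i).Nodup ∧ (search q elt p B k i).length ≤ B ∧
      ∀ f, f ∈ search q elt p B k i ↔ f.natDegree ≤ k ∧ (∀ l < k + 1 - i, f.coeff l = 0) ∧
        (0 < i → p (k + 1 - i) f) := by
  induction i with
  | zero =>
    refine ⟨List.nodup_singleton _, hB, fun f => ?_⟩
    rw [search, List.mem_singleton]
    constructor
    · rintro rfl
      simp
    · rintro ⟨h1, h2, -⟩
      ext l
      rcases lt_or_ge l (k + 1) with h | h
      · simpa using h2 l (by omega)
      · rw [coeff_eq_zero_of_natDegree_lt (by omega), coeff_zero]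
  | succ i ih =>
    obtain ⟨h1, h2, h3⟩ := ih (by omega)
    rw [search]
    obtain ⟨j, hj, hjk⟩ : ∃ j, j = k - i ∧ j ≤ k := ⟨_, rfl, by omega⟩
    rw [← hj, show k + 1 - (i + 1) = j by omega]
    rw [show k + 1 - i = j + 1 by omega] at h3
    have hnodup := nodup_extendBy (p := p j) h1
      (fun g hg => ((h3 g).1 hg).2.1 j (by omega)) helt hq (B * q)
    have hmem : ∀ f, f ∈ extendBy (p j) q elt j (search q elt p B k i) (B * q) ↔
        f.natDegree ≤ k ∧ (∀ l < j, f.coeff l = 0) ∧ (0 < i + 1 → p j f) := by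
      intro f
      rw [mem_extendBy_mul h2 helt']
      constructor
      · rintro ⟨hpf, g, hg, a, rfl⟩
        obtain ⟨g1, g2, -⟩ := (h3 g).1 hg
        refine ⟨natDegree_add_le_of_degree_le g1 ((natDegree_monomial_le a).trans hjk),
          fun l hl => ?_, fun _ => hpf⟩
        rw [coeff_add, coeff_monomial, if_neg (by omega), g2 l (by omega), add_zero]
      · rintro ⟨f1, f2, f3⟩
        refine ⟨f3 (by omega), f - monomial j (f.coeff j), (h3 _).2 ⟨?_, fun l hl => ?_, fun hi0 => ?_⟩,
          f.coeff j, (sub_add_cancel _ _).symm⟩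
        · exact (natDegree_sub_le_of_le f1 ((natDegree_monomial_le _).trans hjk)).trans (by simp)
        · rw [coeff_sub, coeff_monomial]
          split_ifs with h
          · rw [h, sub_self]
          · rw [f2 l (by omega), sub_zero]
        · refine hp j (by omega) _ (f.coeff j) ?_
          rw [sub_add_cancel]
          exact f3 (by omega)
    refine ⟨hnodup, hle j hjk _ hnodup fun f hf => ?_, hmem⟩
    obtain ⟨f1, f2, f3⟩ := (hmem f).1 hf
    exact ⟨f1, f2, f3 (by omega)⟩

end Search

end FRS

namespace FRS

/-! ### Zeros of a polynomial over the extension field and non-units of a quotient ring -/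

section Zeros

open Polynomial

variable {K : Type*} [Field K]

/-- The class of the variable minus a scalar is a unit unless the scalar is a zero. -/
theorem isUnit_root_sub_of {g : K[X]} {a : K} :
    IsUnit (AdjoinRoot.root g - AdjoinRoot.of g a) ↔ g.eval a ≠ 0 := by
  constructor
  · intro h h0
    have := h.map (AdjoinRoot.lift (RingHom.id K) a (by rw [eval₂_id]; exact h0))
    rw [map_sub, AdjoinRoot.lift_root, AdjoinRoot.lift_of, RingHom.id_apply, sub_self] at this
    exact not_isUnit_zero this
  · intro h0
    obtain ⟨h, hh⟩ := X_sub_C_dvd_sub_C_eval (a := a) (p := g)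
    have h1 := congrArg (AdjoinRoot.mk g) hh
    rw [map_sub, AdjoinRoot.mk_self, zero_sub, map_mul, map_sub, AdjoinRoot.mk_X,
      AdjoinRoot.mk_C, AdjoinRoot.mk_C] at h1
    refine isUnit_of_dvd_unit ⟨_, h1⟩ ?_
    exact ((isUnit_iff_ne_zero.2 h0).map (AdjoinRoot.of g)).neg

theorem eval_integralNormalization_eq_zero_iff {T : K[X]} (hT : T ≠ 0) (x : K) :
    T.integralNormalization.eval (T.leadingCoeff * x) = 0 ↔ T.eval x = 0 := by
  have hc := leadingCoeff_ne_zero.2 hT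
  rcases Nat.eq_zero_or_pos T.natDegree with h | h
  · obtain ⟨a, rfl⟩ : ∃ a, C a = T := natDegree_eq_zero.1 h
    have ha : a ≠ 0 := fun h => hT (by rw [h, C_0])
    simp [integralNormalization_C ha, ha]
  · have := integralNormalization_eval₂_leadingCoeff_mul h (RingHom.id K) x
    rw [eval₂_id, eval₂_id, RingHom.id_apply] at this
    rw [this, mul_eq_zero, or_iff_right (pow_ne_zero _ hc)]

variable {F : Type*} [Field F] [Fintype F] [Algebra F K]

/-- In the quotient of `K[X]` by the monic polynomial whose zeros are those of `T` times the leading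
coefficient of `T`: the elements from which the search for the zeros of `T` in the span of
`1, ξ, …, ξ ^ k` starts. -/
noncomputable def searchElts (T : K[X]) (ξ : K) (k i : ℕ) : AdjoinRoot T.integralNormalization :=
  if i = k + 1 then AdjoinRoot.root _ else AdjoinRoot.of _ (T.leadingCoeff * ξ ^ i)

theorem not_isUnit_towerNorm_iff {T : K[X]} (hT : T ≠ 0) (ξ : K) {k : ℕ} {f : F[X]}
    (hf : f.natDegree ≤ k) :
    ¬ IsUnit (towerNorm k (searchElts T ξ k) 0 f) ↔ T.eval (aeval ξ f) = 0 := by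
  have h : towerNorm k (searchElts T ξ k) 0 f =
      AdjoinRoot.root _ - AdjoinRoot.of _ (T.leadingCoeff * aeval ξ f) := by
    rw [towerNorm, tower, searchElts, if_pos rfl]
    congr 1
    rw [aeval_eq_sum_range' (Nat.lt_succ_of_le hf), Finset.mul_sum, map_sum]
    refine Finset.sum_congr rfl fun i hi => ?_
    rw [searchElts, if_neg (by have := Finset.mem_range.1 hi; omega), Algebra.smul_def,
      Algebra.smul_def, mul_left_comm, map_mul _ (algebraMap F K _)]
    rfl
  rw [h, isUnit_root_sub_of, not_not, eval_integralNormalization_eq_zero_iff hT]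

/-- There are no more candidates for the coefficients with index at least `j` than zeros of `T`. -/
theorem length_le_natDegree {T : K[X]} (hT : T ≠ 0) (pb : PowerBasis F K) {k j : ℕ}
    (hk : k < pb.dim) (hj : j ≤ k + 1) {l : List F[X]} (hl : l.Nodup)
    (h : ∀ f ∈ l, f.natDegree ≤ k ∧ (∀ i < j, f.coeff i = 0) ∧
      ¬ IsUnit (towerNorm k (searchElts T pb.gen k) j f)) : l.length ≤ T.natDegree := by
  classical
  have h1 : ∀ f ∈ l, ∃ g : F[X], g.natDegree ≤ k ∧ (∀ i ≥ j, g.coeff i = f.coeff i) ∧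
      T.eval (aeval pb.gen g) = 0 := fun f hf => by
    obtain ⟨hf1, -, hf3⟩ := h f hf
    obtain ⟨g, hg, hc, hu⟩ := exists_not_isUnit_towerNorm_zero hj _ hf1 hf3
    exact ⟨g, hg, hc, (not_isUnit_towerNorm_iff hT _ hg).1 hu⟩
  choose! φ hφ1 hφ2 hφ3 using h1
  rw [← List.toFinset_card_of_nodup hl]
  refine le_trans ?_ ((Multiset.toFinset_card_le _).trans (card_roots' T))
  refine Finset.card_le_card_of_injOn (fun f => aeval pb.gen (φ f)) (fun f hf => ?_) ?_
  · have hf : f ∈ l := List.mem_toFinset.1 hf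
    exact Multiset.mem_toFinset.2 ((mem_roots hT).2 (hφ3 f hf))
  · intro f hf f' hf' heq
    have hf : f ∈ l := List.mem_toFinset.1 hf
    have hf' : f' ∈ l := List.mem_toFinset.1 hf'
    have h2 : φ f = φ f' := by
      by_contra hne
      have := pb.dim_le_natDegree_of_root (p := φ f - φ f') (sub_ne_zero.2 hne)
        (by rw [map_sub, sub_eq_zero]; exact heq)
      have h3 := natDegree_sub_le_of_le (hφ1 f hf) (hφ1 f' hf')
      simp only [max_self] at h3
      omega
    ext i
    rcases lt_or_ge i j with hi | hi
    · rw [(h f hf).2.1 i hi, (h f' hf').2.1 i hi]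
    · rw [← hφ2 f hf i hi, ← hφ2 f' hf' i hi, h2]

end Zeros

/-! ### Matrices of multiplications -/

section Represents

open Finset

variable {F : Type*} [Field F] {R : Type*} [CommRing R] [Algebra F R]

/-- The `w × w` matrix `A` describes the multiplication by `ρ` with respect to the family
`β 0, …, β (w - 1)`. -/
def Represents (w : ℕ) (β : ℕ → R) (A : ℕ → ℕ → F) (ρ : R) : Prop :=
  ∀ j < w, ρ * β j = ∑ i ∈ range w, A i j • β i

/-- The product of `w × w` matrices. -/
def matMul (w : ℕ) (A B : ℕ → ℕ → F) (i j : ℕ) : F := ∑ l ∈ range w, A i l * B l j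

/-- The product of the `w × w` matrices `A 0, …, A (d - 1)`. -/
def matProd (w : ℕ) (A : ℕ → ℕ → ℕ → F) : ℕ → ℕ → ℕ → F
  | 0 => fun i j => if i = j then 1 else 0
  | d + 1 => matMul w (matProd w A d) (A d)

/-- The `w × w` matrix `A` annihilates a nonzero vector. -/
def IsSingular (w : ℕ) (A : ℕ → ℕ → F) : Prop :=
  ∃ v : ℕ → F, (∃ j < w, v j ≠ 0) ∧ ∀ i < w, ∑ j ∈ range w, A i j * v j = 0

variable {w : ℕ} {β : ℕ → R} {A B : ℕ → ℕ → F} {ρ σ : R}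

theorem Represents.sub (hA : Represents w β A ρ) (hB : Represents w β B σ) :
    Represents w β (fun i j => A i j - B i j) (ρ - σ) := fun j hj => by
  simp only [sub_mul, hA j hj, hB j hj, sub_smul, sum_sub_distrib]

theorem Represents.smul (hA : Represents w β A ρ) (a : F) :
    Represents w β (fun i j => a * A i j) (a • ρ) := fun j hj => by
  simp only [smul_mul_assoc, hA j hj, smul_sum, mul_smul]

theorem Represents.sum {d : ℕ} {A : ℕ → ℕ → ℕ → F} {ρ : ℕ → R}
    (h : ∀ l < d, Represents w β (A l) (ρ l)) :
    Represents w β (fun i j => ∑ l ∈ range d, A l i j) (∑ l ∈ range d, ρ l) := fun j hj => by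
  simp only [sum_mul, sum_smul]
  rw [sum_comm, sum_congr rfl fun l hl => h l (mem_range.1 hl) j hj]

theorem Represents.apply (hA : Represents w β A ρ) (v : ℕ → F) :
    ρ * ∑ j ∈ range w, v j • β j = ∑ i ∈ range w, (∑ j ∈ range w, A i j * v j) • β i := by
  simp only [mul_sum, sum_smul]
  rw [sum_comm]
  refine sum_congr rfl fun j hj => ?_
  rw [mul_smul_comm, hA j (mem_range.1 hj), smul_sum]
  exact sum_congr rfl fun i _ => by rw [smul_smul, mul_comm]

theorem Represents.mul (hA : Represents w β A ρ) (hB : Represents w β B σ) :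
    Represents w β (matMul w A B) (ρ * σ) := fun j hj => by
  rw [mul_assoc, hB j hj, hA.apply]
  rfl

theorem Represents.prod {d : ℕ} {A : ℕ → ℕ → ℕ → F} {ρ : ℕ → R}
    (h : ∀ l < d, Represents w β (A l) (ρ l)) :
    Represents w β (matProd w A d) (∏ l ∈ range d, ρ l) := by
  induction d with
  | zero =>
    intro j hj
    simp [matProd, ite_smul, hj]
  | succ d ih =>
    rw [prod_range_succ]
    exact (ih fun l hl => h l (by omega)).mul (h d (by omega))

theorem Represents.not_isUnit_iff (hA : Represents w β A ρ) (b : Module.Basis (Fin w) F R)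
    (hb : ∀ i, b i = β i) : ¬ IsUnit ρ ↔ IsSingular w A := by
  have hsum : ∀ v : ℕ → F, ∑ j ∈ range w, v j • β j = ∑ j : Fin w, v j • b j := fun v => by
    rw [sum_range]
    simp only [hb]
  have h0 : ∀ v : ℕ → F, ∑ j ∈ range w, v j • β j = 0 ↔ ∀ j < w, v j = 0 := fun v => by
    rw [hsum]
    constructor
    · intro h j hj
      exact Fintype.linearIndependent_iff.1 b.linearIndependent (fun j => v j) h ⟨j, hj⟩
    · intro h
      exact sum_eq_zero fun j _ => by rw [h j j.2, zero_smul]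
  constructor
  · intro hρ
    have : Module.Finite F R := Module.Finite.of_basis b
    have : IsArtinianRing R := IsArtinianRing.of_finite F R
    rw [IsArtinianRing.isUnit_iff_mem_nonZeroDivisors, mem_nonZeroDivisors_iff_right] at hρ
    push Not at hρ
    obtain ⟨x, hx, hx0⟩ := hρ
    let v : ℕ → F := fun j => if h : j < w then b.repr x ⟨j, h⟩ else 0
    have hv : ∑ j ∈ range w, v j • β j = x := by
      rw [hsum]
      simp [v]
    refine ⟨v, ?_, (h0 _).1 ?_⟩
    · by_contra! h
      exact hx0 (by rw [← hv, (h0 v).2 h])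
    · rw [← hA.apply, hv, mul_comm, hx]
  · rintro ⟨v, ⟨j, hj, hvj⟩, hv⟩ hρ
    have h1 := hA.apply v
    rw [(h0 _).2 hv, hρ.mul_right_eq_zero] at h1
    exact hvj ((h0 v).1 h1 j hj)

/-- The matrices of the elements of a `tower`, where the field elements are `elt 0, …,
`elt (q - 1)`. -/
def towerMat (w q : ℕ) (elt : ℕ → F) (Y : ℕ → ℕ → ℕ → F) : ℕ → ℕ → ℕ → ℕ → F
  | 0 => Y
  | l + 1 => fun i =>
    matProd w (fun a x y => towerMat w q elt Y l i x y - elt a * towerMat w q elt Y l l x y) q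

/-- The matrix of a `towerNorm`. -/
def normMat (w q : ℕ) (elt : ℕ → F) (Y : ℕ → ℕ → ℕ → F) (k l : ℕ) (f : Polynomial F)
    (x y : ℕ) : F :=
  towerMat w q elt Y l (k + 1) x y -
    ∑ i ∈ range (k + 1), f.coeff i * towerMat w q elt Y l i x y

variable [Fintype F] {q : ℕ} {elt : ℕ → F}

theorem represents_towerMat (helt : ∀ f : F → R, ∏ i ∈ range q, f (elt i) = ∏ a, f a)
    {Y : ℕ → ℕ → ℕ → F} {y : ℕ → R} {k : ℕ} (h : ∀ i ≤ k + 1, Represents w β (Y i) (y i))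
    {l i : ℕ} (hl : l ≤ k + 1) (hi : i ≤ k + 1) :
    Represents w β (towerMat w q elt Y l i) (tower F y l i) := by
  induction l generalizing i with
  | zero => exact h i hi
  | succ l ih =>
    rw [tower]
    dsimp only
    rw [← helt fun a => tower F y l i - a • tower F y l l]
    exact Represents.prod fun a _ => (ih (by omega) hi).sub ((ih (by omega) (by omega)).smul _)

theorem represents_normMat (helt : ∀ f : F → R, ∏ i ∈ range q, f (elt i) = ∏ a, f a)
    {Y : ℕ → ℕ → ℕ → F} {y : ℕ → R} {k : ℕ} (h : ∀ i ≤ k + 1, Represents w β (Y i) (y i))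
    {l : ℕ} (hl : l ≤ k + 1) (f : Polynomial F) :
    Represents w β (normMat w q elt Y k l f) (towerNorm k y l f) :=
  (represents_towerMat helt h hl le_rfl).sub (Represents.sum fun _ hi =>
    (represents_towerMat helt h hl (by omega)).smul _)

end Represents

end FRS

namespace FRS

/-! ### Coordinates in the extension field and in the quotient ring -/

section Coordinates

open Finset Polynomial

variable {F : Type*} [Field F] {K : Type*} [Field K] [Algebra F K]

/-- The element of the extension field with coordinates `u` with respect to the powers of `ξ`. -/
def vecElt (p : ℕ) (ξ : K) (u : ℕ → F) : K := ∑ a ∈ range p, u a • ξ ^ a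

/-- The matrix of the multiplication by `ξ ^ e` times the element with coordinates `u`, where
`ξ ^ p = c`. -/
def kumMat (p : ℕ) (c : F) (e : ℕ) (u : ℕ → F) (b b' : ℕ) : F :=
  ∑ a ∈ range p, if (a + e + b') % p = b then u a * c ^ ((a + e + b') / p) else 0

/-- The coordinates of the product of the elements with coordinates `u` and `v`. -/
def kumMul (p : ℕ) (c : F) (u v : ℕ → F) (b : ℕ) : F :=
  ∑ b' ∈ range p, kumMat p c 0 u b b' * v b'

variable {p : ℕ} {c : F} {ξ : K}

theorem pow_eq_of_pow_eq (hξ : ξ ^ p = algebraMap F K c) (e : ℕ) :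
    ξ ^ e = c ^ (e / p) • ξ ^ (e % p) := by
  conv_lhs => rw [← Nat.div_add_mod e p, pow_add, pow_mul, hξ, ← map_pow]
  rw [Algebra.smul_def]

theorem sum_pow_eq (hp : 0 < p) (hξ : ξ ^ p = algebraMap F K c) {ι : Type*} (t : Finset ι)
    (u : ι → F) (e : ι → ℕ) : ∑ a ∈ t, u a • ξ ^ e a =
      ∑ b ∈ range p, (∑ a ∈ t, if e a % p = b then u a * c ^ (e a / p) else 0) • ξ ^ b := by
  simp only [sum_smul]
  rw [sum_comm]
  refine sum_congr rfl fun a _ => ?_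
  simp only [ite_smul, zero_smul, sum_ite_eq, mem_range, Nat.mod_lt _ hp, if_true]
  rw [pow_eq_of_pow_eq hξ (e a), smul_smul]

theorem vecElt_mul_pow (hp : 0 < p) (hξ : ξ ^ p = algebraMap F K c) (u : ℕ → F) (e b' : ℕ) :
    vecElt p ξ u * ξ ^ e * ξ ^ b' = ∑ b ∈ range p, kumMat p c e u b b' • ξ ^ b := by
  rw [vecElt, sum_mul, sum_mul]
  simp only [smul_mul_assoc, ← pow_add]
  rw [sum_pow_eq hp hξ]
  rfl

theorem vecElt_kumMul (hp : 0 < p) (hξ : ξ ^ p = algebraMap F K c) (u v : ℕ → F) :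
    vecElt p ξ (kumMul p c u v) = vecElt p ξ u * vecElt p ξ v := by
  conv_rhs => rw [vecElt.eq_def p ξ v, mul_sum]
  have h := fun b' => vecElt_mul_pow hp hξ u 0 b'
  simp only [pow_zero, mul_one] at h
  simp only [mul_smul_comm, h, smul_sum, smul_smul]
  rw [vecElt]
  simp only [kumMul, sum_smul]
  rw [sum_comm]
  exact sum_congr rfl fun b' _ => sum_congr rfl fun b _ => by rw [mul_comm]

theorem vecElt_iterate_kumMul (hp : 0 < p) (hξ : ξ ^ p = algebraMap F K c) (u v : ℕ → F) (i : ℕ) :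
    vecElt p ξ ((kumMul p c u)^[i] v) = vecElt p ξ v * vecElt p ξ u ^ i := by
  induction i with
  | zero => simp
  | succ i ih =>
    rw [Function.iterate_succ_apply', vecElt_kumMul hp hξ, ih]
    ring

/-- A sum over pairs of digits. -/
theorem sum_range_mul {M : Type*} [AddCommMonoid M] (p d : ℕ) (f : ℕ → M) :
    ∑ x ∈ range (p * d), f x = ∑ j ∈ range d, ∑ b ∈ range p, f (b + p * j) := by
  induction d with
  | zero => simp
  | succ d ih =>
    rw [Nat.mul_succ, sum_range_add, ih, sum_range_succ]
    simp only [add_comm]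

/-- The family `ξ ^ b Y ^ j` with `b < p`, numbered by `b + p j`. -/
noncomputable def monomialFamily (p : ℕ) (g : K[X]) (ξ : K) (x : ℕ) : AdjoinRoot g :=
  AdjoinRoot.of g (ξ ^ (x % p)) * AdjoinRoot.root g ^ (x / p)

theorem monomialFamily_add {b : ℕ} (hb : b < p) (g : K[X]) (j : ℕ) :
    monomialFamily p g ξ (b + p * j) = AdjoinRoot.of g (ξ ^ b) * AdjoinRoot.root g ^ j := by
  have hp : 0 < p := by omega
  rw [monomialFamily, Nat.add_mul_mod_self_left, Nat.mod_eq_of_lt hb, Nat.add_mul_div_left _ _ hp,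
    Nat.div_eq_of_lt hb, zero_add]

/-- The family `ξ ^ b Y ^ j` is a basis. -/
theorem exists_basis (pb : PowerBasis F K) {g : K[X]} (hg : g.Monic) :
    ∃ b : Module.Basis (Fin (pb.dim * g.natDegree)) F (AdjoinRoot g),
      ∀ i, b i = monomialFamily pb.dim g pb.gen i := by
  let e : Fin g.natDegree × Fin pb.dim ≃ Fin (pb.dim * g.natDegree) :=
    finProdFinEquiv.trans (finCongr (mul_comm _ _))
  have he : ∀ x : Fin g.natDegree × Fin pb.dim, (e x : ℕ) = x.2 + pb.dim * x.1 := fun x => rfl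
  refine ⟨(pb.basis.smulTower' (AdjoinRoot.powerBasisAux' hg)).reindex e, fun i => ?_⟩
  obtain ⟨⟨j, b⟩, rfl⟩ := e.surjective i
  rw [Module.Basis.reindex_apply, Equiv.symm_apply_apply, Module.Basis.smulTower'_apply, he,
    monomialFamily_add b.2, PowerBasis.basis_eq_pow, Algebra.smul_def]
  congr 1
  have := (AdjoinRoot.powerBasis' hg).basis_eq_pow j
  exact this

/-- The matrix of the multiplication by an element of the extension field. -/
def blockMat (p : ℕ) (M : ℕ → ℕ → F) (x y : ℕ) : F :=
  if x / p = y / p then M (x % p) (y % p) else 0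

theorem represents_blockMat {g : K[X]} {d : ℕ} {M : ℕ → ℕ → F} {κ : K}
    (h : ∀ b' < p, κ * ξ ^ b' = ∑ b ∈ range p, M b b' • ξ ^ b) :
    Represents (p * d) (monomialFamily p g ξ) (blockMat p M) (AdjoinRoot.of g κ) := by
  intro y hy
  have hp : 0 < p := Nat.pos_of_ne_zero (by rintro rfl; simp at hy)
  have hyd : y / p < d := Nat.div_lt_of_lt_mul hy
  rw [sum_range_mul, sum_eq_single (y / p)]
  · have h1 : ∀ b ∈ range p, blockMat p M (b + p * (y / p)) y •
        monomialFamily p g ξ (b + p * (y / p)) =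
          AdjoinRoot.of g (M b (y % p) • ξ ^ b) * AdjoinRoot.root g ^ (y / p) := fun b hb => by
      have hb := mem_range.1 hb
      rw [monomialFamily_add hb, blockMat, Nat.add_mul_mod_self_left, Nat.mod_eq_of_lt hb,
        Nat.add_mul_div_left _ _ hp, Nat.div_eq_of_lt hb, zero_add, if_pos rfl, Algebra.smul_def,
        Algebra.smul_def, map_mul, mul_assoc]
      rfl
    rw [sum_congr rfl h1, ← sum_mul, ← map_sum, ← h _ (Nat.mod_lt _ hp), monomialFamily, map_mul,
      mul_assoc]
  · intro j _ hj
    refine sum_eq_zero fun b hb => ?_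
    have hb := mem_range.1 hb
    rw [blockMat, Nat.add_mul_div_left _ _ hp, Nat.div_eq_of_lt hb, zero_add, if_neg hj, zero_smul]
  · intro h
    exact absurd (mem_range.2 hyd) h

/-- The matrix of the multiplication by the root of a monic polynomial of degree `d` whose lower
coefficients have the coordinates `u 0, …, u (d - 1)`. -/
def companionMat (p d : ℕ) (c : F) (u : ℕ → ℕ → F) (x y : ℕ) : F :=
  if y / p + 1 < d then (if x % p = y % p ∧ x / p = y / p + 1 then 1 else 0)
  else -kumMat p c 0 (u (x / p)) (x % p) (y % p)

theorem represents_companionMat (hξ : ξ ^ p = algebraMap F K c) {g : K[X]} (hg : g.Monic)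
    {u : ℕ → ℕ → F} (hu : ∀ j < g.natDegree, g.coeff j = vecElt p ξ (u j)) :
    Represents (p * g.natDegree) (monomialFamily p g ξ) (companionMat p g.natDegree c u)
      (AdjoinRoot.root g) := by
  intro y hy
  have hp : 0 < p := Nat.pos_of_ne_zero (by rintro rfl; simp at hy)
  have hyd : y / p < g.natDegree := Nat.div_lt_of_lt_mul hy
  have hyp : y % p < p := Nat.mod_lt _ hp
  have hxy : ∀ b ∈ range p, ∀ j, (b + p * j) % p = b ∧ (b + p * j) / p = j := fun b hb j => by
    have hb := mem_range.1 hb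
    rw [Nat.add_mul_mod_self_left, Nat.mod_eq_of_lt hb, Nat.add_mul_div_left _ _ hp,
      Nat.div_eq_of_lt hb, zero_add]
    exact ⟨rfl, rfl⟩
  rw [sum_range_mul]
  by_cases h : y / p + 1 < g.natDegree
  · rw [sum_eq_single (y / p + 1), sum_eq_single (y % p)]
    · rw [companionMat, if_pos h, (hxy _ (mem_range.2 hyp) _).1, (hxy _ (mem_range.2 hyp) _).2,
        if_pos ⟨rfl, rfl⟩, one_smul, monomialFamily_add hyp, monomialFamily, pow_succ]
      ring
    · intro b hb hne
      rw [companionMat, if_pos h, (hxy b hb _).1, if_neg fun h' => hne h'.1, zero_smul]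
    · intro h'
      exact absurd (mem_range.2 hyp) h'
    · intro j _ hj
      refine sum_eq_zero fun b hb => ?_
      rw [companionMat, if_pos h, (hxy b hb _).2, if_neg fun h' => hj h'.2, zero_smul]
    · intro h'
      exact absurd (mem_range.2 h) h'
  · have hd : y / p + 1 = g.natDegree := by omega
    have hroot : AdjoinRoot.root g ^ g.natDegree =
        -∑ j ∈ range g.natDegree, AdjoinRoot.of g (g.coeff j) * AdjoinRoot.root g ^ j := by
      have h1 := congrArg (AdjoinRoot.mk g) hg.as_sum
      rw [AdjoinRoot.mk_self, map_add, map_pow, AdjoinRoot.mk_X, map_sum] at h1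
      simp only [map_mul, map_pow, AdjoinRoot.mk_X, AdjoinRoot.mk_C] at h1
      exact eq_neg_of_add_eq_zero_left h1.symm
    rw [monomialFamily, mul_left_comm, ← pow_succ', hd, hroot, mul_neg, mul_sum, ← sum_neg_distrib]
    refine sum_congr rfl fun j hj => ?_
    have h1 : ∀ b ∈ range p, companionMat p g.natDegree c u (b + p * j) y •
        monomialFamily p g ξ (b + p * j) =
          -(AdjoinRoot.of g (kumMat p c 0 (u j) b (y % p) • ξ ^ b) * AdjoinRoot.root g ^ j) :=
      fun b hb => by
        rw [monomialFamily_add (mem_range.1 hb), companionMat, if_neg h, (hxy b hb _).1,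
          (hxy b hb _).2, Algebra.smul_def, Algebra.smul_def, map_mul, map_neg, mul_assoc, neg_mul]
        rfl
    rw [sum_congr rfl h1, sum_neg_distrib, ← sum_mul, ← map_sum, ← vecElt_mul_pow hp hξ, pow_zero,
      mul_one, hu j (mem_range.1 hj), ← mul_assoc, map_mul, mul_comm (AdjoinRoot.of g (ξ ^ _))]

end Coordinates

end FRS

namespace FRS

/-! ### The interpolation step as a system of linear equations -/

universe u

namespace Setting

open Finset

variable (S : Setting.{u})

/-- The bound on the degree of the interpolating polynomial. -/
noncomputable abbrev D : ℕ := interpDegree S.F S.m S.k S.s S.r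

/-- The number `q ^ s` of exponents of `Y_1, …, Y_s` that are less than `q`. -/
abbrev B : ℕ := S.q ^ S.s

/-- The number of monomials that are taken into account. -/
noncomputable abbrev len : ℕ := (S.D + 1) * S.B

/-- The exponents of the monomial number `u`: the quotient by `q ^ s` is the exponent of `X`, and the
digits of the remainder in base `q` are the exponents of `Y_1, …, Y_s`. -/
def expo (u i : ℕ) : ℕ := if i = 0 then u / S.B else u % S.B / S.q ^ (i - 1) % S.q

/-- The exponents of the monomial number `u` as a multi-index. -/
noncomputable def exps (u : ℕ) : Fin (S.s + 1) →₀ ℕ :=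
  Finsupp.equivFunOnFinite.symm fun i => S.expo u i

/-- The polynomial with coefficients `x`. -/
noncomputable def poly (x : ℕ → S.F) : MvPolynomial (Fin (S.s + 1)) S.F :=
  ∑ u ∈ range S.len, MvPolynomial.monomial (S.exps u) (x u)

/-- The monomials of weighted degree at most `D`. -/
def IsGood (u : ℕ) : Prop :=
  S.expo u 0 + S.k * ∑ i ∈ range S.s, S.expo u (i + 1) ≤ S.D

/-- The coordinates of the interpolation points; indices are reduced modulo `n` in order that they
always make sense. -/
noncomputable def point (i j : ℕ) : S.F :=
  if j = 0 then (S.γ : S.F) ^ i else unfold S.z ((i + (j - 1)) % S.n)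

/-- The linear conditions on the coefficients of the polynomial. The condition number
`i r ^ (s + 1) + δ` concerns the coefficient at the interpolation point number `i` whose exponents
are the digits of `δ` in base `r`. It is void if `i` is not an interpolation index or if the degree is
at least `r`. -/
noncomputable def form (v u : ℕ) : S.F :=
  if v / S.r ^ (S.s + 1) % S.m ≤ S.m - S.s ∧
      ∑ j ∈ range (S.s + 1), v % S.r ^ (S.s + 1) / S.r ^ j % S.r < S.r then
    ∏ j ∈ range (S.s + 1), ((Polynomial.X + Polynomial.C (S.point (v / S.r ^ (S.s + 1)) j)) ^
      S.expo u j).coeff (v % S.r ^ (S.s + 1) / S.r ^ j % S.r)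
  else 0

/-- Vectors that span the solutions of the linear conditions. -/
noncomputable def sols : ℕ → ℕ → S.F :=
  eliminate S.len S.len S.form (coordVectors S.IsGood) (S.n * S.r ^ (S.s + 1))

variable {S}

theorem mem_spanRows_sols {x : ℕ → S.F} : x ∈ spanRows S.len S.sols ↔
    (∀ u, x u ≠ 0 → u < S.len ∧ S.IsGood u) ∧
      ∀ v < S.n * S.r ^ (S.s + 1), ∑ u ∈ range S.len, S.form v u * x u = 0 := by
  rw [sols, mem_spanRows_eliminate, mem_spanRows_coordVectors]

theorem q_pos : 0 < S.q := Fintype.card_pos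

theorem exps_zero (u : ℕ) : S.exps u 0 = u / S.B := by simp [exps, expo]

theorem exps_succ (u : ℕ) (i : Fin S.s) : S.exps u i.succ = u % S.B / S.q ^ i.val % S.q := by
  simp [exps, expo]

theorem sum_exps_succ (u : ℕ) : ∑ i : Fin S.s, S.exps u i.succ * S.q ^ i.val = u % S.B := by
  simp only [exps_succ]
  exact sum_div_mod_digits (Nat.mod_lt _ (pow_pos q_pos _))

theorem exps_injective : Function.Injective S.exps := fun u v h => by
  have h1 : u / S.B = v / S.B := by rw [← exps_zero, h, exps_zero]
  have h2 : u % S.B = v % S.B := by rw [← sum_exps_succ, h, sum_exps_succ]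
  rw [← Nat.div_add_mod u S.B, h1, h2, Nat.div_add_mod]

/-- All exponents that occur in an interpolating polynomial are taken into account. -/
theorem exists_exps_eq {e : Fin (S.s + 1) →₀ ℕ} (he : e 0 + S.k * ∑ i : Fin S.s, e i.succ ≤ S.D) :
    ∃ u < S.len, S.exps u = e := by
  have hq := exponent_lt S.interpDegree_lt he
  have hlt : ∑ i : Fin S.s, e i.succ * S.q ^ i.val < S.B := sum_digits_lt hq
  have hB : 0 < S.B := pow_pos q_pos _
  refine ⟨∑ i : Fin S.s, e i.succ * S.q ^ i.val + S.B * e 0, ?_, ?_⟩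
  · calc _ < S.B * (e 0 + 1) := by rw [Nat.mul_succ]; omega
      _ ≤ S.len := by rw [mul_comm]; exact Nat.mul_le_mul_right _ (by omega)
  · ext i
    refine Fin.cases ?_ (fun i => ?_) i
    · rw [exps_zero, Nat.add_mul_div_left _ _ hB, Nat.div_eq_of_lt hlt, zero_add]
    · rw [exps_succ, Nat.add_mul_mod_self_left, Nat.mod_eq_of_lt hlt, sum_digits_div_mod hq]

theorem coeff_poly (x : ℕ → S.F) {u : ℕ} (hu : u < S.len) :
    (S.poly x).coeff (S.exps u) = x u := by
  classical
  rw [poly, MvPolynomial.coeff_sum]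
  simp only [MvPolynomial.coeff_monomial, exps_injective.eq_iff, sum_ite_eq', mem_range, hu, if_true]

theorem exists_of_mem_support_poly {x : ℕ → S.F} {e : Fin (S.s + 1) →₀ ℕ}
    (he : e ∈ (S.poly x).support) : ∃ u < S.len, x u ≠ 0 ∧ S.exps u = e := by
  classical
  obtain ⟨u, hu, h⟩ := Finset.mem_biUnion.1 (MvPolynomial.support_sum he)
  have h0 : x u ≠ 0 := fun h0 => by simp [h0] at h
  rw [MvPolynomial.support_monomial, if_neg h0, mem_singleton] at h
  exact ⟨u, mem_range.1 hu, h0, h.symm⟩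

theorem isGood_iff (u : ℕ) :
    S.IsGood u ↔ S.exps u 0 + S.k * ∑ i : Fin S.s, S.exps u i.succ ≤ S.D := by
  rw [IsGood, sum_range]
  rfl

theorem point_eq {i : ℕ} (hi : i ∈ interpIndices S.F S.m S.s) :
    (Fin.cons ((S.γ : S.F) ^ i) fun j : Fin S.s => unfold S.z (i + j.val)) =
      fun j : Fin (S.s + 1) => S.point i j := by
  obtain ⟨h1, h2⟩ := mem_filter.1 hi
  have h1 : i < S.N * S.m := mem_range.1 h1
  ext j
  refine Fin.cases ?_ (fun j => ?_) j
  · simp [point]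
  · have h3 : i + j < S.n := by
      have h4 := Nat.div_add_mod i S.m
      have h5 : i / S.m + 1 ≤ S.N := Nat.div_lt_of_lt_mul (by rwa [mul_comm])
      have h6 := Nat.mul_le_mul_left S.m h5
      have h7 : S.n = S.m * S.N := mul_comm _ _
      have h8 := S.s_le
      have := j.2
      rw [Nat.mul_succ] at h6
      omega
    simp [point, Nat.mod_eq_of_lt h3]

theorem coeff_shift_poly (x : ℕ → S.F) (a : ℕ → S.F) (d : Fin (S.s + 1) →₀ ℕ) :
    (shift (fun j : Fin (S.s + 1) => a j) (S.poly x)).coeff d =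
      ∑ u ∈ range S.len, (∏ j : Fin (S.s + 1),
        ((Polynomial.X + Polynomial.C (a j)) ^ S.expo u j).coeff (d j)) * x u := by
  rw [poly, map_sum, MvPolynomial.coeff_sum]
  refine sum_congr rfl fun u _ => ?_
  rw [coeff_shift_monomial, mul_comm]
  rfl

/-- The linear conditions say that the polynomial vanishes to the required order. -/
theorem forms_eq_zero_iff (x : ℕ → S.F) :
    (∀ v < S.n * S.r ^ (S.s + 1), ∑ u ∈ range S.len, S.form v u * x u = 0) ↔
      ∀ i ∈ interpIndices S.F S.m S.s, HasZeroOfMult (S.poly x)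
        (Fin.cons ((S.γ : S.F) ^ i) fun j : Fin S.s => unfold S.z (i + j.val)) S.r := by
  have hr : 0 < S.r := S.one_le_r
  have hR : 0 < S.r ^ (S.s + 1) := pow_pos hr _
  constructor
  · intro h i hi d hd
    obtain ⟨h1, h2⟩ := mem_filter.1 hi
    have h1 : i < S.n := mem_range.1 h1
    rw [point_eq hi]
    have hdr : ∀ j, d j < S.r := fun j => lt_of_le_of_lt (d.le_degree j) hd
    have hlt : ∑ j, d j * S.r ^ j.val < S.r ^ (S.s + 1) := sum_digits_lt hdr
    have := h (∑ j, d j * S.r ^ j.val + S.r ^ (S.s + 1) * i) (by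
      calc _ < S.r ^ (S.s + 1) * (i + 1) := by rw [Nat.mul_succ]; omega
        _ ≤ _ := by rw [mul_comm]; exact Nat.mul_le_mul_right _ h1)
    rw [← this]
    refine (coeff_shift_poly x (S.point i) d).trans (sum_congr rfl fun u _ => ?_)
    have hi' : (∑ j, d j * S.r ^ j.val + S.r ^ (S.s + 1) * i) / S.r ^ (S.s + 1) = i := by
      rw [Nat.add_mul_div_left _ _ hR, Nat.div_eq_of_lt hlt, zero_add]
    have hd' : (∑ j, d j * S.r ^ j.val + S.r ^ (S.s + 1) * i) % S.r ^ (S.s + 1) =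
        ∑ j, d j * S.r ^ j.val := by
      rw [Nat.add_mul_mod_self_left, Nat.mod_eq_of_lt hlt]
    rw [form, hi', hd', if_pos, prod_range]
    · congr 1
      exact prod_congr rfl fun j _ => by rw [sum_digits_div_mod hdr]
    · refine ⟨h2, ?_⟩
      rw [sum_range, sum_congr rfl fun j _ => sum_digits_div_mod hdr j, ← Finsupp.degree_eq_sum]
      exact hd
  · intro h v hv
    by_cases hc : v / S.r ^ (S.s + 1) % S.m ≤ S.m - S.s ∧
        ∑ j ∈ range (S.s + 1), v % S.r ^ (S.s + 1) / S.r ^ j % S.r < S.r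
    · have hi : v / S.r ^ (S.s + 1) ∈ interpIndices S.F S.m S.s :=
        mem_filter.2 ⟨mem_range.2 (Nat.div_lt_of_lt_mul (by rwa [mul_comm])), hc.1⟩
      let d : Fin (S.s + 1) →₀ ℕ := Finsupp.equivFunOnFinite.symm
        fun j => v % S.r ^ (S.s + 1) / S.r ^ j.val % S.r
      have := h _ hi d (by rw [Finsupp.degree_eq_sum]; rw [sum_range] at hc; exact hc.2)
      rw [point_eq hi] at this
      rw [← this]
      refine (sum_congr rfl fun u _ => ?_).trans (coeff_shift_poly x (S.point _) d).symm
      rw [form, if_pos hc, prod_range]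
      rfl
    · exact sum_eq_zero fun u _ => by rw [form, if_neg hc, zero_mul]

theorem interpolates_poly {x : ℕ → S.F} (hx : x ∈ spanRows S.len S.sols) (h0 : S.poly x ≠ 0) :
    Interpolates S.γ S.k S.s S.r S.D S.z (S.poly x) := by
  obtain ⟨h1, h2⟩ := mem_spanRows_sols.1 hx
  refine ⟨h0, weightedTotalDegree_le_iff.2 fun e he => ?_, (forms_eq_zero_iff x).1 h2⟩
  obtain ⟨u, -, hxu, rfl⟩ := exists_of_mem_support_poly he
  exact (isGood_iff u).1 (h1 u hxu).2

theorem exists_poly_eq {Q : MvPolynomial (Fin (S.s + 1)) S.F}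
    (hQ : Interpolates S.γ S.k S.s S.r S.D S.z Q) :
    ∃ x ∈ spanRows S.len S.sols, S.poly x = Q := by
  have hdeg := weightedTotalDegree_le_iff.1 hQ.2.1
  let x : ℕ → S.F := fun u => if u < S.len then Q.coeff (S.exps u) else 0
  have hx : ∀ u, x u ≠ 0 → u < S.len ∧ Q.coeff (S.exps u) ≠ 0 := fun u hu => by
    by_cases h : u < S.len
    · exact ⟨h, by simpa [x, h] using hu⟩
    · simp [x, h] at hu
  have hpoly : S.poly x = Q := by
    ext e
    by_cases he : ∃ u < S.len, S.exps u = e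
    · obtain ⟨u, hu, rfl⟩ := he
      rw [coeff_poly x hu]
      simp [x, hu]
    · have h1 : e ∉ (S.poly x).support := fun h =>
        he (let ⟨u, hu, _, h⟩ := exists_of_mem_support_poly h; ⟨u, hu, h⟩)
      have h2 : e ∉ Q.support := fun h => he (exists_exps_eq (hdeg e h))
      rw [MvPolynomial.notMem_support_iff.1 h1, MvPolynomial.notMem_support_iff.1 h2]
  refine ⟨x, mem_spanRows_sols.2 ⟨fun u hu => ⟨(hx u hu).1, (isGood_iff u).2 (hdeg _ ?_)⟩, ?_⟩, hpoly⟩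
  · exact MvPolynomial.mem_support_iff.2 (hx u hu).2
  · rw [forms_eq_zero_iff, hpoly]
    exact hQ.2.2

end Setting

end FRS

namespace FRS

/-! ### Description of the decoder by explicit formulas, and its correctness -/

universe u

namespace Setting

open Finset

variable (S : Setting.{u})

/-- The degree of the extension of `F` by `ξ` with `ξ ^ (q - 1) = γ`. -/
abbrev p : ℕ := S.q - 1

/-- The coordinates of the coefficient of `Y ^ l` in the univariate polynomial
`Q(ξ, Y, Y ^ q, …, Y ^ (q ^ (s - 1)))`, where `Q` is the polynomial with coefficients `x`. -/
noncomputable def coords (x : ℕ → S.F) (l b : ℕ) : S.F :=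
  ∑ i ∈ range (S.D + 1),
    if i % S.p = b then x (S.B * i + l) * (S.γ : S.F) ^ (i / S.p) else 0

open Classical in
/-- The position of a solution for which that univariate polynomial does not vanish. -/
noncomputable def pivot : ℕ :=
  lastIdx (fun u => ∃ l < S.B, ∃ b < S.p, S.coords (S.sols u) l b ≠ 0) S.len

/-- The coefficients of the interpolating polynomial. -/
noncomputable def sol : ℕ → S.F := S.sols S.pivot

open Classical in
/-- The degree of the univariate polynomial. -/
noncomputable def deg : ℕ :=
  lastIdx (fun l => ∃ b < S.p, S.coords S.sol l b ≠ 0) S.B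

/-- The coordinates of the coefficients, except the leading one, of the monic polynomial whose zeros
are those of the univariate polynomial times its leading coefficient. -/
noncomputable def lower (j : ℕ) : ℕ → S.F :=
  (kumMul S.p (S.γ : S.F) (S.coords S.sol S.deg))^[S.deg - 1 - j] (S.coords S.sol j)

/-- The matrices of the elements from which the search for the zeros starts. -/
noncomputable def initMat (i x y : ℕ) : S.F :=
  if i = S.k + 1 then companionMat S.p S.deg (S.γ : S.F) S.lower x y
  else blockMat S.p (kumMat S.p (S.γ : S.F) i (S.coords S.sol S.deg)) x y

/-- The condition that the coefficients of `f` with index at least `j` are those of a zero. -/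
def test (j : ℕ) (f : Polynomial S.F) : Prop :=
  IsSingular (S.p * S.deg) (normMat (S.p * S.deg) S.q S.elt S.initMat S.k j f)

/-- The number of positions in which the encoding of `f` agrees with the received word, as computed
from the coefficients of `f` with index at most `k`. -/
noncomputable def hits (f : Polynomial S.F) : ℕ :=
  ∑ j ∈ range S.N, if ∀ l < S.m, ∑ i ∈ range (S.k + 1),
    f.coeff i * ((S.γ : S.F) ^ (j * S.m + l)) ^ i = unfold S.z ((j * S.m + l) % S.n) then 1 else 0

/-- The condition by which the lists of the search are defined. -/
def accept (j : ℕ) (f : Polynomial S.F) : Prop := S.test j f ∧ (j = 0 → S.t ≤ S.hits f)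

/-- The list of messages: the polynomials `f` of degree at most `k` for which `f(ξ)` is a zero and
whose encoding agrees with the received word in enough positions. -/
noncomputable def messages : List (Polynomial S.F) := search S.q S.elt S.accept S.B S.k (S.k + 1)

/-- The terms of the interpolating polynomial. -/
noncomputable def terms : List ((Fin (S.s + 1) →₀ ℕ) × S.F) :=
  (List.range S.len).map fun u => (S.exps u, S.sol u)

variable {S}

theorem three_le_q : 3 ≤ S.q := by
  have h1 : 3 ≤ S.n := S.three_le
  have h2 : S.n < S.q := S.n_lt_q
  omega

theorem p_pos : 0 < S.p := by
  have : 3 ≤ S.q := S.three_le_q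
  show 0 < S.q - 1
  omega

theorem elt_injOn : Set.InjOn S.elt (Set.Iio S.q) := fun i hi j hj h => by
  rw [← S.code_elt hi, ← S.code_elt hj, h]

theorem ofTerms_terms : ofTerms S.terms = S.poly S.sol := by
  rw [ofTerms, terms, List.map_map]
  rfl

theorem coords_sum {U : ℕ} (c : Fin U → S.F) (x : ℕ → ℕ → S.F) (l b : ℕ) :
    S.coords (∑ u, c u • x u) l b = ∑ u, c u * S.coords (x u) l b := by
  simp only [coords, mul_sum]
  rw [sum_comm]
  refine sum_congr rfl fun i _ => ?_
  split_ifs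
  · rw [Finset.sum_apply, sum_mul]
    exact sum_congr rfl fun u _ => mul_assoc _ _ _
  · simp

section

variable {K : Type*} [Field K] [Algebra S.F K]

theorem coeff_collapse_poly {ξ : K} (hξ : ξ ^ S.p = algebraMap S.F K S.γ) (x : ℕ → S.F) {l : ℕ}
    (hl : l < S.B) :
    (collapse ξ (S.poly x)).coeff l = vecElt S.p ξ (S.coords x l) := by
  rw [poly, map_sum, Polynomial.finsetSum_coeff, show S.len = S.B * (S.D + 1) from mul_comm _ _,
    sum_range_mul]
  have h1 : ∀ i ∈ range (S.D + 1), ∑ b ∈ range S.B,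
      (collapse ξ (MvPolynomial.monomial (S.exps (b + S.B * i)) (x (b + S.B * i)))).coeff l =
        x (S.B * i + l) • ξ ^ i := fun i _ => by
    have hB : 0 < S.B := pow_pos q_pos _
    have h2 : ∀ b ∈ range S.B,
        (collapse ξ (MvPolynomial.monomial (S.exps (b + S.B * i)) (x (b + S.B * i)))).coeff l =
          if l = b then x (b + S.B * i) • ξ ^ i else 0 := fun b hb => by
      have hb := mem_range.1 hb
      rw [collapse_monomial, sum_exps_succ, exps_zero, Polynomial.coeff_C_mul_X_pow,
        Nat.add_mul_mod_self_left, Nat.mod_eq_of_lt hb, Nat.add_mul_div_left _ _ hB,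
        Nat.div_eq_of_lt hb, zero_add]
    rw [sum_congr rfl h2, sum_ite_eq, if_pos (mem_range.2 hl), add_comm]
  rw [sum_congr rfl h1, sum_pow_eq p_pos hξ]
  rfl

variable {pb : PowerBasis S.F K} (hdim : pb.dim = S.p)
  (hgen : pb.gen ^ S.p = algebraMap S.F K S.γ)

include hdim

theorem vecElt_eq_zero_iff {v : ℕ → S.F} :
    vecElt S.p pb.gen v = 0 ↔ ∀ b < S.p, v b = 0 := by
  constructor
  · intro h b hb
    rw [← hdim] at hb
    refine Fintype.linearIndependent_iff.1 pb.basis.linearIndependent (fun b => v b) ?_ ⟨b, hb⟩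
    rw [← h, vecElt, ← hdim, sum_range]
    simp
  · intro h
    exact sum_eq_zero fun b hb => by rw [h b (mem_range.1 hb), zero_smul]

include hgen

theorem coeff_collapse_poly_ne_zero_iff (x : ℕ → S.F) {l : ℕ} (hl : l < S.B) :
    (collapse pb.gen (S.poly x)).coeff l ≠ 0 ↔ ∃ b < S.p, S.coords x l b ≠ 0 := by
  rw [coeff_collapse_poly hgen x hl, Ne, vecElt_eq_zero_iff hdim]
  push Not
  rfl

/-- One of the computed solutions does not vanish in the extension field, because the coordinates
there are linear in the solution and some interpolating polynomial does not vanish. -/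
theorem poly_sol_spec : Interpolates S.γ S.k S.s S.r S.D S.z (S.poly S.sol) ∧
    collapse pb.gen (S.poly S.sol) ≠ 0 := by
  classical
  have hex : ∃ u < S.len, ∃ l < S.B, ∃ b < S.p, S.coords (S.sols u) l b ≠ 0 := by
    obtain ⟨Q, hQ⟩ := exists_interpolates S.γ S.one_le_k S.one_le_r
      (degreeRadicand_lt S.m S.k S.s S.r) S.z
    obtain ⟨Q', hQ', h0⟩ := exists_collapse_ne_zero S.gen S.three_le_q pb.gen pb.isIntegral_gen hgen
      S.interpDegree_lt hQ
    obtain ⟨x, hx, rfl⟩ := exists_poly_eq hQ'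
    by_contra! hno
    refine h0 ?_
    obtain ⟨c, rfl⟩ := mem_spanRows.1 hx
    ext l
    rw [Polynomial.coeff_zero]
    by_contra hl
    have hlB : l < S.B := (Polynomial.le_natDegree_of_ne_zero hl).trans_lt
      (natDegree_collapse_lt _ S.interpDegree_lt hQ'.2.1)
    obtain ⟨b, hb, hne⟩ := (coeff_collapse_poly_ne_zero_iff hdim hgen _ hlB).1 hl
    rw [coords_sum] at hne
    exact hne (sum_eq_zero fun u _ => by rw [hno u u.2 l hlB b hb, mul_zero])
  have hpiv : S.pivot =
      lastIdx (fun u => ∃ l < S.B, ∃ b < S.p, S.coords (S.sols u) l b ≠ 0) S.len := by rw [pivot]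
  obtain ⟨h1, l, hl, hb⟩ := lastIdx_spec hex
  rw [← hpiv] at h1 hb
  have h2 : collapse pb.gen (S.poly S.sol) ≠ 0 := fun h => by
    exact (coeff_collapse_poly_ne_zero_iff hdim hgen S.sol hl).2 hb (by rw [h]; simp)
  exact ⟨interpolates_poly (row_mem_spanRows _ h1) fun h => h2 (by rw [h, map_zero]), h2⟩

theorem deg_eq : S.deg = (collapse pb.gen (S.poly S.sol)).natDegree := by
  classical
  obtain ⟨h1, h2⟩ := poly_sol_spec hdim hgen
  have hlt := natDegree_collapse_lt pb.gen S.interpDegree_lt h1.2.1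
  have h3 : ∃ l < S.B, ∃ b < S.p, S.coords S.sol l b ≠ 0 := ⟨_, hlt,
    (coeff_collapse_poly_ne_zero_iff hdim hgen _ hlt).1 (Polynomial.leadingCoeff_ne_zero.2 h2)⟩
  obtain ⟨h4, h5⟩ := lastIdx_spec h3
  have h6 : S.deg = lastIdx (fun l => ∃ b < S.p, S.coords S.sol l b ≠ 0) S.B := by
    rw [deg]
  rw [← h6] at h4 h5
  refine le_antisymm (Polynomial.le_natDegree_of_ne_zero
    ((coeff_collapse_poly_ne_zero_iff hdim hgen _ h4).2 h5)) ?_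
  by_contra! h7
  rw [h6] at h7
  exact not_of_lastIdx_lt h7 hlt ((coeff_collapse_poly_ne_zero_iff hdim hgen _ hlt).1
    (Polynomial.leadingCoeff_ne_zero.2 h2))

/-- The matrix whose singularity is tested is that of the multiplication by the product of all
`y - c g(ξ)`, where `y` is the class of the variable, `c` the leading coefficient, and `g` runs through
the polynomials that have the same coefficients as `f` from index `j` on. -/
theorem test_iff {j : ℕ} (hj : j ≤ S.k + 1) (f : Polynomial S.F) : S.test j f ↔
    ¬ IsUnit (towerNorm S.k (searchElts (collapse pb.gen (S.poly S.sol)) pb.gen S.k) j f) := by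
  obtain ⟨h1, h0⟩ := poly_sol_spec hdim hgen
  have hdeg := deg_eq hdim hgen
  set T := collapse pb.gen (S.poly S.sol) with hT
  have hlt : T.natDegree < S.B := natDegree_collapse_lt pb.gen S.interpDegree_lt h1.2.1
  have hmonic := Polynomial.monic_integralNormalization h0
  have hd : T.integralNormalization.natDegree = S.deg := by
    rw [Polynomial.natDegree_integralNormalization, hdeg]
  have hlead : T.leadingCoeff = vecElt S.p pb.gen (S.coords S.sol S.deg) := by
    rw [Polynomial.leadingCoeff, ← hdeg, hT, coeff_collapse_poly hgen _ (by rw [hdeg]; exact hlt)]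
  have hrep : ∀ i ≤ S.k + 1, Represents (S.p * S.deg)
      (monomialFamily S.p T.integralNormalization pb.gen) (S.initMat i)
      (searchElts T pb.gen S.k i) := by
    intro i _
    by_cases hi : i = S.k + 1
    · have := represents_companionMat hgen hmonic (u := S.lower) fun j hj => by
        rw [hd] at hj
        rw [Polynomial.integralNormalization_coeff_ne_natDegree (by omega), lower,
          vecElt_iterate_kumMul p_pos hgen, ← hlead, ← hdeg, hT, coeff_collapse_poly hgen]
        omega
      rw [hd] at this
      unfold initMat searchElts
      simp only [hi, if_true]
      exact this
    · have := represents_blockMat (p := S.p) (ξ := pb.gen) (g := T.integralNormalization)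
        (d := S.deg) (κ := T.leadingCoeff * pb.gen ^ i) fun b' _ => by
          rw [hlead]
          exact vecElt_mul_pow p_pos hgen (S.coords S.sol S.deg) i b'
      unfold initMat searchElts
      simp only [hi, if_false]
      exact this
  have hbas : ∃ b : Module.Basis (Fin (S.p * S.deg)) S.F (AdjoinRoot T.integralNormalization),
      ∀ i, b i = monomialFamily S.p T.integralNormalization pb.gen i := by
    rw [← hdim, ← hd]
    exact exists_basis pb hmonic
  obtain ⟨b, hb⟩ := hbas
  exact ((represents_normMat S.prod_elt hrep hj f).not_isUnit_iff b hb).symm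

end

theorem hits_eq {f : Polynomial S.F} (hf : f.natDegree ≤ S.k) :
    S.hits f = agreement S.γ S.z f := by
  rw [hits, agreement, card_filter, sum_range]
  refine sum_congr rfl fun j _ => ?_
  have h : (∀ l < S.m, ∑ i ∈ range (S.k + 1), f.coeff i * ((S.γ : S.F) ^ (j.val * S.m + l)) ^ i =
      unfold S.z ((j.val * S.m + l) % S.n)) ↔ encode S.γ S.m f j = S.z j := by
    rw [funext_iff, Fin.forall_iff]
    refine forall_congr' fun l => forall_congr' fun hl => ?_
    have h1 : j.val * S.m + l < S.m * S.N :=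
      calc j.val * S.m + l < S.m * (j.val + 1) := by rw [Nat.mul_succ, mul_comm]; omega
        _ ≤ _ := Nat.mul_le_mul_left _ j.2
    have h2 : (j.val * S.m + l) / S.m = j := by
      rw [mul_comm, Nat.mul_add_div (by omega), Nat.div_eq_of_lt hl, add_zero]
    have h3 : (j.val * S.m + l) % S.m = l := by
      rw [mul_comm, Nat.mul_add_mod, Nat.mod_eq_of_lt hl]
    rw [Nat.mod_eq_of_lt (by rw [show S.n = S.m * S.N from mul_comm _ _]; exact h1), unfold,
      dif_pos h1, encode, Polynomial.eval_eq_sum_range' (Nat.lt_succ_of_le hf)]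
    simp only [h2, h3]
  simp only [h]

theorem mem_messages_iff : S.messages.Nodup ∧ ∀ f, f ∈ S.messages ↔
    f.natDegree ≤ S.k ∧ S.test 0 f ∧ S.t ≤ agreement S.γ S.z f := by
  obtain ⟨K, _, _, pb, hdim, hgen⟩ := exists_powerBasis S.F S.gen
  obtain ⟨hQ, h0⟩ := poly_sol_spec hdim hgen
  have hk : S.k < pb.dim := by
    have h1 : S.k < S.n := S.k_lt
    have h2 : S.n < S.q := S.n_lt_q
    rw [hdim]
    show S.k < S.q - 1
    omega
  obtain ⟨h1, -, h3⟩ := search_spec (p := S.accept) (B := S.B) (pow_pos q_pos _) q_pos elt_injOn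
    (fun a => ⟨S.e a, (S.e a).2, S.elt_code a⟩)
    (fun j hj g a h => ⟨(test_iff hdim hgen (by omega) g).2
      ((not_isUnit_towerNorm_succ hj.le _ g).2 ⟨a, (test_iff hdim hgen (by omega) _).1 h.1⟩),
      fun h => absurd h (Nat.succ_ne_zero j)⟩)
    (fun j hj l hl h => (length_le_natDegree h0 pb hk (by omega) hl fun f hf =>
      ⟨(h f hf).1, (h f hf).2.1, (test_iff hdim hgen (by omega) f).1 (h f hf).2.2.1⟩).trans
        (natDegree_collapse_lt pb.gen S.interpDegree_lt hQ.2.1).le) (le_refl (S.k + 1))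
  refine ⟨h1, fun f => (h3 f).trans (and_congr_right fun hf => ?_)⟩
  simp [accept, hits_eq hf]

/-- The list of messages and the interpolating polynomial are those of a run of the decoder. A
polynomial `f` with enough agreements satisfies `Q(X, f(X), …) = 0`, so that `f(ξ)` is a zero. -/
theorem isDecoderRun :
    IsDecoderRun S.γ S.k S.s S.r S.t S.z (ofTerms S.terms) S.messages := by
  obtain ⟨K, _, _, pb, hdim, hgen⟩ := exists_powerBasis S.F S.gen
  obtain ⟨hQ, h0⟩ := poly_sol_spec hdim hgen
  obtain ⟨h1, h2⟩ := S.mem_messages_iff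
  rw [ofTerms_terms]
  refine ⟨hQ, h1, fun f => (h2 f).trans (and_congr_right fun hf => and_congr_left fun ht => ?_)⟩
  have h3 := substitute_eq_zero S.gen S.one_le_s S.s_le hQ S.interpDegree_lt_agreement hf ht
  refine iff_of_true ?_ h3
  rw [test_iff hdim hgen (Nat.zero_le _), not_isUnit_towerNorm_iff h0 _ hf, eval_collapse hgen, h3,
    map_zero]

end Setting

end FRS

namespace FRS
open DataTree

/-! ### Running time: parameters and linear conditions -/

universe u

namespace Setting

variable {Γ : Type*} {π : Γ → Setting.{u}}

theorem k_mul_q_le (S : Setting.{u}) : S.k * S.q ≤ S.n ^ 3 :=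
  (Nat.mul_le_mul S.k_le S.q_le).trans (by rw [pow_succ S.n 2, mul_comm])

theorem pow_le_budget_pow (S : Setting.{u}) {a : ℕ} (h : a ≤ S.n ^ 3) :
    a ^ (S.s + 1) ≤ S.budget ^ 6 := by
  have h1 : 1 ≤ S.n := le_trans (by norm_num) S.three_le
  calc a ^ (S.s + 1) ≤ (S.n ^ 3) ^ (S.s + 1) := Nat.pow_le_pow_left h _
    _ = S.n ^ (3 * (S.s + 1)) := by rw [pow_mul]
    _ ≤ S.n ^ (S.s * 6) := Nat.pow_le_pow_right h1 (by have := S.one_le_s; omega)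
    _ = S.budget ^ 6 := by rw [budget, pow_mul]

theorem polyBounded_pow_succ {a : Γ → ℕ} (h : ∀ γ, a γ ≤ (π γ).k * (π γ).q) :
    PolyBounded (fun γ => (π γ).budget) fun γ => a γ ^ ((π γ).s + 1) :=
  (PolyBounded.self.pow 6).mono fun γ =>
    (π γ).pow_le_budget_pow ((h γ).trans (π γ).k_mul_q_le)

/-- The same for smaller exponents. -/
theorem polyBounded_pow {a b : Γ → ℕ} (h : ∀ γ, a γ ≤ (π γ).k * (π γ).q)
    (hb : ∀ γ, b γ ≤ (π γ).s + 1) :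
    PolyBounded (fun γ => (π γ).budget) fun γ => a γ ^ b γ := by
  refine ((polyBounded_pow_succ h).add (.const 1)).mono fun γ => ?_
  rcases Nat.eq_zero_or_pos (a γ) with h0 | h0
  · rw [h0]
    rcases Nat.eq_zero_or_pos (b γ) with h1 | h1
    · simp [h1]
    · simp [Nat.ne_of_gt h1]
  · exact (Nat.pow_le_pow_right h0 (hb γ)).trans (Nat.le_succ _)

theorem q_le_k_mul_q (S : Setting.{u}) : S.q ≤ S.k * S.q := Nat.le_mul_of_pos_left _ S.one_le_k

theorem card_interpIndices (S : Setting.{u}) : (interpIndices S.F S.m S.s).card =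
    ∑ i ∈ Finset.range S.n, if i % S.m ≤ S.m - S.s then 1 else 0 := by
  rw [interpIndices, Finset.card_filter]

theorem D_eq (S : Setting.{u}) : S.D = ∑ D ∈ Finset.range (S.k * S.q),
    if D ^ (S.s + 1) ≤ degreeRadicand S.F S.m S.k S.s S.r then 1 else 0 := by
  rw [Finset.sum_boole, Nat.cast_id]
  have : (Finset.range (S.k * S.q)).filter
      (fun D => D ^ (S.s + 1) ≤ degreeRadicand S.F S.m S.k S.s S.r) = Finset.range S.D := by
    ext D
    rw [Finset.mem_filter, Finset.mem_range, Finset.mem_range, ← not_lt, ← interpDegree_le_iff,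
      not_le]
    exact ⟨fun h => h.2, fun h => ⟨h.trans S.interpDegree_lt, h⟩⟩
  rw [this, Finset.card_range]

theorem one_le_card (S : Setting.{u}) : 1 ≤ S.k ^ S.s * (interpIndices S.F S.m S.s).card := by
  refine Nat.mul_pos (pow_pos S.one_le_k _) (Finset.card_pos.2 ⟨0, ?_⟩)
  refine Finset.mem_filter.2 ⟨Finset.mem_range.2 (lt_of_lt_of_le (by norm_num) S.three_le), ?_⟩
  simp

theorem radicand_le (S : Setting.{u}) :
    degreeRadicand S.F S.m S.k S.s S.r ≤ (S.k * S.q) ^ (S.s + 1) :=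
  (degreeRadicand_lt S.m S.k S.s S.r).le.trans (Nat.pow_le_pow_left S.interpDegree_lt.le _)

end Setting

open Setting

variable {C : Ctx.{u}} {d : C.Γ → ℕ}

namespace FN

theorem p : FN C fun γ => (C.π γ).p := q.pred

theorem B : FN C fun γ => (C.π γ).B :=
  pow q s (polyBounded_pow (fun γ => (C.π γ).q_le_k_mul_q) fun _ => Nat.le_succ _)

theorem degreeRadicand :
    FN C fun γ => degreeRadicand (C.π γ).F (C.π γ).m (C.π γ).k (C.π γ).s (C.π γ).r := by
  have hk : ∀ γ : C.Γ, (C.π γ).k ≤ (C.π γ).k * (C.π γ).q := fun γ =>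
    Nat.le_mul_of_pos_right _ q_pos
  refine mul (mul (pow k s (polyBounded_pow hk fun _ => Nat.le_succ _)) ?_) ?_
  · exact (sum (t := fun γ i => if i % (C.π γ).m ≤ (C.π γ).m - (C.π γ).s then 1 else 0) n
      (ite (.le ((index n).mod m) (m.sub s)) (const 1) (const 0))).congr
        fun γ => (C.π γ).card_interpIndices
  · refine prod (t := fun γ j => (C.π γ).r + j) s.succ (r.wk.add (index s.succ))
      (B := fun γ => ((C.π γ).k * (C.π γ).q) ^ ((C.π γ).s + 1))
      (polyBounded_pow_succ fun _ => le_rfl) fun γ j hj => ?_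
    calc ∏ i ∈ Finset.range j, ((C.π γ).r + i)
        ≤ ∏ i ∈ Finset.range ((C.π γ).s + 1), ((C.π γ).r + i) :=
          Finset.prod_le_prod_of_subset_of_one_le' (Finset.range_subset_range.2 hj)
            fun i _ _ => (C.π γ).one_le_r.trans (Nat.le_add_right _ _)
      _ ≤ _ := Nat.le_mul_of_pos_left _ (C.π γ).one_le_card
      _ ≤ _ := (C.π γ).radicand_le

theorem D : FN C fun γ => (C.π γ).D := by
  refine (sum (t := fun γ D => if D ^ ((C.π γ).s + 1) ≤ FRS.degreeRadicand (C.π γ).F (C.π γ).m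
    (C.π γ).k (C.π γ).s (C.π γ).r then 1 else 0) (k.mul q) (ite (.le (pow (index (k.mul q)) s.succ
      (polyBounded_pow (fun p => p.2.2.le) fun _ => le_rfl)) degreeRadicand) (const 1)
        (const 0))).congr fun γ => (C.π γ).D_eq

theorem monomials : FN C fun γ => (C.π γ).len := D.succ.mul B

theorem expo {u i : C.Γ → ℕ} (hu : FN C u) (hi : FN C i) (h : ∀ γ, i γ ≤ (C.π γ).s) :
    FN C fun γ => (C.π γ).expo (u γ) (i γ) :=
  ite (.eq hi (const 0)) (hu.div B) (((hu.mod B).div (pow q hi.pred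
    (polyBounded_pow (fun γ => (C.π γ).q_le_k_mul_q) fun γ => by have := h γ; omega))).mod q)

theorem rpow {i : C.Γ → ℕ} (hi : FN C i) (h : ∀ γ, i γ ≤ (C.π γ).s + 1) :
    FN C fun γ => (C.π γ).r ^ i γ :=
  pow r hi (polyBounded_pow (fun γ => (C.π γ).r_le) h)

theorem conditions : FN C fun γ => (C.π γ).n * (C.π γ).r ^ ((C.π γ).s + 1) :=
  n.mul (rpow s.succ fun _ => le_rfl)

end FN

theorem FB.isGood {u : C.Γ → ℕ} (hu : FN C u) : FB C fun γ => (C.π γ).IsGood (u γ) := by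
  refine FB.le (FN.add (FN.expo hu (FN.const 0) fun _ => Nat.zero_le _) (FN.mul FN.k
    (FN.sum (t := fun γ i => (C.π γ).expo (u γ) (i + 1)) FN.s
      (FN.expo hu.wk (FN.index FN.s).succ fun p => p.2.2)))) FN.D

namespace FE

/-- The coefficients of powers of `X + a` are computed by the rule of Pascal's triangle. -/
theorem coeff_pow {a : ∀ γ : C.Γ, (C.π γ).F} {e i : C.Γ → ℕ} (ha : FE C a) (he : FN C e)
    (hd : FN C d) (hi : FN C i) (h : ∀ γ, i γ < d γ) :
    FE C fun γ => ((Polynomial.X + Polynomial.C (a γ)) ^ e γ).coeff (i γ) := by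
  refine FVec.get (d := d)
    (v := fun γ i => ((Polynomial.X + Polynomial.C (a γ)) ^ e γ).coeff i) ?_ hi h
  refine Fast.iter (s := fun γ j => (C.π γ).vec (d γ)
    fun i => ((Polynomial.X + Polynomial.C (a γ)) ^ j).coeff i) he ?_ ?_
  · refine FVec.of (v := fun γ i => (((Polynomial.X : Polynomial (C.π γ).F) +
      Polynomial.C (a γ)) ^ 0).coeff i) hd ((FE.ite (.eq (FN.index hd) (FN.const 0)) .one
      .zero).congr fun p => ?_)
    rw [pow_zero, Polynomial.coeff_one]
  · let C' := C.st e fun γ j => (C.π γ).vec (d γ)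
      fun i => ((Polynomial.X + Polynomial.C (a γ)) ^ j).coeff i
    have hst : FVec C' (fun p => d p.1)
        fun p i => ((Polynomial.X + Polynomial.C (a p.1)) ^ (p.2 : ℕ)).coeff i := Fast.state
    have hd' : FN C' fun p => d p.1 := hd.wks
    refine FVec.of (C := C') (d := fun p => d p.1)
      (v := fun p i => ((Polynomial.X + Polynomial.C (a p.1)) ^ ((p.2 : ℕ) + 1)).coeff i) hd'
      ((FE.add (.mul ((ha.wks : FE C' fun p => a p.1)).wk (hst.wk.get (FN.index hd') fun p => p.2.2))
        (.ite (.eq (FN.index hd') (FN.const 0)) .zero (hst.wk.get (FN.index hd').pred fun p =>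
          (Nat.sub_le _ _).trans_lt p.2.2))).congr fun p => ?_)
    rw [pow_succ, mul_add, Polynomial.coeff_add, Polynomial.coeff_mul_C, mul_comm (a _), add_comm]
    congr 1
    rcases (p.2 : ℕ) with _ | i
    · simp
    · simp [Polynomial.coeff_mul_X]

theorem point {i j : C.Γ → ℕ} (hi : FN C i) (hj : FN C j) :
    FE C fun γ => (C.π γ).point (i γ) (j γ) :=
  ite (.eq hj (FN.const 0)) (pow gen hi) (unfold ((hi.add hj.pred).mod FN.n) fun γ =>
    Nat.mod_lt _ (lt_of_lt_of_le (by norm_num) (C.π γ).three_le))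

theorem form {v u : C.Γ → ℕ} (hv : FN C v) (hu : FN C u) :
    FE C fun γ => (C.π γ).form (v γ) (u γ) := by
  have hR : FN C fun γ => (C.π γ).r ^ ((C.π γ).s + 1) := FN.rpow FN.s.succ fun _ => le_rfl
  have hdig : FN (C.ix fun γ => (C.π γ).s + 1) fun p => v p.1 % (C.π p.1).r ^ ((C.π p.1).s + 1) /
      (C.π p.1).r ^ (p.2 : ℕ) % (C.π p.1).r :=
    ((hv.mod hR).wk.div (FN.rpow (FN.index FN.s.succ) fun p => p.2.2.le)).mod FN.r
  refine FE.congr (FE.ite (FB.and (.le ((hv.div hR).mod FN.m) (FN.m.sub FN.s)) (.lt (FN.sum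
    (t := fun γ j => v γ % (C.π γ).r ^ ((C.π γ).s + 1) / (C.π γ).r ^ j % (C.π γ).r) FN.s.succ
      hdig) FN.r)) (FE.prod (t := fun γ j => ((Polynomial.X + Polynomial.C ((C.π γ).point
        (v γ / (C.π γ).r ^ ((C.π γ).s + 1)) j)) ^ (C.π γ).expo (u γ) j).coeff
          (v γ % (C.π γ).r ^ ((C.π γ).s + 1) / (C.π γ).r ^ j % (C.π γ).r)) FN.s.succ ?_) .zero)
      fun γ => rfl
  exact coeff_pow (point (hv.div hR).wk (FN.index FN.s.succ))
    (FN.expo hu.wk (FN.index FN.s.succ) fun p => Nat.lt_succ_iff.1 p.2.2) FN.r hdig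
      fun p => Nat.mod_lt _ (C.π p.1).one_le_r

end FE

theorem FMat.sols :
    FMat C (fun γ => (C.π γ).len) (fun γ => (C.π γ).len) fun γ => (C.π γ).sols :=
  FMat.eliminate FN.monomials FN.monomials FN.conditions
    (FE.form (FN.index FN.conditions).wk (FN.index FN.monomials))
    (FMat.coordVectors FN.monomials (FB.isGood (FN.index FN.monomials)))

end FRS

namespace FRS
open DataTree Setting

/-! ### Running time: matrices of multiplications -/

universe u

variable {C : Ctx.{u}} {d : C.Γ → ℕ}

namespace Setting

theorem len_pos (S : Setting.{u}) : 0 < S.len := Nat.mul_pos (Nat.succ_pos _) (pow_pos q_pos _)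

theorem B_pos (S : Setting.{u}) : 0 < S.B := pow_pos q_pos _

theorem deg_lt (S : Setting.{u}) : S.deg < S.B := lastIdx_lt S.B_pos

end Setting

theorem FE.coords {x : ∀ γ : C.Γ, ℕ → (C.π γ).F} {l b : C.Γ → ℕ}
    (hx : FVec C (fun γ => (C.π γ).len) x) (hl : FN C l) (hlB : ∀ γ, l γ < (C.π γ).B)
    (hb : FN C b) : FE C fun γ => (C.π γ).coords (x γ) (l γ) (b γ) := by
  refine FE.sum (t := fun γ i => if i % (C.π γ).p = b γ then x γ ((C.π γ).B * i + l γ) *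
    ((C.π γ).γ : (C.π γ).F) ^ (i / (C.π γ).p) else 0) FN.D.succ ?_
  have hi : FN (C.ix fun γ => (C.π γ).D + 1) fun p => (p.2 : ℕ) := FN.index FN.D.succ
  refine .ite (.eq (hi.mod FN.p) hb.wk) (.mul (hx.wk.get ((FN.B.mul hi).add hl.wk) fun p => ?_)
    (.pow .gen (hi.div FN.p))) .zero
  calc (C.π p.1).B * p.2 + l p.1 < (C.π p.1).B * (p.2 + 1) := by
        rw [Nat.mul_succ]; exact Nat.add_lt_add_left (hlB _) _
    _ ≤ _ := by rw [mul_comm]; exact Nat.mul_le_mul_right _ p.2.2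

theorem FN.pivot : FN C fun γ => (C.π γ).pivot := by
  classical
  have hrow : FVec (C.ix fun γ => (C.π γ).len) (fun p => (C.π p.1).len)
      fun p => (C.π p.1).sols p.2 := FMat.row FMat.sols.wk (FN.index FN.monomials) fun p => p.2.2
  refine (FN.lastIdx (p := fun γ u => ∃ l < (C.π γ).B, ∃ b < (C.π γ).p,
    (C.π γ).coords ((C.π γ).sols u) l b ≠ 0) FN.monomials ?_).congr fun γ => by
      rw [Setting.pivot]
  let C1 := C.ix fun γ => (C.π γ).len
  exact FB.ex (C := C1) (p := fun x l => ∃ b < (C1.π x).p,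
    (C1.π x).coords ((C1.π x).sols x.2) l b ≠ 0) FN.B
      (FB.ex (C := C1.ix fun x => (C1.π x).B) (p := fun x b =>
        (C1.π x.1).coords ((C1.π x.1).sols x.1.2) x.2 b ≠ 0) FN.p
          (FB.eqE (FE.coords hrow.wk.wk (FN.index FN.B).wk (fun p => p.1.2.2) (FN.index FN.p))
            .zero).not)

theorem FVec.sol : FVec C (fun γ => (C.π γ).len) fun γ => (C.π γ).sol :=
  FMat.row FMat.sols FN.pivot fun γ => lastIdx_lt (C.π γ).len_pos

/-- The coordinates of a coefficient of the univariate polynomial. -/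
theorem FVec.coords_sol {l : C.Γ → ℕ} (hl : FN C l) (hlB : ∀ γ, l γ < (C.π γ).B) :
    FVec C (fun γ => (C.π γ).p) fun γ => (C.π γ).coords (C.π γ).sol (l γ) :=
  FVec.of FN.p (FE.coords FVec.sol hl.wk (fun p => hlB p.1) (FN.index FN.p))

theorem FN.deg : FN C fun γ => (C.π γ).deg := by
  classical
  refine (FN.lastIdx (p := fun γ l => ∃ b < (C.π γ).p, (C.π γ).coords (C.π γ).sol l b ≠ 0)
    FN.B ?_).congr fun γ => by rw [Setting.deg]
  exact FB.ex (C := C.ix fun γ => (C.π γ).B)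
    (p := fun x b => (C.π x.1).coords (C.π x.1).sol x.2 b ≠ 0) FN.p
    (FB.eqE (FE.coords FVec.sol (FN.index FN.B).wk (fun p => p.1.2.2) (FN.index FN.p)) .zero).not

theorem FE.kumMat {v : ∀ γ : C.Γ, ℕ → (C.π γ).F} {e b b' : C.Γ → ℕ}
    (hv : FVec C (fun γ => (C.π γ).p) v) (he : FN C e) (hb : FN C b) (hb' : FN C b') :
    FE C fun γ => kumMat (C.π γ).p ((C.π γ).γ : (C.π γ).F) (e γ) (v γ) (b γ) (b' γ) := by
  have hi : FN (C.ix fun γ => (C.π γ).p) fun p => (p.2 : ℕ) := FN.index FN.p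
  have hs : FN (C.ix fun γ => (C.π γ).p) fun p => (p.2 : ℕ) + e p.1 + b' p.1 :=
    (hi.add he.wk).add hb'.wk
  exact FE.sum (t := fun γ a => if (a + e γ + b' γ) % (C.π γ).p = b γ then
    v γ a * ((C.π γ).γ : (C.π γ).F) ^ ((a + e γ + b' γ) / (C.π γ).p) else 0) FN.p
      (.ite (.eq (hs.mod FN.p) hb.wk) (.mul (hv.wk.get hi fun p => p.2.2) (.pow .gen (hs.div FN.p)))
        .zero)

theorem FVec.kumMul {v w : ∀ γ : C.Γ, ℕ → (C.π γ).F} (hv : FVec C (fun γ => (C.π γ).p) v)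
    (hw : FVec C (fun γ => (C.π γ).p) w) :
    FVec C (fun γ => (C.π γ).p) fun γ => kumMul (C.π γ).p ((C.π γ).γ : (C.π γ).F) (v γ) (w γ) := by
  refine FVec.of FN.p (FE.sum (t := fun (p : (C.ix fun γ => (C.π γ).p).Γ) b' =>
    FRS.kumMat (C.π p.1).p ((C.π p.1).γ : (C.π p.1).F) 0 (v p.1) p.2 b' * w p.1 b') FN.p ?_)
  exact .mul (.kumMat hv.wk.wk (FN.const 0) (FN.index FN.p).wk (FN.index FN.p))
    (hw.wk.wk.get (FN.index FN.p) fun p => p.2.2)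

theorem FVec.lower {j : C.Γ → ℕ} (hj : FN C j) (hjB : ∀ γ, j γ < (C.π γ).B) :
    FVec C (fun γ => (C.π γ).p) fun γ => (C.π γ).lower (j γ) := by
  refine Fast.iter (s := fun γ i => (C.π γ).vec (C.π γ).p ((FRS.kumMul (C.π γ).p
    ((C.π γ).γ : (C.π γ).F) ((C.π γ).coords (C.π γ).sol (C.π γ).deg))^[i]
      ((C.π γ).coords (C.π γ).sol (j γ)))) ((FN.deg.sub (FN.const 1)).sub hj)
        (FVec.coords_sol hj hjB) ?_
  simp only [Function.iterate_succ_apply']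
  exact FVec.kumMul (FVec.coords_sol FN.deg fun p => deg_lt _) Fast.state

theorem FN.width : FN C fun γ => (C.π γ).p * (C.π γ).deg := FN.p.mul FN.deg

theorem FMat.initMat {i : C.Γ → ℕ} (hi : FN C i) :
    FMat C (fun γ => (C.π γ).p * (C.π γ).deg) (fun γ => (C.π γ).p * (C.π γ).deg)
      fun γ => (C.π γ).initMat (i γ) := by
  have hx : FN ((C.ix fun γ => (C.π γ).p * (C.π γ).deg).ix fun p => (C.π p.1).p * (C.π p.1).deg)
    fun p => (p.1.2 : ℕ) := (FN.index FN.width).wk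
  have hy : FN ((C.ix fun γ => (C.π γ).p * (C.π γ).deg).ix fun p => (C.π p.1).p * (C.π p.1).deg)
    fun p => (p.2 : ℕ) := FN.index FN.width
  refine FMat.of FN.width FN.width (.ite (.eq hi.wk.wk FN.k.succ) ?_ ?_)
  · refine .ite (.lt (hy.div FN.p).succ FN.deg) (.ite (.and (.eq (hx.mod FN.p) (hy.mod FN.p))
      (.eq (hx.div FN.p) (hy.div FN.p).succ)) .one .zero) (.neg (.kumMat (FVec.lower (hx.div FN.p)
        fun p => ?_) (.const 0) (hx.mod FN.p) (hy.mod FN.p)))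
    exact (Nat.div_lt_of_lt_mul p.1.2.2).trans (deg_lt _)
  · exact .ite (.eq (hx.div FN.p) (hy.div FN.p)) (.kumMat (FVec.coords_sol FN.deg fun p => deg_lt _)
      hi.wk.wk (hx.mod FN.p) (hy.mod FN.p)) .zero

section

variable {w : C.Γ → ℕ}

theorem FMat.matMul {A A' : ∀ γ : C.Γ, ℕ → ℕ → (C.π γ).F} (hw : FN C w) (hA : FMat C w w A)
    (hA' : FMat C w w A') : FMat C w w fun γ => matMul (w γ) (A γ) (A' γ) := by
  refine FMat.of hw hw (FE.sum (t := fun (p : ((C.ix w).ix fun p => w p.1).Γ) l =>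
    A p.1.1 p.1.2 l * A' p.1.1 l p.2) hw.wk.wk ?_)
  exact .mul (hA.wk.wk.wk.get (FN.index hw).wk.wk (fun p => p.1.1.2.2) (FN.index hw.wk.wk)
    fun p => p.2.2) (hA'.wk.wk.wk.get (FN.index hw.wk.wk) (fun p => p.2.2) (FN.index hw.wk).wk
      fun p => p.1.2.2)

theorem FMat.matProd {A : ∀ γ : C.Γ, ℕ → ℕ → ℕ → (C.π γ).F} (hw : FN C w) (hd : FN C d)
    (hA : FMat (C.ix d) (fun p => w p.1) (fun p => w p.1) fun p => A p.1 p.2) :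
    FMat C w w fun γ => matProd (w γ) (A γ) (d γ) := by
  refine Fast.iter (s := fun γ j => (C.π γ).mat (w γ) (w γ) (FRS.matProd (w γ) (A γ) j)) hd ?_ ?_
  · exact FMat.of hw hw (.ite (.eq (FN.index hw).wk (FN.index hw.wk)) .one .zero)
  · exact FMat.matMul hw.wks Fast.state hA.toSt

end

/-- The matrices of a stage of the tower. -/
theorem Fast.towerMat {l : C.Γ → ℕ} (hl : FN C l) (hlk : ∀ γ, l γ ≤ (C.π γ).k + 1) :
    Fast C fun γ => DataTree.tab ((C.π γ).k + 2) fun i => (C.π γ).mat ((C.π γ).p * (C.π γ).deg)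
      ((C.π γ).p * (C.π γ).deg) (towerMat ((C.π γ).p * (C.π γ).deg) (C.π γ).q (C.π γ).elt
        (C.π γ).initMat (l γ) i) := by
  have hk2 : ∀ {C : Ctx.{u}}, FN C fun γ => (C.π γ).k + 2 := FN.k.succ.succ
  let T : ∀ γ : C.Γ, ℕ → ℕ → ℕ → ℕ → (C.π γ).F := fun γ =>
    FRS.towerMat ((C.π γ).p * (C.π γ).deg) (C.π γ).q (C.π γ).elt (C.π γ).initMat
  let st : C.Γ → ℕ → DataTree := fun γ l => DataTree.tab ((C.π γ).k + 2) fun i =>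
    (C.π γ).mat ((C.π γ).p * (C.π γ).deg) ((C.π γ).p * (C.π γ).deg) (T γ l i)
  refine Fast.iter (s := st) hl ?_ ?_
  · exact Fast.tab (w := fun γ i => (C.π γ).mat ((C.π γ).p * (C.π γ).deg)
      ((C.π γ).p * (C.π γ).deg) ((C.π γ).initMat i)) hk2 (FMat.initMat (FN.index hk2))
  · let C' := C.st l st
    have hst : Fast C' fun p => DataTree.tab ((C'.π p).k + 2) fun i =>
      (C'.π p).mat ((C'.π p).p * (C'.π p).deg) ((C'.π p).p * (C'.π p).deg) (T p.1 p.2 i) := Fast.state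
    have hl' : FN C' fun p => (p.2 : ℕ) := (FN.index hl).toSt
    let C2 := C'.ix fun p => (C'.π p).k + 2
    let C3 := C2.ix fun p => (C2.π p).q
    -- an entry of the previous stage
    have hget : ∀ {i : C3.Γ → ℕ} (_ : FN C3 i) (_ : ∀ p, i p < (C3.π p).k + 2),
        FMat C3 (fun p => (C3.π p).p * (C3.π p).deg) (fun p => (C3.π p).p * (C3.π p).deg)
          fun p => T p.1.1.1 p.1.1.2 (i p) := fun hi h =>
      Fast.get_tab (w := fun (p : C3.Γ) i => (C3.π p).mat ((C3.π p).p * (C3.π p).deg)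
        ((C3.π p).p * (C3.π p).deg) (T p.1.1.1 p.1.1.2 i)) hst.wk.wk hi h
    have hi : FN C3 fun p => (p.1.2 : ℕ) := (FN.index hk2).wk
    have ha : FN C3 fun p => (p.2 : ℕ) := FN.index FN.q
    refine Fast.tab (C := C') (d := fun p => (C'.π p).k + 2) (w := fun p i =>
      (C'.π p).mat ((C'.π p).p * (C'.π p).deg) ((C'.π p).p * (C'.π p).deg) (T p.1 (p.2 + 1) i)) hk2 ?_
    refine FMat.matProd (C := C2) (d := fun p => (C2.π p).q) (A := fun p a x y =>
      T p.1.1 p.1.2 p.2 x y - (C2.π p).elt a * T p.1.1 p.1.2 p.1.2 x y) FN.width FN.q ?_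
    refine FMat.of (C := C3) FN.width FN.width (.sub ?_ (.mul (.elt ha.wk.wk fun p => p.1.1.2.2) ?_))
    · exact (hget hi fun p => p.1.2.2).wk.wk.get (FN.index FN.width).wk (fun p => p.1.2.2)
        (FN.index FN.width) fun p => p.2.2
    · refine (hget hl'.wk.wk fun p => ?_).wk.wk.get (FN.index FN.width).wk (fun p => p.1.2.2)
        (FN.index FN.width) fun p => p.2.2
      have h1 := p.1.1.2.2
      have h2 := hlk p.1.1.1
      exact Nat.lt_succ_of_lt (h1.trans_le h2)

end FRS

namespace FRS
open DataTree Setting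

/-! ### Running time: the search and the output -/

universe u

variable {C : Ctx.{u}} {d : C.Γ → ℕ}

namespace Setting

variable (S : Setting.{u})

/-- The representation of a list of polynomials. -/
noncomputable def polys (l : List (Polynomial S.F)) : DataTree := ofList (l.map (encPoly S.e S.k))

theorem encPoly_eq (f : Polynomial S.F) : encPoly S.e S.k f = S.vec (S.k + 1) f.coeff := by
  rw [encPoly, ofList_ofFn, vec]
  exact tab_congr fun i hi => by rw [dif_pos hi]

theorem get_polys {l : List (Polynomial S.F)} {i : ℕ} (h : i < l.length) :
    (S.polys l).get i = S.vec (S.k + 1) (l.getD i 0).coeff := by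
  rw [polys, get_ofList, ← encPoly_eq]
  simp [h]

theorem drop_polys_ne_nil {l : List (Polynomial S.F)} {i : ℕ} :
    (S.polys l).drop i ≠ DataTree.nil ↔ i < l.length := by
  rw [Ne, eq_nil_iff_len, len_drop, polys, len_ofList, List.length_map]
  omega

theorem encTerms_terms : encTerms S.e S.terms = tab S.len fun u =>
    DataTree.cons (tab (S.s + 1) fun i => ofNat (S.expo u i)) (encElem S.e (S.sol u)) := by
  rw [encTerms, terms, List.map_map, tab]
  congr 1
  refine List.map_congr_left fun u _ => ?_
  rw [Function.comp, ofList_ofFn]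
  congr 1
  refine tab_congr fun i hi => ?_
  rw [dif_pos hi]
  rfl

end Setting

/-- The coefficients of the polynomial `f` of degree at most `k` are computable in polynomial
time. -/
abbrev FPoly (C : Ctx.{u}) (f : ∀ γ : C.Γ, Polynomial (C.π γ).F) : Prop :=
  FVec C (fun γ => (C.π γ).k + 1) fun γ => (f γ).coeff

theorem FMat.towerMat {l i : C.Γ → ℕ} (hl : FN C l) (hlk : ∀ γ, l γ ≤ (C.π γ).k + 1)
    (hi : FN C i) (hik : ∀ γ, i γ ≤ (C.π γ).k + 1) :
    FMat C (fun γ => (C.π γ).p * (C.π γ).deg) (fun γ => (C.π γ).p * (C.π γ).deg) fun γ =>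
      towerMat ((C.π γ).p * (C.π γ).deg) (C.π γ).q (C.π γ).elt (C.π γ).initMat (l γ) (i γ) :=
  Fast.get_tab (w := fun γ i => (C.π γ).mat ((C.π γ).p * (C.π γ).deg) ((C.π γ).p * (C.π γ).deg)
    (FRS.towerMat ((C.π γ).p * (C.π γ).deg) (C.π γ).q (C.π γ).elt (C.π γ).initMat (l γ) i))
    (Fast.towerMat hl hlk) hi fun γ => Nat.lt_succ_of_le (hik γ)

theorem FMat.normMat {l : C.Γ → ℕ} {f : ∀ γ : C.Γ, Polynomial (C.π γ).F} (hl : FN C l)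
    (hlk : ∀ γ, l γ ≤ (C.π γ).k + 1) (hf : FPoly C f) :
    FMat C (fun γ => (C.π γ).p * (C.π γ).deg) (fun γ => (C.π γ).p * (C.π γ).deg) fun γ =>
      normMat ((C.π γ).p * (C.π γ).deg) (C.π γ).q (C.π γ).elt (C.π γ).initMat (C.π γ).k (l γ)
        (f γ) := by
  let C2 := (C.ix fun γ => (C.π γ).p * (C.π γ).deg).ix fun p => (C.π p.1).p * (C.π p.1).deg
  have hx : FN C2 fun p => (p.1.2 : ℕ) := (FN.index FN.width).wk
  have hy : FN C2 fun p => (p.2 : ℕ) := FN.index FN.width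
  refine FMat.of FN.width FN.width (.sub ?_ (.sum (t := fun (p : C2.Γ) i => (f p.1.1).coeff i *
    FRS.towerMat ((C2.π p).p * (C2.π p).deg) (C2.π p).q (C2.π p).elt (C2.π p).initMat (l p.1.1) i
      p.1.2 p.2) FN.k.succ (.mul ?_ ?_)))
  · exact (FMat.towerMat hl hlk FN.k.succ fun _ => le_rfl).wk.wk.get hx (fun p => p.1.2.2) hy
      fun p => p.2.2
  · exact hf.wk.wk.wk.get (FN.index FN.k.succ) fun p => p.2.2
  · exact (FMat.towerMat (C := C2.ix fun p => (C2.π p).k + 1) hl.wk.wk.wk (fun p => hlk _)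
      (FN.index FN.k.succ) fun p => p.2.2.le).get hx.wk (fun p => p.1.1.2.2) hy.wk fun p => p.1.2.2

theorem FB.test {l : C.Γ → ℕ} {f : ∀ γ : C.Γ, Polynomial (C.π γ).F} (hl : FN C l)
    (hlk : ∀ γ, l γ ≤ (C.π γ).k + 1) (hf : FPoly C f) : FB C fun γ => (C.π γ).test (l γ) (f γ) :=
  FB.exists_ker FN.width (FMat.normMat hl hlk hf)

theorem FN.hits {f : ∀ γ : C.Γ, Polynomial (C.π γ).F} (hf : FPoly C f) :
    FN C fun γ => (C.π γ).hits (f γ) := by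
  let C1 := C.ix fun γ => (C.π γ).N
  let C2 := C1.ix fun p => (C1.π p).m
  have hs : FN C2 fun p => (p.1.2 : ℕ) * (C2.π p).m + p.2 :=
    ((FN.index FN.N).wk.mul FN.m).add (FN.index FN.m)
  refine FN.sum (t := fun γ j => if ∀ l < (C.π γ).m, ∑ i ∈ Finset.range ((C.π γ).k + 1),
    (f γ).coeff i * (((C.π γ).γ : (C.π γ).F) ^ (j * (C.π γ).m + l)) ^ i =
      unfold (C.π γ).z ((j * (C.π γ).m + l) % (C.π γ).n) then 1 else 0) FN.N
        (.ite (.all (C := C1) (d := fun p => (C1.π p).m) (p := fun x l =>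
          ∑ i ∈ Finset.range ((C1.π x).k + 1), (f x.1).coeff i *
            (((C1.π x).γ : (C1.π x).F) ^ (x.2 * (C1.π x).m + l)) ^ i =
              unfold (C1.π x).z ((x.2 * (C1.π x).m + l) % (C1.π x).n)) FN.m
                (.eqE ?_ ?_)) (.const 1) (.const 0))
  · exact .sum (C := C2) (t := fun x i => (f x.1.1).coeff i * (((C2.π x).γ : (C2.π x).F) ^
      (x.1.2 * (C2.π x).m + x.2)) ^ i) FN.k.succ (.mul (hf.wk.wk.wk.get (FN.index FN.k.succ)
        fun p => p.2.2) (.pow (.pow .gen hs.wk) (FN.index FN.k.succ)))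
  · exact .unfold (hs.mod FN.n) fun p =>
      Nat.mod_lt _ (lt_of_lt_of_le (by norm_num) (C2.π p).three_le)

theorem FB.accept {l : C.Γ → ℕ} {f : ∀ γ : C.Γ, Polynomial (C.π γ).F} (hl : FN C l)
    (hlk : ∀ γ, l γ ≤ (C.π γ).k + 1) (hf : FPoly C f) :
    FB C fun γ => (C.π γ).accept (l γ) (f γ) :=
  ((FB.test hl hlk hf).and ((FB.eq hl (.const 0)).and (FB.le FN.t (.hits hf)).not).not).congr
    fun γ => by rw [Setting.accept, not_and, not_not]

theorem Fast.extendBy {P : ∀ γ : C.Γ, Polynomial (C.π γ).F → Prop} {j : C.Γ → ℕ}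
    {l : ∀ γ : C.Γ, List (Polynomial (C.π γ).F)} (hd : FN C d) (hj : FN C j)
    (hl : Fast C fun γ => (C.π γ).polys (l γ))
    (hP : ∀ f : ∀ x : (C.ix d).Γ, Polynomial (C.π x.1).F, FPoly (C.ix d) f →
      FB (C.ix d) fun x => P x.1 (f x)) :
    Fast C fun γ => (C.π γ).polys (extendBy (P γ) (C.π γ).q (C.π γ).elt (j γ) (l γ) (d γ)) := by
  classical
  let C1 := C.ix d
  have hi : FN C1 fun x => (x.2 : ℕ) := FN.index hd
  have hdiv : FN C1 fun x => (x.2 : ℕ) / (C1.π x).q := hi.div FN.q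
  have hlt : FB C1 fun x => (x.2 : ℕ) / (C1.π x).q < (l x.1).length :=
    (FB.ne_nil (hl.wk.drop hdiv)).congr fun x => ((C1.π x).drop_polys_ne_nil).symm
  have hg : FPoly C1 fun x => (l x.1).getD ((x.2 : ℕ) / (C1.π x).q) 0 := by
    refine (Fast.ite hlt (hl.wk.get hdiv) (FVec.of (C := C1) (v := fun _ _ => 0) FN.k.succ
      FE.zero)).congr fun x => ?_
    split_ifs with h
    · exact ((C1.π x).get_polys h).symm
    · show (C1.π x).vec _ ((l x.1).getD _ 0).coeff = _
      rw [List.getD_eq_default _ _ (not_lt.1 h)]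
      rfl
  have hf : FPoly C1 fun x => (l x.1).getD ((x.2 : ℕ) / (C1.π x).q) 0 +
      Polynomial.monomial (j x.1) ((C1.π x).elt (x.2 % (C1.π x).q)) := by
    refine FVec.of FN.k.succ ((FE.add (hg.wk.get (FN.index FN.k.succ) fun p => p.2.2)
      (.ite (.eq hj.wk.wk (FN.index FN.k.succ)) (.elt (hi.mod FN.q).wk fun p =>
        Nat.mod_lt _ q_pos) .zero)).congr fun p => ?_)
    rw [Polynomial.coeff_add, Polynomial.coeff_monomial]
  refine Fast.iter (s := fun γ b => (C.π γ).polys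
    (FRS.extendBy (P γ) (C.π γ).q (C.π γ).elt (j γ) (l γ) b)) hd .nil ?_
  refine (Fast.ite (hlt.and (hP _ hf)).toSt (Fast.cons (Fast.toSt hf) .state) .state).congr
    fun x => ?_
  rw [FRS.extendBy]
  split_ifs with h
  · rw [polys, List.map_cons, ofList, encPoly_eq]
    rfl
  · rfl

theorem Fast.messages : Fast C fun γ => (C.π γ).polys (C.π γ).messages := by
  refine Fast.iter (s := fun γ i => (C.π γ).polys (search (C.π γ).q (C.π γ).elt (C.π γ).accept
    (C.π γ).B (C.π γ).k i)) FN.k.succ ?_ ?_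
  · refine (Fast.cons (FVec.of (v := fun _ _ => 0) FN.k.succ FE.zero) .nil).congr fun γ => ?_
    rw [search, polys, List.map_singleton, encPoly_eq]
    rfl
  · let C1 := C.st (fun γ => (C.π γ).k + 1) fun γ i => (C.π γ).polys (search (C.π γ).q (C.π γ).elt
      (C.π γ).accept (C.π γ).B (C.π γ).k i)
    have hj : FN C1 fun x => (C1.π x).k - x.2 := FN.k.sub (FN.index FN.k.succ).toSt
    exact Fast.extendBy (C := C1) (P := fun x => (C1.π x).accept ((C1.π x).k - x.2))
      (FN.B.mul FN.q) hj .state fun f hf => FB.accept hj.wk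
        (fun x => (Nat.sub_le _ _).trans (Nat.le_succ _)) hf

theorem Fast.terms : Fast C fun γ => encTerms (C.π γ).e (C.π γ).terms := by
  refine (Fast.tab (w := fun γ u => DataTree.cons (DataTree.tab ((C.π γ).s + 1)
    fun i => ofNat ((C.π γ).expo u i)) (encElem (C.π γ).e ((C.π γ).sol u))) FN.monomials
      (.cons ?_ ?_)).congr fun γ => (C.π γ).encTerms_terms
  · let C1 := C.ix fun γ => (C.π γ).len
    exact Fast.tab (C := C1) (w := fun x i => ofNat ((C1.π x).expo x.2 i)) FN.s.succ
      (FN.expo (FN.index FN.monomials).wk (FN.index FN.s.succ) fun p => Nat.lt_succ_iff.1 p.2.2).fast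
  · exact FVec.get FVec.sol.wk (FN.index FN.monomials) fun p => p.2.2

/-- One program carries out the decoder in time polynomial in `n ^ s`. -/
theorem exists_prog : ∃ (P : Prog) (c : ℕ), ∀ S : Setting.{u}, ∃ steps ≤ (S.budget + 2) ^ c,
    Run P S.input (encOutput S.e S.k S.terms S.messages) steps := by
  have h : Fast Ctx.base.{u} fun S => encOutput S.e S.k S.terms S.messages :=
    Fast.cons (Fast.terms (C := Ctx.base)) (Fast.messages (C := Ctx.base))
  obtain ⟨P, τ, ⟨c, hc⟩, hP⟩ := h
  refine ⟨P, c, fun S => ?_⟩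
  obtain ⟨n, hn, hrun⟩ := hP S
  exact ⟨n, hn.trans (hc S), hrun⟩

end FRS

theorem mainTheorem3 :
    ∃ (P : FRS.Prog) (C : ℕ),
      ∀ (F : Type*) [Field F] [Fintype F] [DecidableEq F] (γ : Fˣ)
        (_hγ : ∀ x : Fˣ, x ∈ Subgroup.zpowers γ)
        (m k s r t : ℕ) (_hm : 1 ≤ m) (_hk : 1 ≤ k) (_hs : 1 ≤ s) (_hsm : s ≤ m) (_hr : 1 ≤ r)
        (_htN : t ≤ FRS.blockLength F m)
        (_ht : ((FRS.blockLength F m : ℝ) * ((k : ℝ) / ((m : ℝ) - (s : ℝ) + 1)) ^ s *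
            ∏ j ∈ Finset.Icc 1 s, (1 + (j : ℝ) / (r : ℝ))) ^ ((1 : ℝ) / ((s : ℝ) + 1)) + 2
              ≤ (t : ℝ))
        (z : Fin (FRS.blockLength F m) → Fin m → F),
        -- the interpolation step is feasible
        (∃ Q, FRS.IsInterpolant γ k s r z Q) ∧
        -- every run of the decoder outputs exactly the codewords within distance `N - t` of `z`,
        -- and at most `|F|^s` of them
        (∀ Q L, FRS.IsDecoderRun γ k s r t z Q L →
          (∀ c, c ∈ L.map (FRS.encode γ m) ↔
            c ∈ FRS.code γ m k ∧ hammingDist c z ≤ FRS.blockLength F m - t) ∧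
          L.length ≤ Fintype.card F ^ s) ∧
        -- if `D / k < |F|`, the program carries out such a run in `n^(O(s))` steps
        (FRS.interpDegree F m k s r < k * Fintype.card F →
          ∀ e : F ≃ Fin (Fintype.card F), ∃ T L steps,
            FRS.IsDecoderRun γ k s r t z (FRS.ofTerms T) L ∧
            FRS.Run P (FRS.encInput e γ k s r t z) (FRS.encOutput e k T L) steps ∧
            steps ≤ FRS.unfoldedLength F m ^ (C * s)) := by
  obtain ⟨P, c, hP⟩ := FRS.exists_prog
  refine ⟨P, 2 * c, fun F _ _ _ γ hγ m k s r t hm hk hs hsm hr htN ht z => ?_⟩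
  obtain ⟨ht3, hDt, hN, hkN⟩ := FRS.parameter_bounds hk hsm hr htN ht
  refine ⟨FRS.exists_interpolates γ hk hr (FRS.degreeRadicand_lt m k s r) z, fun Q L h =>
    ⟨h.mem_map_iff hγ hs hsm htN hDt, h.length_le hγ hk hs hsm htN ht3 hN hkN⟩, fun hD e => ?_⟩
  have hkn : k < FRS.unfoldedLength F m := hkN.trans_le (Nat.mul_le_mul_left _ (by omega))
  have h3 : 3 ≤ FRS.unfoldedLength F m := (ht3.trans htN).trans (Nat.le_mul_of_pos_right _ hm)
  have hrD : r ≤ k * Fintype.card F :=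
    (FRS.le_interpDegree hk (by omega) r).trans hD.le
  let S : FRS.Setting :=
    { F := F, γ := γ, m := m, k := k, s := s, r := r, t := t, z := z, e := e, one_le_k := hk,
      one_le_s := hs, s_le := hsm, t_le := htN, three_le := h3, k_lt := hkn, r_le := hrD,
      one_le_r := hr, gen := hγ, interpDegree_lt := hD, interpDegree_lt_agreement := hDt }
  obtain ⟨steps, hsteps, hrun⟩ := hP S
  refine ⟨S.terms, S.messages, steps, S.isDecoderRun, hrun, hsteps.trans ?_⟩
  have h4 : 3 ≤ FRS.unfoldedLength F m ^ s := h3.trans (Nat.le_self_pow (by omega) _)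
  calc (FRS.unfoldedLength F m ^ s + 2) ^ c
      ≤ ((FRS.unfoldedLength F m ^ s) ^ 2) ^ c := Nat.pow_le_pow_left (by nlinarith) c
    _ = FRS.unfoldedLength F m ^ (2 * c * s) := by rw [← pow_mul, ← pow_mul]; congr 1; ring
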